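/- **Setting.** Fix $K\ge 1$. For every $N\ge 1$ let $N_1+\dots+N_K=N$ be a partition of the $N$ coordinates into $K$ consecutive clusters, with index sets $\varsigma_1,\dots,\varsigma_K$ ($|\varsigma_k|=N_k$), let $M\ge 0$, and let $\mathbf A_j,\mathbf B_j\in\mathbb C^{N\times N^x_j}$ ($1\le j\le M$) and Hermitian nonnegative $\mathbf S_k\in\mathbb C^{N_k\times N_k}$ be deterministic; all of these, including $N_k$, $M$, $N_j^x$, may depend on $N$. For each $N$ let $\mathbf x_1,\dots,\mathbf x_M$ be independent, $\mathbf x_j\sim\mathcal{CN}(0,\mathbf I_{N^x_j})$ (all defined on one probability space, with arbitrary dependence between different $N$). Write $\mathbf R_{[k,l]}$ for the block of an $N\times N$ matrix with rows in $\varsigma_k$ and columns in $\varsigma_l$, $\mathbf A_{jk},\mathbf B_{jk}$ for the rows of $\mathbf A_j,\mathbf B_j$ in $\varsigma_k$, and $\boldsymbol\Omega_j=\mathbf A_j\mathbf A_j^H$. Let $$\mathbf X_k=\tfrac1{\sqrt{N_k}}[\mathbf A_{1k}\mathbf x_1,\dots,\mathbf A_{Mk}\mathbf x_M],\qquad \mathbf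 Y_k=\tfrac1{\sqrt{N_k}}[\mathbf B_{1k}\mathbf x_1,\dots,\mathbf B_{Mk}\mathbf x_M],\qquad \mathbf Q_k=(\mathbf X_k\mathbf X_k^H+\mathbf S_k-z_k\mathbf I_{N_k})^{-1},$$ with fixed $z_1,\dots,z_K<0$. Assume $0<\liminf_N N_k/M\le\limsup_N N_k/M<\infty$ for every $k$ (A.1) and $\limsup_N\max_{j}\{\|\mathbf A_j\|,\|\mathbf B_j\|\}<\infty$, where $\|\cdot\|$ is the spectral norm. For random $X_N$ and deterministic $\overline X_N$ write $X_N\asymp_{1/2}\overline X_N$ if $X_N$ is integrable, $|\mathbb E X_N-\overline X_N|=O(N^{-1/2})$ and $|X_N-\overline X_N|/N\to0$ almost surely as $N\to\infty$. **Claim.** (i) For all $N$ and $k$ the system $$\delta_{jk}=\tfrac1{N_k}\operatorname{Tr}[\boldsymbol\Omega_j]_{[k,k]}\boldsymbol\Theta_k\ (1\le j\le M),\qquad \boldsymbol\Theta_k=\Big(-z_k\mathbf I_{N_k}+\mathbf S_k+\tfrac1{N_k}\sum_{j=1}^M\tfrac{[\boldsymbol\Omega_j]_{[k,k]}}{1+\delta_{jk}}\Big)^{-1}$$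 has exactly one solution with all $\delta_{jk}\ge0$, and $\delta_{jk}>0$ whenever $[\boldsymbol\Omega_j]_{[k,k]}\neq0$. With this solution put $\widetilde{\mathbf F}_k=\operatorname{diag}((1+\delta_{jk})^{-1})_j$ and, for $P,O\in\{A,B\}$ and $\boldsymbol{\mathcal A}\in\mathbb C^{N_l\times N_k}$, $\boldsymbol{\mathcal B}\in\mathbb C^{N_k\times N_l}$, $$[\boldsymbol\Gamma_{kl}]_{ij}=\tfrac{1}{N_kN_l}\operatorname{Tr}[\boldsymbol\Omega_i]_{[l,k]}\boldsymbol\Theta_k[\boldsymbol\Omega_j]_{[k,l]}\boldsymbol\Theta_l,\qquad \boldsymbol\Xi_{kl}=(\mathbf I_M-\boldsymbol\Gamma_{kl}\widetilde{\mathbf F}_k\widetilde{\mathbf F}_l)^{-1},$$ $$[\widetilde{\boldsymbol\lambda}_{kl}(\boldsymbol{\mathcal A})]_j=\tfrac{\operatorname{Tr}\boldsymbol{\mathcal A}\boldsymbol\Theta_k[\boldsymbol\Omega_j]_{[k,l]}\boldsymbol\Theta_l}{\sqrt{N_kN_l}},\quad [\widetilde{\boldsymbol\lambda}_{P,O,kl}(\boldsymbol{\mathcal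 A})]_j=\tfrac{\operatorname{Tr}\boldsymbol{\mathcal A}\boldsymbol\Theta_k\mathbf P_{jk}\mathbf O_{jl}^H\boldsymbol\Theta_l}{\sqrt{N_kN_l}}\quad\text{(row vectors)},$$ $$[\boldsymbol\lambda_{kl}(\boldsymbol{\mathcal B})]_j=\tfrac{\operatorname{Tr}[\boldsymbol\Omega_j]_{[l,k]}\boldsymbol\Theta_k\boldsymbol{\mathcal B}\boldsymbol\Theta_l}{\sqrt{N_kN_l}}\quad\text{(column vector)},$$ $$[\boldsymbol\Lambda_{P,O,kl}]_{ij}=\tfrac1{N_kN_l}\operatorname{Tr}[\boldsymbol\Omega_i]_{[l,k]}\boldsymbol\Theta_k\mathbf P_{jk}\mathbf O_{jl}^H\boldsymbol\Theta_l,\qquad \mathbf D_{P,O,k}=\tfrac1{N_k}\operatorname{diag}(\operatorname{Tr}\mathbf P_{jk}\mathbf O_{jk}^H\boldsymbol\Theta_k)_j .$$ (ii) $\mathbf I_M-\boldsymbol\Gamma_{kl}\widetilde{\mathbf F}_k\widetilde{\mathbf F}_l$ is invertible for all $N,k,l$. (iii) For all $k,l$ and all deterministic sequences of matrices $\boldsymbol{\mathcal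 A},\boldsymbol{\mathcal B}$ of the appropriate sizes and of vectors $\mathbf b\in\mathbb C^M$ such that $\|\boldsymbol{\mathcal A}\|,\|\boldsymbol{\mathcal B}\|,\|\operatorname{diag}(\mathbf b)\|$ are bounded uniformly in $N$, $$\operatorname{Tr}\boldsymbol{\mathcal A}\mathbf Q_k\asymp_{1/2}\operatorname{Tr}\boldsymbol{\mathcal A}\boldsymbol\Theta_k,$$ $$\operatorname{Tr}\boldsymbol{\mathcal A}\mathbf Q_k\mathbf X_k\operatorname{diag}(\mathbf b)\mathbf Y_l^H\asymp_{1/2}\overline\Phi_{B,kl}:=\frac1{\sqrt{N_kN_l}}\sum_{j=1}^M[\widetilde{\mathbf F}_k\mathbf b]_j\operatorname{Tr}\boldsymbol{\mathcal A}\boldsymbol\Theta_k\mathbf A_{jk}\mathbf B_{jl}^H,$$ $$\operatorname{Tr}\boldsymbol{\mathcal A}\mathbf Q_k\boldsymbol{\mathcal B}\mathbf Q_l\asymp_{1/2}\operatorname{Tr}\boldsymbol{\mathcal A}\boldsymbol\Theta_k\boldsymbol{\mathcal B}\boldsymbol\Theta_l+\widetilde{\boldsymbol\lambda}_{kl}(\boldsymbol{\mathcal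 A})\widetilde{\mathbf F}_k\widetilde{\mathbf F}_l\boldsymbol\Xi_{kl}\boldsymbol\lambda_{kl}(\boldsymbol{\mathcal B}),$$ $$\operatorname{Tr}\boldsymbol{\mathcal A}\mathbf Q_k\mathbf Y_k\mathbf Y_l^H\mathbf Q_l\asymp_{1/2}\overline\Pi_{B,kl},$$ where $$\overline\Pi_{B,kl}=\big[\widetilde{\boldsymbol\lambda}_{B,B,kl}(\boldsymbol{\mathcal A})-\widetilde{\boldsymbol\lambda}_{B,A,kl}(\boldsymbol{\mathcal A})\mathbf D_{A,B,l}\widetilde{\mathbf F}_l-\widetilde{\boldsymbol\lambda}_{A,B,kl}(\boldsymbol{\mathcal A})\mathbf D_{B,A,k}\widetilde{\mathbf F}_k\big]\mathbf 1_M$$ $$\quad+\widetilde{\boldsymbol\lambda}_{kl}(\boldsymbol{\mathcal A})\widetilde{\mathbf F}_k\widetilde{\mathbf F}_l\boldsymbol\Xi_{kl}\big[\boldsymbol\Lambda_{B,B,kl}-\boldsymbol\Lambda_{B,A,kl}\mathbf D_{A,B,l}\widetilde{\mathbf F}_l-\boldsymbol\Lambda_{A,B,kl}\mathbf D_{B,A,k}\widetilde{\mathbf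 F}_k+\mathbf D_{B,A,k}\mathbf D_{A,B,l}\big]\mathbf 1_M .$$ Moreover $\operatorname{Tr}\boldsymbol{\mathcal A}\mathbf Q_k\mathbf X_k\operatorname{diag}(\mathbf b)\mathbf X_l^H$ and $\operatorname{Tr}\boldsymbol{\mathcal A}\mathbf Q_k\mathbf X_k\mathbf X_l^H\mathbf Q_l$ are $\asymp_{1/2}$-equivalent to the expressions obtained from $\overline\Phi_{B,kl}$ and $\overline\Pi_{B,kl}$ by replacing every $\mathbf B_j$ by $\mathbf A_j$. -/

import Mathlib

open MeasureTheory ProbabilityTheory Filter Asymptotics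
open scoped Matrix Topology ENNReal NNReal ComplexOrder Matrix.Norms.L2Operator

/-- The circularly symmetric law `CN(0, 1)` on `ℂ`: real and imaginary parts are independent, each
with law `N(0, 1/2)`. -/
noncomputable def stdComplexGaussian : Measure ℂ :=
  ((gaussianReal 0 (1 / 2)).prod (gaussianReal 0 (1 / 2))).map Complex.measurableEquivRealProd.symm

/-- The law `CN(0, I_d)` on `ℂ^d`. -/
noncomputable def stdComplexGaussianVec (d : ℕ) : Measure (Fin d → ℂ) :=
  Measure.pi fun _ => stdComplexGaussian

/-- `X_N ≍_l X̄_N`: the expectations (which exist) are within `O(N^{-l})` of `X̄_N`, and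
`|X_N - X̄_N| / N → 0` almost surely. -/
def StochEquiv {Ω : Type*} [MeasurableSpace Ω] (P : Measure Ω) (l : ℝ)
    (X : ℕ → Ω → ℂ) (Xbar : ℕ → ℂ) : Prop :=
  (∀ N, Integrable (X N) P) ∧
  ((fun N : ℕ => ‖(∫ ω, X N ω ∂P) - Xbar N‖) =O[atTop] fun N : ℕ => (N : ℝ) ^ (-l)) ∧
  ∀ᵐ ω ∂P, Tendsto (fun N : ℕ => ‖X N ω - Xbar N‖ / (N : ℝ)) atTop (𝓝 0)

/-- The deterministic data in dimension `N`: the partition `N = N_1 + ⋯ + N_K` into `K` clusters,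
the number `M` of columns, the lengths `d j` of the Gaussian vectors `x_j`, the correlation
matrices `A_j`, `B_j` of size `N × d j`, and the Hermitian nonnegative matrices `S_k`. -/
structure Setup (K N : ℕ) where
  n : Fin K → ℕ
  sum_n : ∑ k, n k = N
  M : ℕ
  d : Fin M → ℕ
  A : ∀ j : Fin M, Matrix (Fin N) (Fin (d j)) ℂ
  B : ∀ j : Fin M, Matrix (Fin N) (Fin (d j)) ℂ
  S : ∀ k : Fin K, Matrix (Fin (n k)) (Fin (n k)) ℂ
  S_nonneg : ∀ k : Fin K, (S k).PosSemidef

namespace Setup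

variable {K N : ℕ} (D : Setup K N)

/-- A family of correlation matrices, such as `A = (A_j)_j` or `B = (B_j)_j`. -/
abbrev Corr : Type := ∀ j : Fin D.M, Matrix (Fin N) (Fin (D.d j)) ℂ

/-- The values of the vectors `x_1, …, x_M`. -/
abbrev Sample : Type := ∀ j : Fin D.M, Fin (D.d j) → ℂ

/-- The index vector of cluster `k`: the `k`-th of the consecutive intervals of lengths
`N_1, …, N_K` in `{1, …, N}`. -/
def idx (k : Fin K) (i : Fin (D.n k)) : Fin N :=
  Fin.cast D.sum_n (finSigmaFinEquiv ⟨k, i⟩)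

/-- The rows of `R` with index in cluster `k`. -/
def rows {m : Type} (R : Matrix (Fin N) m ℂ) (k : Fin K) : Matrix (Fin (D.n k)) m ℂ :=
  R.submatrix (D.idx k) id

/-- The block `[R]_{[k, l]}`. -/
def block (R : Matrix (Fin N) (Fin N) ℂ) (k l : Fin K) :
    Matrix (Fin (D.n k)) (Fin (D.n l)) ℂ :=
  R.submatrix (D.idx k) (D.idx l)

/-- `Ω_j = A_j A_jᴴ`. -/
noncomputable def Om (j : Fin D.M) : Matrix (Fin N) (Fin N) ℂ := D.A j * (D.A j)ᴴ

/-- `√(N_k N_l)` -/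
noncomputable def sqrtNN (k l : Fin K) : ℂ := ((Real.sqrt ((D.n k : ℝ) * (D.n l : ℝ)) : ℝ) : ℂ)

/-! ### Random quantities -/

/-- For a family `P` of correlation matrices, the matrix `N_k^{-1/2} [P_1 x_1, …, P_M x_M]`
restricted to the rows of cluster `k`: it is `X_k` for `P = A` and `Y_k` for `P = B`. -/
noncomputable def colMat (P : D.Corr) (x : D.Sample) (k : Fin K) :
    Matrix (Fin (D.n k)) (Fin D.M) ℂ :=
  (1 / ((Real.sqrt (D.n k : ℝ) : ℝ) : ℂ)) •
    D.rows (Matrix.of fun (i : Fin N) (j : Fin D.M) => (P j *ᵥ x j) i) k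

/-- `X_k` -/
noncomputable def X (x : D.Sample) (k : Fin K) : Matrix (Fin (D.n k)) (Fin D.M) ℂ :=
  D.colMat D.A x k

/-- The resolvent `Q_k = (X_k X_kᴴ + S_k - z_k I)⁻¹`. -/
noncomputable def Q (z : Fin K → ℝ) (x : D.Sample) (k : Fin K) :
    Matrix (Fin (D.n k)) (Fin (D.n k)) ℂ :=
  (D.X x k * (D.X x k)ᴴ + D.S k - ((z k : ℝ) : ℂ) • (1 : Matrix (Fin (D.n k)) (Fin (D.n k)) ℂ))⁻¹

/-- `Tr 𝒜 Q_k` -/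
noncomputable def digamma (z : Fin K → ℝ) (k : Fin K)
    (a : Matrix (Fin (D.n k)) (Fin (D.n k)) ℂ) (x : D.Sample) : ℂ :=
  (a * D.Q z x k).trace

/-- `Tr 𝒜 Q_k X_k diag(b) Y_lᴴ`, where `Y_l` is built from the family `P`. -/
noncomputable def Phi (P : D.Corr) (z : Fin K → ℝ) (k l : Fin K)
    (a : Matrix (Fin (D.n l)) (Fin (D.n k)) ℂ) (b : Fin D.M → ℂ) (x : D.Sample) : ℂ :=
  (a * D.Q z x k * D.X x k * Matrix.diagonal b * (D.colMat P x l)ᴴ).trace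

/-- `Tr 𝒜 Q_k 𝓑 Q_l` -/
noncomputable def Upsilon (z : Fin K → ℝ) (k l : Fin K)
    (a : Matrix (Fin (D.n l)) (Fin (D.n k)) ℂ) (b : Matrix (Fin (D.n k)) (Fin (D.n l)) ℂ)
    (x : D.Sample) : ℂ :=
  (a * D.Q z x k * b * D.Q z x l).trace

/-- `Tr 𝒜 Q_k Y_k Y_lᴴ Q_l`, where `Y_k`, `Y_l` are built from the family `P`. -/
noncomputable def Pi (P : D.Corr) (z : Fin K → ℝ) (k l : Fin K)
    (a : Matrix (Fin (D.n l)) (Fin (D.n k)) ℂ) (x : D.Sample) : ℂ :=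
  (a * D.Q z x k * D.colMat P x k * (D.colMat P x l)ᴴ * D.Q z x l).trace

/-! ### Deterministic quantities -/

/-- `(-z_k I + S_k + N_k⁻¹ ∑_j [Ω_j]_{[k,k]} / (1 + δ_j))⁻¹` -/
noncomputable def ThetaOf (z : Fin K → ℝ) (k : Fin K) (δ : Fin D.M → ℝ) :
    Matrix (Fin (D.n k)) (Fin (D.n k)) ℂ :=
  (-((z k : ℝ) : ℂ) • (1 : Matrix (Fin (D.n k)) (Fin (D.n k)) ℂ) + D.S k +
    (1 / (D.n k : ℂ)) • ∑ j, (1 / (1 + ((δ j : ℝ) : ℂ))) • D.block (D.Om j) k k)⁻¹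

/-- `(δ_{jk})_j` is a nonnegative solution of the fixed-point system of cluster `k`. -/
def IsSolution (z : Fin K → ℝ) (k : Fin K) (δ : Fin D.M → ℝ) : Prop :=
  ∀ j, 0 ≤ δ j ∧
    ((δ j : ℝ) : ℂ) = 1 / (D.n k : ℂ) * (D.block (D.Om j) k k * D.ThetaOf z k δ).trace

variable (z : Fin K → ℝ) (δ : Fin K → Fin D.M → ℝ)

/-- `Θ_k` -/
noncomputable def Theta (k : Fin K) : Matrix (Fin (D.n k)) (Fin (D.n k)) ℂ :=
  D.ThetaOf z k (δ k)

/-- `F̃_k` -/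
noncomputable def F (k : Fin K) : Matrix (Fin D.M) (Fin D.M) ℂ :=
  Matrix.diagonal fun j => (1 + ((δ k j : ℝ) : ℂ))⁻¹

/-- `Γ_{kl}` -/
noncomputable def Gam (k l : Fin K) : Matrix (Fin D.M) (Fin D.M) ℂ :=
  Matrix.of fun i j => 1 / ((D.n k : ℂ) * (D.n l : ℂ)) *
    (D.block (D.Om i) l k * D.Theta z δ k * D.block (D.Om j) k l * D.Theta z δ l).trace

/-- `Ξ_{kl}` -/
noncomputable def Xi (k l : Fin K) : Matrix (Fin D.M) (Fin D.M) ℂ :=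
  (1 - D.Gam z δ k l * D.F δ k * D.F δ l)⁻¹

/-- `λ̃_{kl}(𝒜)`, a row vector -/
noncomputable def lamT (k l : Fin K) (a : Matrix (Fin (D.n l)) (Fin (D.n k)) ℂ) :
    Fin D.M → ℂ :=
  fun j => 1 / D.sqrtNN k l *
    (a * D.Theta z δ k * D.block (D.Om j) k l * D.Theta z δ l).trace

/-- `λ̃_{P,O,kl}(𝒜)`, a row vector -/
noncomputable def lamTPO (P O : D.Corr) (k l : Fin K)
    (a : Matrix (Fin (D.n l)) (Fin (D.n k)) ℂ) : Fin D.M → ℂ :=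
  fun j => 1 / D.sqrtNN k l *
    (a * D.Theta z δ k * D.rows (P j) k * (D.rows (O j) l)ᴴ * D.Theta z δ l).trace

/-- `λ_{kl}(𝓑)`, a column vector -/
noncomputable def lam (k l : Fin K) (b : Matrix (Fin (D.n k)) (Fin (D.n l)) ℂ) :
    Fin D.M → ℂ :=
  fun j => 1 / D.sqrtNN k l *
    (D.block (D.Om j) l k * D.Theta z δ k * b * D.Theta z δ l).trace

/-- `Λ_{P,O,kl}` -/
noncomputable def LamPO (P O : D.Corr) (k l : Fin K) : Matrix (Fin D.M) (Fin D.M) ℂ :=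
  Matrix.of fun i j => 1 / ((D.n k : ℂ) * (D.n l : ℂ)) *
    (D.block (D.Om i) l k * D.Theta z δ k * D.rows (P j) k * (D.rows (O j) l)ᴴ *
      D.Theta z δ l).trace

/-- `D_{P,O,k}` -/
noncomputable def DPO (P O : D.Corr) (k : Fin K) : Matrix (Fin D.M) (Fin D.M) ℂ :=
  Matrix.diagonal fun j => 1 / (D.n k : ℂ) *
    (D.rows (P j) k * (D.rows (O j) k)ᴴ * D.Theta z δ k).trace

/-- The equivalent of `Tr 𝒜 Q_k`. -/
noncomputable def digammaBar (k : Fin K) (a : Matrix (Fin (D.n k)) (Fin (D.n k)) ℂ) : ℂ :=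
  (a * D.Theta z δ k).trace

/-- The equivalent of `Tr 𝒜 Q_k X_k diag(b) Y_lᴴ`, where `Y_l` is built from the family `P`. -/
noncomputable def PhiBar (P : D.Corr) (k l : Fin K)
    (a : Matrix (Fin (D.n l)) (Fin (D.n k)) ℂ) (b : Fin D.M → ℂ) : ℂ :=
  (∑ j, (D.F δ k *ᵥ b) j *
    (a * D.Theta z δ k * D.rows (D.A j) k * (D.rows (P j) l)ᴴ).trace) / D.sqrtNN k l

/-- The equivalent of `Tr 𝒜 Q_k 𝓑 Q_l`. -/
noncomputable def UpsilonBar (k l : Fin K)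
    (a : Matrix (Fin (D.n l)) (Fin (D.n k)) ℂ) (b : Matrix (Fin (D.n k)) (Fin (D.n l)) ℂ) : ℂ :=
  (a * D.Theta z δ k * b * D.Theta z δ l).trace +
    (D.lamT z δ k l a ᵥ* (D.F δ k * D.F δ l * D.Xi z δ k l)) ⬝ᵥ D.lam z δ k l b

/-- The equivalent of `Tr 𝒜 Q_k Y_k Y_lᴴ Q_l`, where `Y_k`, `Y_l` are built from the family
`P`. -/
noncomputable def PiBar (P : D.Corr) (k l : Fin K)
    (a : Matrix (Fin (D.n l)) (Fin (D.n k)) ℂ) : ℂ :=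
  (D.lamTPO z δ P P k l a
      - D.lamTPO z δ P D.A k l a ᵥ* (D.DPO z δ D.A P l * D.F δ l)
      - D.lamTPO z δ D.A P k l a ᵥ* (D.DPO z δ P D.A k * D.F δ k)) ⬝ᵥ 1 +
    (D.lamT z δ k l a ᵥ* (D.F δ k * D.F δ l * D.Xi z δ k l *
      (D.LamPO z δ P P k l
        - D.LamPO z δ P D.A k l * D.DPO z δ D.A P l * D.F δ l
        - D.LamPO z δ D.A P k l * D.DPO z δ P D.A k * D.F δ k
        + D.DPO z δ P D.A k * D.DPO z δ D.A P l))) ⬝ᵥ 1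

end Setup

/-- Assumption A.1: `0 < liminf_N N_k / M ≤ limsup_N N_k / M < ∞` for every cluster `k`. -/
def ProportionalGrowth {K : ℕ} (D : ∀ N, Setup K N) : Prop :=
  ∀ k : Fin K,
    0 < liminf (fun N => (((D N).n k : ℕ) : ℝ≥0∞) / (((D N).M : ℕ) : ℝ≥0∞)) atTop ∧
    limsup (fun N => (((D N).n k : ℕ) : ℝ≥0∞) / (((D N).M : ℕ) : ℝ≥0∞)) atTop < ⊤

/-- `limsup_N max_j {‖A_j‖, ‖B_j‖} < ∞` for the spectral norm. -/
def BoundedCorrelation {K : ℕ} (D : ∀ N, Setup K N) : Prop :=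
  ∃ C : ℝ, ∀ᶠ N in atTop, ∀ j, ‖(D N).A j‖ ≤ C ∧ ‖(D N).B j‖ ≤ C

/-- In each dimension `N` the vectors `x_1, …, x_M` are independent with `x_j ∼ CN(0, I)`; nothing
is assumed on the joint law for different `N`. -/
def IsGaussianSample {K : ℕ} (D : ∀ N, Setup K N) {Ω : Type*} [MeasurableSpace Ω]
    (P : Measure Ω) (x : ∀ N, ∀ j : Fin (D N).M, Ω → Fin ((D N).d j) → ℂ) : Prop :=
  ∀ N, (∀ j, HasLaw (x N j) (stdComplexGaussianVec ((D N).d j)) P) ∧ iIndepFun (x N) P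

/-! Once the factor N_k^{-1/2} is absorbed into the correlation matrices, all blocks A_{jk}, B_{jk}
have norm at most β = O(N^{-1/2}), while N_k β², M β² and the inverse gaps 1/(-z_k) stay below a
constant B. Every estimate is non-asymptotic in B and β; the powers of B are not optimised, only
those of β matter.

Two Gaussian tools come from the rotation invariance of a pair (x, y) of independent copies:
integration by parts, 𝔼 L(x) f(x) = 𝔼 L(y) f'(x)[y] (`TameDeriv.integral_mul_eq`), and a Poincaré
inequality (`TameDeriv.integral_norm_sub_sq_le`). Write Q for the resolvent. Since ‖Xᴴ Q‖² ≤ B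
although X is unbounded, Poincaré shows that the traces of the theorem have variance O(1), that Tr
P_iᴴ Q R_i has standard deviation O(β²), and that a diagonal entry of Yᴴ Q Y' has standard deviation
O(β).

Integration by parts writes the mean of such an entry as 𝔼 Tr P_iᴴ Q R_i minus the mean of Tr(P_iᴴ Q
A_i) times the entry with A in place of P. The product decouples up to a covariance O(β³). For P = A
the equation can be solved, with denominator 1 + α_i, α_i = 𝔼 Tr A_iᴴ Q A_i. Inserted into the
resolvent identity between Q and Θ(α), this leaves M = O(β⁻²) errors of size β³, so 𝔼 Tr C Q = Tr C
Θ(α) + O(β); in particular α solves the fixed-point system up to O(β³).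

The system is stable. Sandwiching Θ = Θ Θ⁻¹ Θ bounds ∑_j ‖C ᴴ Θ A_j‖² / (1 + δ_j) (Frobenius norms)
by Tr Cᴴ Θ C, and Cauchy–Schwarz then bounds the rows of the difference operator, in the weights w_j
= √((1+δ_j)(1+δ'_j)), by √(δ_i δ'_i) at two solutions, hence by a fixed fraction of w_i
(`sum_norm_trace_div_weight_le`, `sum_norm_trace_div_le_contr`). This one estimate gives uniqueness,
existence by compactness, α - δ = O(β³), and, for a pair of clusters, the invertibility of I - Γ F̃
F̃. Together: `Bounded.norm_gMean_trace_mul_resolv_sub_le`.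

With two resolvents, integration by parts shows that u(D) = 𝔼 Tr C Q D Q' satisfies, up to O(β), an
affine equation closed in the numbers u(A_i A'_iᴴ). The vector λ̃ F̃ F̃ Ξ is the exact solution, and
the same weighted contraction compares the two (`Bounded.norm_pairMean_sub_pairExpr_le`). Putting
the result back into the integration by parts formula gives the equivalent of Tr 𝒜 Q_k Y_k Y_lᴴ Q_l
(`Bounded.norm_gMean_form2_sub_det_le`).

Finally, second moments about the equivalents are bounded and ∑ N⁻² converges, which gives almost
sure convergence after division by N whatever the joint law in N. -/

set_option linter.unusedSectionVars false

/-! ### Functions of polynomial growth and Gaussian integration -/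

/-- Continuous functions of at most polynomial growth. -/
def Tame {V F : Type*} [NormedAddCommGroup V] [NormedAddCommGroup F] (f : V → F) : Prop :=
  Continuous f ∧ ∃ (C : ℝ) (p : ℕ), 0 ≤ C ∧ ∀ v, ‖f v‖ ≤ C * (1 + ‖v‖) ^ p

namespace Tame

variable {V W F : Type*} [NormedAddCommGroup V] [NormedAddCommGroup W] [NormedAddCommGroup F]

theorem const (c : F) : Tame (fun _ : V => c) :=
  ⟨continuous_const, ‖c‖, 0, norm_nonneg _, by simp⟩

theorem bound_mono {f : V → F} {C : ℝ} {p q : ℕ} (hC : 0 ≤ C)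
    (h : ∀ v, ‖f v‖ ≤ C * (1 + ‖v‖) ^ p) (hpq : p ≤ q) (v : V) : ‖f v‖ ≤ C * (1 + ‖v‖) ^ q :=
  (h v).trans (by
    have : (1 : ℝ) ≤ 1 + ‖v‖ := by linarith [norm_nonneg v]
    gcongr)

theorem add {f g : V → F} (hf : Tame f) (hg : Tame g) : Tame (fun v => f v + g v) := by
  obtain ⟨cf, C, p, hC, hp⟩ := hf
  obtain ⟨cg, D, q, hD, hq⟩ := hg
  refine ⟨cf.add cg, C + D, max p q, by positivity, fun v => (norm_add_le _ _).trans ?_⟩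
  rw [add_mul]
  exact add_le_add (bound_mono hC hp (le_max_left _ _) v) (bound_mono hD hq (le_max_right _ _) v)

theorem neg {f : V → F} (hf : Tame f) : Tame (fun v => -f v) := by
  obtain ⟨cf, C, p, hC, hp⟩ := hf
  exact ⟨cf.neg, C, p, hC, by simpa using hp⟩

theorem sub {f g : V → F} (hf : Tame f) (hg : Tame g) : Tame (fun v => f v - g v) := by
  simpa [sub_eq_add_neg] using hf.add hg.neg

theorem sum {ι : Type*} (s : Finset ι) {f : ι → V → F} (hf : ∀ i ∈ s, Tame (f i)) :
    Tame (fun v => ∑ i ∈ s, f i v) := by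
  classical
  induction s using Finset.induction_on with
  | empty => simpa using const (V := V) (0 : F)
  | insert a s ha ih =>
    simp only [Finset.sum_insert ha]
    exact (hf a (by simp)).add (ih fun i hi => hf i (by simp [hi]))

theorem mul {R : Type*} [NormedRing R] {f g : V → R} (hf : Tame f) (hg : Tame g) :
    Tame (fun v => f v * g v) := by
  obtain ⟨cf, C, p, hC, hp⟩ := hf
  obtain ⟨cg, D, q, hD, hq⟩ := hg
  refine ⟨cf.mul cg, C * D, p + q, by positivity, fun v => (norm_mul_le _ _).trans ?_⟩
  calc ‖f v‖ * ‖g v‖ ≤ (C * (1 + ‖v‖) ^ p) * (D * (1 + ‖v‖) ^ q) :=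
        mul_le_mul (hp v) (hq v) (norm_nonneg _) (by positivity)
    _ = _ := by ring

theorem norm_sq {f : V → F} (hf : Tame f) : Tame (fun v => ‖f v‖ ^ 2) := by
  have h : Tame (fun v => ‖f v‖) := by
    obtain ⟨cf, C, p, hC, hp⟩ := hf
    exact ⟨cf.norm, C, p, hC, by simpa using hp⟩
  simpa [sq] using h.mul h

theorem comp {f : W → F} (hf : Tame f) {g : V → W} (hg : Continuous g) {a : ℝ}
    (ha : ∀ v, ‖g v‖ ≤ a * ‖v‖) : Tame (fun v => f (g v)) := by
  obtain ⟨cf, C, p, hC, hp⟩ := hf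
  refine ⟨cf.comp hg, C * (1 + |a|) ^ p, p, by positivity, fun v => (hp _).trans ?_⟩
  rw [mul_assoc, ← mul_pow]
  have h1 : ‖g v‖ ≤ |a| * ‖v‖ :=
    (ha v).trans (mul_le_mul_of_nonneg_right (le_abs_self a) (norm_nonneg v))
  gcongr
  nlinarith [norm_nonneg v, abs_nonneg a]

theorem comp_fst {f : V → F} (hf : Tame f) : Tame (fun v : V × W => f v.1) :=
  hf.comp continuous_fst (a := 1) fun v => by simpa using norm_fst_le v

theorem comp_snd {f : W → F} (hf : Tame f) : Tame (fun v : V × W => f v.2) :=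
  hf.comp continuous_snd (a := 1) fun v => by simpa using norm_snd_le v

theorem star {f : V → ℂ} (hf : Tame f) : Tame (fun v => star (f v)) := by
  obtain ⟨cf, C, p, hC, hp⟩ := hf
  exact ⟨cf.star, C, p, hC, by simpa using hp⟩

theorem of_clm [NormedSpace ℝ V] [NormedSpace ℝ F] (L : V →L[ℝ] F) : Tame (fun v => L v) :=
  ⟨L.continuous, ‖L‖, 1, norm_nonneg _, fun v => (L.le_opNorm v).trans (by
    rw [pow_one]; gcongr; linarith)⟩

variable [NormedSpace ℝ V] [MeasurableSpace V] [BorelSpace V] [SecondCountableTopology V]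
  [CompleteSpace V]

/-- Gaussian measures have moments of every order. -/
theorem integrable_one_add_norm_pow (μ : Measure V) [IsGaussian μ] (p : ℕ) :
    Integrable (fun v => (1 + ‖v‖) ^ p) μ := by
  have h := (IsGaussian.memLp_id μ p (by simp)).integrable_norm_pow'
  refine (((integrable_const (1 : ℝ)).add h).const_mul (2 ^ (p - 1) : ℝ)).mono'
    (by fun_prop) (Eventually.of_forall fun v => ?_)
  rw [Real.norm_of_nonneg (by positivity)]
  simpa using add_pow_le zero_le_one (norm_nonneg v) p

theorem integrable {f : V → F} (hf : Tame f) (μ : Measure V) [IsGaussian μ] :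
    Integrable f μ := by
  obtain ⟨cf, C, p, hC, hp⟩ := hf
  exact ((integrable_one_add_norm_pow μ p).const_mul C).mono' cf.aestronglyMeasurable
    (Eventually.of_forall hp)

end Tame

/-- Cauchy–Schwarz against a constant, by expanding the square of m‖g‖ - I. It serves both for
Lebesgue measure on a quarter turn and, with mass one, as Jensen's inequality. -/
theorem sq_integral_norm_le {α F : Type*} [MeasurableSpace α] (ν : Measure α) [IsFiniteMeasure ν]
    [NormedAddCommGroup F] {g : α → F} (hg : Integrable g ν)
    (hg2 : Integrable (fun a => ‖g a‖ ^ 2) ν) :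
    (∫ a, ‖g a‖ ∂ν) ^ 2 ≤ ν.real Set.univ * ∫ a, ‖g a‖ ^ 2 ∂ν := by
  set m := ν.real Set.univ with hm
  set I := ∫ a, ‖g a‖ ∂ν with hI
  have hm0 : 0 ≤ m := measureReal_nonneg
  have h0 : 0 ≤ ∫ a, (m * ‖g a‖ - I) ^ 2 ∂ν := integral_nonneg fun a => sq_nonneg _
  have hexp : ∫ a, (m * ‖g a‖ - I) ^ 2 ∂ν = m ^ 2 * (∫ a, ‖g a‖ ^ 2 ∂ν) - m * I ^ 2 := by
    have : ∀ a, (m * ‖g a‖ - I) ^ 2 = m ^ 2 * ‖g a‖ ^ 2 - 2 * m * I * ‖g a‖ + I ^ 2 := by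
      intro a; ring
    simp_rw [this]
    have h1 : Integrable (fun a => m ^ 2 * ‖g a‖ ^ 2) ν := hg2.const_mul _
    have h2 : Integrable (fun a => 2 * m * I * ‖g a‖) ν := hg.norm.const_mul _
    have h3 : Integrable (fun a => m ^ 2 * ‖g a‖ ^ 2 - 2 * m * I * ‖g a‖) ν := h1.sub h2
    rw [integral_add h3 (integrable_const _), integral_sub h1 h2, integral_const_mul,
      integral_const_mul, integral_const, ← hm, ← hI]
    simp only [smul_eq_mul]
    ring
  rcases hm0.eq_or_lt with h | h
  · have : ν = 0 := by
      rw [← Measure.measure_univ_eq_zero]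
      have := h.symm
      rw [hm, measureReal_def, ENNReal.toReal_eq_zero_iff] at this
      exact this.resolve_right (measure_ne_top _ _)
    simp [hI, this]
  · rw [hexp] at h0
    have : 0 ≤ m * (m * (∫ a, ‖g a‖ ^ 2 ∂ν) - I ^ 2) := by nlinarith
    nlinarith [nonneg_of_mul_nonneg_right this h]

/-- `f` is differentiable along curves, with directional derivative `f'`, and both are tame. -/
structure TameDeriv {E : Type*} [NormedAddCommGroup E] [NormedSpace ℝ E]
    (f : E → ℂ) (f' : E → E → ℂ) : Prop where
  tame : Tame f
  tame' : Tame (fun p : E × E => f' p.1 p.2)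
  hasDerivAt : ∀ (c : ℝ → E) (c' : E) (t : ℝ), HasDerivAt c c' t →
    HasDerivAt (fun s => f (c s)) (f' (c t) c') t

/-! ### Rotations of a pair of vectors -/

section Rotation

variable {E : Type*} [NormedAddCommGroup E] [NormedSpace ℝ E]

theorem norm_rotation_le (θ : ℝ) (p : E × E) :
    ‖ContinuousLinearMap.rotation θ p‖ ≤ 2 * ‖p‖ := by
  rw [ContinuousLinearMap.rotation_apply]
  have hc := Real.abs_cos_le_one θ
  have hs := Real.abs_sin_le_one θ
  have h1 := norm_fst_le p
  have h2 := norm_snd_le p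
  have key : ∀ a b : ℝ, |a| ≤ 1 → |b| ≤ 1 → ‖a • p.1 + b • p.2‖ ≤ 2 * ‖p‖ := by
    intro a b ha hb
    refine (norm_add_le _ _).trans ?_
    rw [norm_smul, norm_smul, Real.norm_eq_abs, Real.norm_eq_abs]
    nlinarith [norm_nonneg p.1, norm_nonneg p.2, abs_nonneg a, abs_nonneg b]
  exact max_le (key _ _ hc hs) (key _ _ (by rwa [abs_neg]) hc)

theorem hasDerivAt_rotation_fst (p : E × E) (θ : ℝ) :
    HasDerivAt (fun s => (ContinuousLinearMap.rotation s p).1)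
      (ContinuousLinearMap.rotation θ p).2 θ := by
  simp only [ContinuousLinearMap.rotation_apply]
  exact ((Real.hasDerivAt_cos θ).smul_const p.1).add ((Real.hasDerivAt_sin θ).smul_const p.2)

/-- The increment of `f` along a quarter turn. -/
theorem TameDeriv.norm_sub_sq_le {f : E → ℂ} {f' : E → E → ℂ} (hf : TameDeriv f f')
    (p : E × E) : ‖f p.2 - f p.1‖ ^ 2 ≤ Real.pi / 2 *
      ∫ θ in Set.Ioc 0 (Real.pi / 2), ‖f' (ContinuousLinearMap.rotation θ p).1
        (ContinuousLinearMap.rotation θ p).2‖ ^ 2 := by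
  have hpi : 0 ≤ Real.pi / 2 := by positivity
  have hgθ : Continuous (fun θ => f' (ContinuousLinearMap.rotation θ p).1
        (ContinuousLinearMap.rotation θ p).2) := by
    have h1 : Continuous (fun θ : ℝ => ContinuousLinearMap.rotation θ p) := by
      simp only [ContinuousLinearMap.rotation_apply]
      fun_prop
    exact hf.tame'.1.comp h1
  have h := intervalIntegral.integral_eq_sub_of_hasDerivAt (a := 0) (b := Real.pi / 2)
    (f := fun θ => f (ContinuousLinearMap.rotation θ p).1)
    (f' := fun θ => f' (ContinuousLinearMap.rotation θ p).1 (ContinuousLinearMap.rotation θ p).2)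
    (fun θ _ => hf.hasDerivAt _ _ θ (hasDerivAt_rotation_fst p θ))
    (hgθ.intervalIntegrable _ _)
  rw [intervalIntegral.integral_of_le hpi] at h
  have h0 : f p.2 - f p.1 = ∫ θ in Set.Ioc 0 (Real.pi / 2),
      f' (ContinuousLinearMap.rotation θ p).1 (ContinuousLinearMap.rotation θ p).2 := by
    rw [h]
    simp [ContinuousLinearMap.rotation_apply]
  rw [h0]
  have hνm : (volume.restrict (Set.Ioc 0 (Real.pi / 2))).real Set.univ = Real.pi / 2 := by
    simp [measureReal_def, Real.volume_Ioc, ENNReal.toReal_ofReal hpi]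
  have h1 := sq_integral_norm_le (volume.restrict (Set.Ioc 0 (Real.pi / 2)))
    (hgθ.integrableOn_Icc.mono_set Set.Ioc_subset_Icc_self)
    ((hgθ.norm.pow 2).integrableOn_Icc.mono_set Set.Ioc_subset_Icc_self)
  rw [hνm] at h1
  exact (pow_le_pow_left₀ (norm_nonneg _) (norm_integral_le_integral_norm _) 2).trans h1

end Rotation

/-! ### Gaussian integration by parts and the Poincaré inequality -/

section Gaussian

variable {E : Type*} [NormedAddCommGroup E] [NormedSpace ℝ E] [MeasurableSpace E] [BorelSpace E]
  [SecondCountableTopology E] [CompleteSpace E]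

theorem integral_comp_rotation {F : Type*} [NormedAddCommGroup F] [NormedSpace ℝ F]
    (μ : Measure E) [IsGaussian μ] (hμ : ∫ x, x ∂μ = 0)
    (θ : ℝ) {g : E × E → F} (hg : Continuous g) :
    ∫ p, g (ContinuousLinearMap.rotation θ p) ∂(μ.prod μ) = ∫ p, g p ∂(μ.prod μ) := by
  conv_rhs => rw [← IsGaussian.map_rotation_eq_self (μ := μ) (by simpa using hμ) θ]
  rw [integral_map (by fun_prop) hg.aestronglyMeasurable]

/-- Gaussian integration by parts. -/
theorem TameDeriv.integral_mul_eq {f : E → ℂ} {f' : E → E → ℂ} (hf : TameDeriv f f')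
    (μ : Measure E) [IsGaussian μ] (hμ : ∫ x, x ∂μ = 0) (L : E →L[ℝ] ℂ) :
    ∫ x, L x * f x ∂μ = ∫ p, L p.2 * f' p.1 p.2 ∂(μ.prod μ) := by
  obtain ⟨C, q, hC, hq⟩ := hf.tame'.2
  have hT : Tame (fun p : E × E => L p.2) := (Tame.of_clm L).comp_snd
  obtain ⟨D, r, hD, hr⟩ := hT.2
  have hG : ∀ θ, Continuous (fun p : E × E => L p.2 *
      f (ContinuousLinearMap.rotation θ p).1) := fun θ =>
    hT.1.mul (hf.tame.1.comp (continuous_fst.comp (ContinuousLinearMap.rotation θ).continuous))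
  -- The function θ ↦ 𝔼 L(y) f(cos θ · x + sin θ · y) is evaluated in two ways: here it is
  -- differentiated under the integral at θ = 0, and `heq` computes it in closed form.
  have hder : HasDerivAt (fun θ : ℝ => ∫ p, L p.2 * f (ContinuousLinearMap.rotation θ p).1
      ∂(μ.prod μ)) (∫ p, L p.2 * f' (ContinuousLinearMap.rotation 0 p).1
        (ContinuousLinearMap.rotation 0 p).2 ∂(μ.prod μ)) 0 := by
    refine (hasDerivAt_integral_of_dominated_loc_of_deriv_le (s := Set.univ) (μ := μ.prod μ)
      (F := fun θ p => L p.2 * f (ContinuousLinearMap.rotation θ p).1)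
      (F' := fun θ p => L p.2 * f' (ContinuousLinearMap.rotation θ p).1
        (ContinuousLinearMap.rotation θ p).2) (x₀ := 0)
      (bound := fun p => (D * (C * 2 ^ q)) * (1 + ‖p‖) ^ (r + q)) univ_mem
      (Eventually.of_forall fun θ => (hG θ).aestronglyMeasurable) ?_ ?_ ?_ ?_ ?_).2
    · refine Tame.integrable (hT.mul (hf.tame.comp
        (continuous_fst.comp (ContinuousLinearMap.rotation 0).continuous) (a := 2) fun p => ?_)) _
      exact (norm_fst_le _).trans (norm_rotation_le 0 p)
    · exact (hT.1.mul (hf.tame'.1.comp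
        (ContinuousLinearMap.rotation 0).continuous)).aestronglyMeasurable
    · refine Eventually.of_forall fun p θ _ => ?_
      rw [norm_mul]
      calc _ ≤ (D * (1 + ‖p‖) ^ r) * (C * (1 + ‖ContinuousLinearMap.rotation θ p‖) ^ q) :=
            mul_le_mul (hr p) (hq _) (norm_nonneg _) (by positivity)
        _ ≤ (D * (1 + ‖p‖) ^ r) * (C * (2 * (1 + ‖p‖)) ^ q) := by
            have := norm_rotation_le θ p
            gcongr
            linarith
        _ = _ := by rw [mul_pow]; ring
    · exact (Tame.integrable_one_add_norm_pow _ _).const_mul _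
    · exact Eventually.of_forall fun p θ _ =>
        (hf.hasDerivAt _ _ θ (hasDerivAt_rotation_fst p θ)).const_mul (L p.2)
  have hL0 : ∫ x, L x ∂μ = 0 := by
    have := L.integral_comp_comm (φ := fun x => x) (IsGaussian.integrable_id (μ := μ))
    rw [this, hμ, map_zero]
  have hLf : Tame (fun x => L x * f x) := (Tame.of_clm L).mul hf.tame
  -- In the rotated coordinates (x', y') one has L(y) = sin θ L(x') + cos θ L(y'). By invariance
  -- (x', y') has the law of (x, y), and the y' part is independent of f(x') with mean zero.
  have heq : ∀ θ : ℝ, ∫ p, L p.2 * f (ContinuousLinearMap.rotation θ p).1 ∂(μ.prod μ)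
      = (Real.sin θ : ℂ) * ∫ x, L x * f x ∂μ := by
    intro θ
    have h1 := integral_comp_rotation μ hμ θ
      (g := fun p : E × E => ((Real.sin θ : ℂ) * L p.1 + (Real.cos θ : ℂ) * L p.2) * f p.1)
      (((continuous_const.mul (L.continuous.comp continuous_fst)).add
        (continuous_const.mul (L.continuous.comp continuous_snd))).mul
          (hf.tame.1.comp continuous_fst))
    have h2 : ∀ p : E × E, ((Real.sin θ : ℂ) * L (ContinuousLinearMap.rotation θ p).1 +
        (Real.cos θ : ℂ) * L (ContinuousLinearMap.rotation θ p).2) = L p.2 := by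
      intro p
      have hsc : (Real.sin θ : ℂ) ^ 2 + (Real.cos θ : ℂ) ^ 2 = 1 := by
        exact_mod_cast Real.sin_sq_add_cos_sq θ
      simp only [ContinuousLinearMap.rotation_apply, map_add, map_smul, Complex.real_smul]
      push_cast at hsc ⊢
      linear_combination L p.2 * hsc
    simp only [h2] at h1
    rw [h1]
    have h3 : ∀ p : E × E, ((Real.sin θ : ℂ) * L p.1 + (Real.cos θ : ℂ) * L p.2) * f p.1
        = (Real.sin θ : ℂ) * (L p.1 * f p.1) + (Real.cos θ : ℂ) * (f p.1 * L p.2) := by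
      intro p; ring
    simp only [h3]
    rw [integral_add, integral_const_mul, integral_const_mul, integral_prod_mul, hL0]
    · simp only [mul_zero, add_zero]
      congr 1
      rw [integral_fun_fst (μ := μ) (ν := μ) (fun x => L x * f x)]
      simp
    · exact (Tame.integrable (hLf.comp_fst) _).const_mul _
    · exact (Tame.integrable (hf.tame.comp_fst.mul hT) _).const_mul _
  simp only [heq] at hder
  have hder2 : HasDerivAt (fun θ : ℝ => (Real.sin θ : ℂ) * ∫ x, L x * f x ∂μ)
      ((Real.cos 0 : ℝ) * ∫ x, L x * f x ∂μ) 0 :=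
    ((Real.hasDerivAt_sin 0).ofReal_comp).mul_const _
  have := hder2.unique hder
  simpa [ContinuousLinearMap.rotation_apply] using this

theorem TameDeriv.integrable_rotation {f : E → ℂ} {f' : E → E → ℂ} (hf : TameDeriv f f')
    (μ : Measure E) [IsGaussian μ] :
    Integrable (Function.uncurry fun (p : E × E) (θ : ℝ) =>
      ‖f' (ContinuousLinearMap.rotation θ p).1 (ContinuousLinearMap.rotation θ p).2‖ ^ 2)
      ((μ.prod μ).prod (volume.restrict (Set.Ioc 0 (Real.pi / 2)))) := by
  obtain ⟨C, q, hC, hq⟩ := hf.tame'.norm_sq.2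
  have hb : Integrable (fun p : E × E => (C * 2 ^ q) * (1 + ‖p‖) ^ q) (μ.prod μ) :=
    (Tame.integrable_one_add_norm_pow _ _).const_mul _
  refine (hb.comp_fst (volume.restrict (Set.Ioc 0 (Real.pi / 2)))).mono' ?_
    (Eventually.of_forall fun x => ?_)
  · have hc : Continuous (fun x : (E × E) × ℝ => f' (ContinuousLinearMap.rotation x.2 x.1).1
        (ContinuousLinearMap.rotation x.2 x.1).2) := by
      have h1 : Continuous (fun x : (E × E) × ℝ => ContinuousLinearMap.rotation x.2 x.1) := by
        simp only [ContinuousLinearMap.rotation_apply]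
        fun_prop
      exact hf.tame'.1.comp h1
    exact (hc.norm.pow 2).aestronglyMeasurable
  · have h1 := hq (ContinuousLinearMap.rotation x.2 x.1)
    have h2 := norm_rotation_le x.2 x.1
    refine h1.trans ?_
    rw [mul_assoc, ← mul_pow]
    gcongr
    linarith

/-- After Fubini every angle contributes the same expectation by rotation invariance, so integrating
over the quarter turn costs just a second factor π/2. -/
theorem TameDeriv.integral_prod_norm_sub_sq_le {f : E → ℂ} {f' : E → E → ℂ}
    (hf : TameDeriv f f') (μ : Measure E) [IsGaussian μ] (hμ : ∫ x, x ∂μ = 0) :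
    ∫ p, ‖f p.2 - f p.1‖ ^ 2 ∂(μ.prod μ) ≤
      (Real.pi / 2) ^ 2 * ∫ p, ‖f' p.1 p.2‖ ^ 2 ∂(μ.prod μ) := by
  have hpi : 0 ≤ Real.pi / 2 := by positivity
  have htd : Tame (fun p : E × E => ‖f p.2 - f p.1‖ ^ 2) :=
    (hf.tame.comp_snd.sub hf.tame.comp_fst).norm_sq
  have hswap := hf.integrable_rotation μ
  have hνm : (volume.restrict (Set.Ioc 0 (Real.pi / 2))).real Set.univ = Real.pi / 2 := by
    simp [measureReal_def, Real.volume_Ioc, ENNReal.toReal_ofReal hpi]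
  have h1 := integral_mono (htd.integrable (μ.prod μ))
    (hswap.integral_prod_left.const_mul (Real.pi / 2)) hf.norm_sub_sq_le
  refine h1.trans (le_of_eq ?_)
  rw [integral_const_mul]
  simp only [Function.uncurry_apply_pair]
  rw [integral_integral_swap hswap]
  have h2 : ∀ θ : ℝ, ∫ p, ‖f' (ContinuousLinearMap.rotation θ p).1
      (ContinuousLinearMap.rotation θ p).2‖ ^ 2 ∂(μ.prod μ)
      = ∫ p, ‖f' p.1 p.2‖ ^ 2 ∂(μ.prod μ) := fun θ =>
    integral_comp_rotation μ hμ θ (g := fun p => ‖f' p.1 p.2‖ ^ 2) (hf.tame'.1.norm.pow 2)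
  simp only [h2]
  rw [integral_const, hνm, smul_eq_mul]
  ring

/-- Gaussian Poincaré inequality (with a non-optimal constant). -/
theorem TameDeriv.integral_norm_sub_sq_le {f : E → ℂ} {f' : E → E → ℂ} (hf : TameDeriv f f')
    (μ : Measure E) [IsGaussian μ] (hμ : ∫ x, x ∂μ = 0) :
    ∫ x, ‖f x - ∫ y, f y ∂μ‖ ^ 2 ∂μ ≤ 3 * ∫ p, ‖f' p.1 p.2‖ ^ 2 ∂(μ.prod μ) := by
  have htd : Tame (fun p : E × E => ‖f p.2 - f p.1‖ ^ 2) :=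
    (hf.tame.comp_snd.sub hf.tame.comp_fst).norm_sq
  -- Centring at the mean is averaging over an independent copy, so Jensen passes from the variance
  -- to the squared increment.
  have hjen : ∀ x, ‖f x - ∫ y, f y ∂μ‖ ^ 2 ≤ ∫ y, ‖f y - f x‖ ^ 2 ∂μ := by
    intro x
    have ht : Tame (fun y => f y - f x) := hf.tame.sub (Tame.const _)
    have h1 : ‖f x - ∫ y, f y ∂μ‖ = ‖∫ y, (f y - f x) ∂μ‖ := by
      rw [integral_sub (hf.tame.integrable μ) (integrable_const _), norm_sub_rev]
      simp
    rw [h1]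
    have h := sq_integral_norm_le μ (ht.integrable μ) (ht.norm_sq.integrable μ)
    rw [probReal_univ, one_mul] at h
    exact (pow_le_pow_left₀ (norm_nonneg _) (norm_integral_le_integral_norm _) 2).trans h
  have hp3 : (Real.pi / 2) ^ 2 ≤ 3 := by
    have := Real.pi_lt_d2
    have := Real.pi_pos
    nlinarith
  have hint2 := htd.integrable (μ.prod μ)
  have hint1 : Integrable (fun x => ‖f x - ∫ y, f y ∂μ‖ ^ 2) μ :=
    (hf.tame.sub (Tame.const (∫ y, f y ∂μ))).norm_sq.integrable μ
  have h1 := integral_mono hint1 hint2.integral_prod_left hjen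
  have h2 := integral_prod _ hint2
  rw [← h2] at h1
  exact (h1.trans (hf.integral_prod_norm_sub_sq_le μ hμ)).trans
    (mul_le_mul_of_nonneg_right hp3 (integral_nonneg fun _ => by positivity))

end Gaussian

/-- A covariance is at most the product of bounds for the standard deviations. -/
theorem norm_integral_mul_sub_le {E : Type*} [NormedAddCommGroup E] [NormedSpace ℝ E]
    [MeasurableSpace E] [BorelSpace E] [SecondCountableTopology E] [CompleteSpace E]
    (μ : Measure E) [IsGaussian μ] {f g : E → ℂ} (hf : Tame f) (hg : Tame g) {a b : ℝ}
    (ha : 0 < a) (hb : 0 < b) (hfa : ∫ x, ‖f x - ∫ y, f y ∂μ‖ ^ 2 ∂μ ≤ a ^ 2)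
    (hgb : ∫ x, ‖g x - ∫ y, g y ∂μ‖ ^ 2 ∂μ ≤ b ^ 2) :
    ‖∫ x, f x * g x ∂μ - (∫ x, f x ∂μ) * ∫ x, g x ∂μ‖ ≤ a * b := by
  set mf := ∫ y, f y ∂μ
  set mg := ∫ y, g y ∂μ
  have hf0 : Tame (fun x => f x - mf) := hf.sub (Tame.const _)
  have hg0 : Tame (fun x => g x - mg) := hg.sub (Tame.const _)
  have h1 : ∫ x, f x * g x ∂μ - mf * mg = ∫ x, (f x - mf) * (g x - mg) ∂μ := by
    have : ∀ x, (f x - mf) * (g x - mg) = f x * g x - f x * mg - mf * g x + mf * mg := by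
      intro x; ring
    simp_rw [this]
    have hfg := (hf.mul hg).integrable μ
    have hfi := (hf.integrable μ).mul_const mg
    have hgi := (hg.integrable μ).const_mul mf
    have h2 : Integrable (fun x => f x * g x - f x * mg) μ := hfg.sub hfi
    have h3 : Integrable (fun x => f x * g x - f x * mg - mf * g x) μ := h2.sub hgi
    rw [integral_add h3 (integrable_const _), integral_sub h2 hgi, integral_sub hfg hfi,
      integral_mul_const,
      integral_const_mul, integral_const, probReal_univ, one_smul]
    ring
  rw [h1]
  refine (norm_integral_le_integral_norm _).trans ?_
  -- Young's inequality with these weights makes each half contribute a * b / 2.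
  have hi1 := (hf0.norm_sq.integrable μ).const_mul (b / (2 * a))
  have hi2 := (hg0.norm_sq.integrable μ).const_mul (a / (2 * b))
  calc ∫ x, ‖(f x - mf) * (g x - mg)‖ ∂μ
      ≤ ∫ x, (b / (2 * a) * ‖f x - mf‖ ^ 2 + a / (2 * b) * ‖g x - mg‖ ^ 2) ∂μ := by
        refine integral_mono ((hf0.mul hg0).integrable μ).norm (hi1.add hi2) fun x => ?_
        simp only [norm_mul]
        have : b / (2 * a) * ‖f x - mf‖ ^ 2 + a / (2 * b) * ‖g x - mg‖ ^ 2
          - ‖f x - mf‖ * ‖g x - mg‖ = (b * ‖f x - mf‖ - a * ‖g x - mg‖) ^ 2 / (2 * a * b) := by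
          field_simp
          ring
        have h2 : 0 ≤ (b * ‖f x - mf‖ - a * ‖g x - mg‖) ^ 2 / (2 * a * b) := by positivity
        linarith
    _ = b / (2 * a) * ∫ x, ‖f x - mf‖ ^ 2 ∂μ + a / (2 * b) * ∫ x, ‖g x - mg‖ ^ 2 ∂μ := by
        rw [integral_add hi1 hi2, integral_const_mul, integral_const_mul]
    _ ≤ b / (2 * a) * a ^ 2 + a / (2 * b) * b ^ 2 := by gcongr
    _ = a * b := by field_simp; ring

/-! ### Frobenius norm, traces and resolvents -/

section Frobenius

variable {m n p : Type*} [Fintype m] [Fintype n] [Fintype p]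

/-- The squared Frobenius norm. -/
noncomputable def frSq (G : Matrix m n ℂ) : ℝ := ∑ i, ∑ j, ‖G i j‖ ^ 2

theorem frSq_nonneg (G : Matrix m n ℂ) : 0 ≤ frSq G := by unfold frSq; positivity

theorem frSq_conjTranspose (G : Matrix m n ℂ) : frSq Gᴴ = frSq G := by
  unfold frSq
  rw [Finset.sum_comm]
  simp

theorem trace_mul_conjTranspose_eq_frSq (G : Matrix m n ℂ) : (G * Gᴴ).trace = (frSq G : ℂ) := by
  simp only [Matrix.trace, Matrix.diag, Matrix.mul_apply, Matrix.conjTranspose_apply, frSq]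
  push_cast
  refine Finset.sum_congr rfl fun i _ => Finset.sum_congr rfl fun j _ => ?_
  rw [RCLike.star_def, Complex.mul_conj, Complex.normSq_eq_norm_sq]
  push_cast
  rfl

theorem trace_conjTranspose_mul_eq_frSq (G : Matrix m n ℂ) : (Gᴴ * G).trace = (frSq G : ℂ) := by
  rw [Matrix.trace_mul_comm, trace_mul_conjTranspose_eq_frSq]

theorem norm_trace_mul_sq_le (A : Matrix m n ℂ) (B : Matrix n m ℂ) :
    ‖(A * B).trace‖ ^ 2 ≤ frSq A * frSq B := by
  have h1 : ‖(A * B).trace‖ ≤ ∑ q : m × n, ‖A q.1 q.2‖ * ‖B q.2 q.1‖ := by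
    simp only [Matrix.trace, Matrix.diag, Matrix.mul_apply]
    rw [← Fintype.sum_prod_type' (f := fun i j => A i j * B j i)]
    exact (norm_sum_le _ _).trans (by simp)
  calc ‖(A * B).trace‖ ^ 2 ≤ (∑ q : m × n, ‖A q.1 q.2‖ * ‖B q.2 q.1‖) ^ 2 := by gcongr
    _ ≤ (∑ q : m × n, ‖A q.1 q.2‖ ^ 2) * ∑ q : m × n, ‖B q.2 q.1‖ ^ 2 :=
        Finset.sum_mul_sq_le_sq_mul_sq _ _ _
    _ = _ := by
        rw [← frSq_conjTranspose B]
        simp [frSq, Fintype.sum_prod_type]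

theorem norm_trace_mul_le (A : Matrix m n ℂ) (B : Matrix n m ℂ) :
    ‖(A * B).trace‖ ≤ √(frSq A) * √(frSq B) := by
  rw [← Real.sqrt_mul (frSq_nonneg A)]
  exact Real.le_sqrt_of_sq_le (norm_trace_mul_sq_le A B)

/-- The left side is Tr (YᴴY)(ZᴴZ), so Cauchy–Schwarz applies. This reduces products of two
different column matrices to Gram matrices of a single family, whose second moments can be computed.
-/
theorem frSq_mul_conjTranspose_le (Y : Matrix m n ℂ) (Z : Matrix p n ℂ) :
    frSq (Y * Zᴴ) ≤ (frSq (Yᴴ * Y) + frSq (Zᴴ * Z)) / 2 := by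
  have h : (frSq (Y * Zᴴ) : ℂ) = ((Yᴴ * Y) * (Zᴴ * Z)).trace := by
    rw [← trace_conjTranspose_mul_eq_frSq, Matrix.conjTranspose_mul,
      Matrix.conjTranspose_conjTranspose, Matrix.trace_mul_comm]
    simp only [Matrix.mul_assoc]
    rw [Matrix.trace_mul_comm]
    simp only [Matrix.mul_assoc]
    rw [← Matrix.mul_assoc, Matrix.trace_mul_comm]
    simp only [Matrix.mul_assoc]
  have h2 := norm_trace_mul_le (Yᴴ * Y) (Zᴴ * Z)
  rw [← h, Complex.norm_real, Real.norm_of_nonneg (frSq_nonneg _)] at h2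
  have h3 := Real.sq_sqrt (frSq_nonneg (Yᴴ * Y))
  have h4 := Real.sq_sqrt (frSq_nonneg (Zᴴ * Z))
  nlinarith [sq_nonneg (√(frSq (Yᴴ * Y)) - √(frSq (Zᴴ * Z)))]

variable [DecidableEq m] [DecidableEq n] [DecidableEq p]

theorem sum_norm_mulVec_sq_le (P : Matrix m n ℂ) (v : n → ℂ) :
    ∑ a, ‖(P *ᵥ v) a‖ ^ 2 ≤ ‖P‖ ^ 2 * ∑ b, ‖v b‖ ^ 2 := by
  have h := Matrix.l2_opNorm_mulVec P (WithLp.toLp 2 v)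
  have h2 := pow_le_pow_left₀ (norm_nonneg _) h 2
  rw [mul_pow, EuclideanSpace.norm_sq_eq, EuclideanSpace.norm_sq_eq] at h2
  simpa using h2

theorem opNorm_le_of_sum_sq {P : Matrix m n ℂ} {c : ℝ} (hc : 0 ≤ c)
    (h : ∀ v : n → ℂ, ∑ a, ‖(P *ᵥ v) a‖ ^ 2 ≤ c ^ 2 * ∑ b, ‖v b‖ ^ 2) : ‖P‖ ≤ c := by
  rw [Matrix.l2_opNorm_def]
  refine ContinuousLinearMap.opNorm_le_bound _ hc fun v => ?_
  refine le_of_sq_le_sq ?_ (by positivity)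
  rw [mul_pow, EuclideanSpace.norm_sq_eq, EuclideanSpace.norm_sq_eq]
  simpa using h v

theorem sum_norm_vecMul_sq_le (P : Matrix m n ℂ) (v : m → ℂ) :
    ∑ a, ‖(v ᵥ* P) a‖ ^ 2 ≤ ‖P‖ ^ 2 * ∑ b, ‖v b‖ ^ 2 := by
  have h := sum_norm_mulVec_sq_le Pᴴ (star v)
  rw [Matrix.l2_opNorm_conjTranspose, ← Matrix.star_vecMul] at h
  simpa using h

theorem frSq_mul_le (A : Matrix m n ℂ) (B : Matrix n p ℂ) :
    frSq (A * B) ≤ ‖A‖ ^ 2 * frSq B := by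
  unfold frSq
  rw [Finset.sum_comm, Finset.sum_comm (f := fun i j => ‖B i j‖ ^ 2), Finset.mul_sum]
  refine Finset.sum_le_sum fun j _ => ?_
  exact sum_norm_mulVec_sq_le A (fun i => B i j)

theorem frSq_mul_le' (A : Matrix m n ℂ) (B : Matrix n p ℂ) :
    frSq (A * B) ≤ frSq A * ‖B‖ ^ 2 := by
  rw [← frSq_conjTranspose, Matrix.conjTranspose_mul, mul_comm, ← frSq_conjTranspose A,
    ← Matrix.l2_opNorm_conjTranspose]
  exact frSq_mul_le _ _

theorem frSq_one : frSq (1 : Matrix m m ℂ) = Fintype.card m := by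
  have h := trace_mul_conjTranspose_eq_frSq (1 : Matrix m m ℂ)
  simp only [Matrix.conjTranspose_one, mul_one, Matrix.trace_one] at h
  exact_mod_cast h.symm

theorem frSq_le_card_mul (A : Matrix m n ℂ) : frSq A ≤ Fintype.card m * ‖A‖ ^ 2 := by
  have h := frSq_mul_le' (1 : Matrix m m ℂ) A
  rwa [Matrix.one_mul, frSq_one] at h

theorem norm_trace_le (A : Matrix m m ℂ) : ‖A.trace‖ ≤ Fintype.card m * ‖A‖ := by
  have h := norm_trace_mul_le (1 : Matrix m m ℂ) A
  rw [one_mul, frSq_one] at h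
  refine h.trans ?_
  have h2 : √(frSq A) ≤ √(Fintype.card m) * ‖A‖ := by
    rw [← Real.sqrt_sq (norm_nonneg A), ← Real.sqrt_mul (by positivity)]
    exact Real.sqrt_le_sqrt (frSq_le_card_mul A)
  calc _ ≤ √(Fintype.card m) * (√(Fintype.card m) * ‖A‖) := by gcongr
    _ = _ := by rw [← mul_assoc, Real.mul_self_sqrt (by positivity)]

theorem norm_trace_mul_le_card (A : Matrix m n ℂ) (B : Matrix n m ℂ) :
    ‖(A * B).trace‖ ≤ Fintype.card m * (‖A‖ * ‖B‖) :=
  (norm_trace_le _).trans (by gcongr; exact Matrix.l2_opNorm_mul A B)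

theorem norm_entry_le (A : Matrix m n ℂ) (i : m) (j : n) : ‖A i j‖ ≤ ‖A‖ := by
  have h := sum_norm_mulVec_sq_le A (Pi.single j 1)
  have h1 : ∑ b, ‖(Pi.single j (1 : ℂ) : n → ℂ) b‖ ^ 2 = 1 := by
    rw [Finset.sum_eq_single j] <;> simp +contextual
  rw [h1, mul_one] at h
  have h2 : ‖(A *ᵥ Pi.single j 1) i‖ ^ 2 ≤ ∑ a, ‖(A *ᵥ Pi.single j 1) a‖ ^ 2 :=
    Finset.single_le_sum (f := fun a => ‖(A *ᵥ Pi.single j 1) a‖ ^ 2)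
      (fun _ _ => by positivity) (Finset.mem_univ i)
  have h3 : (A *ᵥ Pi.single j 1) i = A i j := by simp
  rw [h3] at h2
  exact le_of_sq_le_sq (h2.trans h) (norm_nonneg _)

end Frobenius

/-! ### Resolvent bounds from a lower bound on T -/

section Resolvent

variable {m n : Type*} [Fintype m] [Fintype n] [DecidableEq m] [DecidableEq n]

/-- `T ≥ t` in the order of Hermitian matrices. -/
def LowerBdd (t : ℝ) (T : Matrix m m ℂ) : Prop := (T - (t : ℂ) • 1).PosSemidef

theorem LowerBdd.posSemidef {t : ℝ} (ht : 0 ≤ t) {T : Matrix m m ℂ} (hT : LowerBdd t T) :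
    T.PosSemidef := by
  have h1 : ((t : ℂ) • (1 : Matrix m m ℂ)).PosSemidef :=
    Matrix.PosSemidef.one.smul (by exact_mod_cast ht)
  simpa using Matrix.PosSemidef.add hT h1

theorem LowerBdd.posDef {t : ℝ} (ht : 0 < t) {T : Matrix m m ℂ} (hT : LowerBdd t T) :
    T.PosDef := by
  have h1 : ((t : ℂ) • (1 : Matrix m m ℂ)).PosDef :=
    Matrix.PosDef.one.smul (by exact_mod_cast ht)
  simpa using Matrix.PosDef.posSemidef_add hT h1

theorem LowerBdd.add {t : ℝ} {T W : Matrix m m ℂ} (hT : LowerBdd t T) (hW : W.PosSemidef) :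
    LowerBdd t (W + T) := by
  have := Matrix.PosSemidef.add hT hW
  unfold LowerBdd
  convert this using 1
  abel

theorem LowerBdd.mono {s t : ℝ} (hst : s ≤ t) {T : Matrix m m ℂ} (hT : LowerBdd t T) :
    LowerBdd s T := by
  have h1 : (((t - s : ℝ) : ℂ) • (1 : Matrix m m ℂ)).PosSemidef :=
    Matrix.PosSemidef.one.smul (by exact_mod_cast sub_nonneg.2 hst)
  have := Matrix.PosSemidef.add hT h1
  unfold LowerBdd
  convert this using 1
  push_cast
  rw [sub_smul]
  abel

theorem sum_norm_sq_eq_dotProduct {q : Type*} [Fintype q] (v : q → ℂ) :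
    ((∑ b, ‖v b‖ ^ 2 : ℝ) : ℂ) = star v ⬝ᵥ v := by
  simp only [dotProduct, Pi.star_apply]
  push_cast
  refine Finset.sum_congr rfl fun i _ => ?_
  rw [mul_comm, RCLike.star_def, Complex.mul_conj, Complex.normSq_eq_norm_sq]
  push_cast
  rfl

theorem norm_dotProduct_le {q : Type*} [Fintype q] (u v : q → ℂ) :
    ‖star u ⬝ᵥ v‖ ^ 2 ≤ (∑ b, ‖u b‖ ^ 2) * ∑ b, ‖v b‖ ^ 2 := by
  have h1 : ‖star u ⬝ᵥ v‖ ≤ ∑ b, ‖u b‖ * ‖v b‖ :=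
    (norm_sum_le _ _).trans (by simp)
  calc _ ≤ (∑ b, ‖u b‖ * ‖v b‖) ^ 2 := by gcongr
    _ ≤ _ := Finset.sum_mul_sq_le_sq_mul_sq _ _ _

/-- The bound behind all resolvent estimates: if `G ≥ X Xᴴ + t`, then `w = G⁻¹ v` satisfies
`‖Xᴴ w‖² + t ‖w‖² ≤ Re ⟨w, v⟩`. -/
theorem resolvent_energy {t : ℝ} {T : Matrix m m ℂ} (hT : LowerBdd t T) (X : Matrix m n ℂ)
    (w : m → ℂ) :
    ∑ b, ‖(Xᴴ *ᵥ w) b‖ ^ 2 + t * ∑ b, ‖w b‖ ^ 2 ≤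
      (star w ⬝ᵥ ((X * Xᴴ + T) *ᵥ w)).re := by
  have h0 := hT.dotProduct_mulVec_nonneg w
  have h1 : star w ⬝ᵥ ((X * Xᴴ + T) *ᵥ w) = star (Xᴴ *ᵥ w) ⬝ᵥ (Xᴴ *ᵥ w) +
      (t : ℂ) * (star w ⬝ᵥ w) + star w ⬝ᵥ ((T - (t : ℂ) • 1) *ᵥ w) := by
    rw [Matrix.star_mulVec, Matrix.conjTranspose_conjTranspose, Matrix.add_mulVec,
      Matrix.sub_mulVec, dotProduct_add, dotProduct_sub, ← Matrix.mulVec_mulVec,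
      Matrix.dotProduct_mulVec, Matrix.smul_mulVec, Matrix.one_mulVec, dotProduct_smul,
      smul_eq_mul]
    ring
  rw [h1, ← sum_norm_sq_eq_dotProduct, ← sum_norm_sq_eq_dotProduct, Complex.add_re,
    Complex.add_re, Complex.ofReal_re, ← Complex.ofReal_mul, Complex.ofReal_re]
  linarith [(Complex.nonneg_iff.1 h0).1]

theorem resolvent_posDef {t : ℝ} (ht : 0 < t) {T : Matrix m m ℂ} (hT : LowerBdd t T)
    (X : Matrix m n ℂ) : (X * Xᴴ + T).PosDef :=
  (hT.add (Matrix.posSemidef_self_mul_conjTranspose X)).posDef ht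

/-- With a = ‖w‖², b = ‖v‖², c = ‖Xᴴw‖² and N = |⟨w, v⟩|, the energy inequality gives c + t a ≤ N
and Cauchy–Schwarz gives N² ≤ a b; both bounds follow by elimination. -/
theorem resolvent_solve {t : ℝ} (ht : 0 < t) {T : Matrix m m ℂ} (hT : LowerBdd t T)
    (X : Matrix m n ℂ) {w v : m → ℂ} (hv : (X * Xᴴ + T) *ᵥ w = v) :
    ∑ b, ‖w b‖ ^ 2 ≤ t⁻¹ ^ 2 * ∑ b, ‖v b‖ ^ 2 ∧
      ∑ b, ‖(Xᴴ *ᵥ w) b‖ ^ 2 ≤ t⁻¹ * ∑ b, ‖v b‖ ^ 2 := by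
  have h := resolvent_energy hT X w
  rw [hv] at h
  have h1 : 0 ≤ ∑ b, ‖(Xᴴ *ᵥ w) b‖ ^ 2 := Finset.sum_nonneg fun _ _ => sq_nonneg _
  have h2 := Complex.re_le_norm (star w ⬝ᵥ v)
  have h3 := norm_dotProduct_le w v
  have ha : 0 ≤ ∑ b, ‖w b‖ ^ 2 := Finset.sum_nonneg fun _ _ => sq_nonneg _
  have hb : 0 ≤ ∑ b, ‖v b‖ ^ 2 := Finset.sum_nonneg fun _ _ => sq_nonneg _
  generalize ∑ b, ‖w b‖ ^ 2 = a at *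
  generalize ∑ b, ‖v b‖ ^ 2 = b at *
  generalize ∑ b, ‖(Xᴴ *ᵥ w) b‖ ^ 2 = c at *
  generalize ‖star w ⬝ᵥ v‖ = N at *
  have h4 : t * a ≤ N := by linarith
  have h5 : (t * a) ^ 2 ≤ a * b := (pow_le_pow_left₀ (by positivity) h4 2).trans h3
  have hab : a ≤ t⁻¹ ^ 2 * b := by
    rcases ha.eq_or_lt with h0 | h0
    · rw [← h0]; positivity
    · have h6 : t ^ 2 * a ≤ b := by
        have : a * (t ^ 2 * a) ≤ a * b := by nlinarith
        exact le_of_mul_le_mul_left this h0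
      rw [inv_pow, ← div_eq_inv_mul, le_div_iff₀ (by positivity)]
      linarith
  refine ⟨hab, ?_⟩
  have h6 : N ≤ t⁻¹ * b := by
    refine le_of_sq_le_sq (h3.trans ?_) (by positivity)
    calc a * b ≤ (t⁻¹ ^ 2 * b) * b := by gcongr
      _ = _ := by ring
  nlinarith [mul_nonneg ht.le ha]

theorem resolvent_mulVec {t : ℝ} (ht : 0 < t) {T : Matrix m m ℂ} (hT : LowerBdd t T)
    (X : Matrix m n ℂ) (v : m → ℂ) : (X * Xᴴ + T) *ᵥ ((X * Xᴴ + T)⁻¹ *ᵥ v) = v := by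
  have hu := (Matrix.isUnit_iff_isUnit_det _).1 (resolvent_posDef ht hT X).isUnit
  rw [Matrix.mulVec_mulVec, Matrix.mul_nonsing_inv _ hu, Matrix.one_mulVec]

theorem norm_inv_le_of_lowerBdd {t : ℝ} (ht : 0 < t) {T : Matrix m m ℂ} (hT : LowerBdd t T)
    (X : Matrix m n ℂ) : ‖(X * Xᴴ + T)⁻¹‖ ≤ t⁻¹ :=
  opNorm_le_of_sum_sq (by positivity) fun v =>
    (resolvent_solve ht hT X (resolvent_mulVec ht hT X v)).1

/-- There is no bound on X itself; the energy inequality controls it next to the resolvent. Traces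
containing derivatives of the resolvent are therefore arranged so that X always touches a resolvent.
-/
theorem norm_conjTranspose_mul_inv_sq_le {t : ℝ} (ht : 0 < t) {T : Matrix m m ℂ}
    (hT : LowerBdd t T) (X : Matrix m n ℂ) : ‖Xᴴ * (X * Xᴴ + T)⁻¹‖ ^ 2 ≤ t⁻¹ := by
  have hs : √t⁻¹ ^ 2 = t⁻¹ := Real.sq_sqrt (by positivity)
  have hle : ‖Xᴴ * (X * Xᴴ + T)⁻¹‖ ≤ √t⁻¹ := by
    refine opNorm_le_of_sum_sq (Real.sqrt_nonneg _) fun v => ?_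
    rw [hs, ← Matrix.mulVec_mulVec]
    exact (resolvent_solve ht hT X (resolvent_mulVec ht hT X v)).2
  exact (pow_le_pow_left₀ (norm_nonneg _) hle 2).trans_eq hs

theorem norm_inv_mul_sq_le {t : ℝ} (ht : 0 < t) {T : Matrix m m ℂ}
    (hT : LowerBdd t T) (X : Matrix m n ℂ) : ‖(X * Xᴴ + T)⁻¹ * X‖ ^ 2 ≤ t⁻¹ := by
  rw [← Matrix.l2_opNorm_conjTranspose, Matrix.conjTranspose_mul,
    (resolvent_posDef ht hT X).inv.isHermitian.eq]
  exact norm_conjTranspose_mul_inv_sq_le ht hT X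

end Resolvent

/-! ### Calculus of tame functions -/

section TameCalculus

variable {E : Type*} [NormedAddCommGroup E] [NormedSpace ℝ E]

namespace TameDeriv

theorem const (c : ℂ) : TameDeriv (fun _ : E => c) (fun _ _ => 0) :=
  ⟨Tame.const _, Tame.const _, fun _ _ t _ => hasDerivAt_const t c⟩

theorem clm (L : E →L[ℝ] ℂ) : TameDeriv (fun x => L x) (fun _ h => L h) :=
  ⟨Tame.of_clm L, (Tame.of_clm L).comp_snd, fun _ _ t hc => L.hasFDerivAt.comp_hasDerivAt t hc⟩

variable {f g : E → ℂ} {f' g' : E → E → ℂ}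

theorem add (hf : TameDeriv f f') (hg : TameDeriv g g') :
    TameDeriv (fun x => f x + g x) (fun x h => f' x h + g' x h) :=
  ⟨hf.tame.add hg.tame, hf.tame'.add hg.tame', fun c c' t hc =>
    (hf.hasDerivAt c c' t hc).add (hg.hasDerivAt c c' t hc)⟩

theorem mul (hf : TameDeriv f f') (hg : TameDeriv g g') :
    TameDeriv (fun x => f x * g x) (fun x h => f' x h * g x + f x * g' x h) :=
  ⟨hf.tame.mul hg.tame, (hf.tame'.mul hg.tame.comp_fst).add (hf.tame.comp_fst.mul hg.tame'),
    fun c c' t hc => (hf.hasDerivAt c c' t hc).mul (hg.hasDerivAt c c' t hc)⟩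

theorem star (hf : TameDeriv f f') :
    TameDeriv (fun x => star (f x)) (fun x h => star (f' x h)) :=
  ⟨hf.tame.star, hf.tame'.star, fun c c' t hc => (hf.hasDerivAt c c' t hc).star⟩

theorem sum {ι : Type*} (s : Finset ι) {f : ι → E → ℂ} {f' : ι → E → E → ℂ}
    (hf : ∀ i ∈ s, TameDeriv (f i) (f' i)) :
    TameDeriv (fun x => ∑ i ∈ s, f i x) (fun x h => ∑ i ∈ s, f' i x h) :=
  ⟨Tame.sum s fun i hi => (hf i hi).tame, Tame.sum s fun i hi => (hf i hi).tame',
    fun c c' t hc => HasDerivAt.fun_sum fun i hi => (hf i hi).hasDerivAt c c' t hc⟩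

end TameDeriv

/-- Entrywise version of `TameDeriv`. -/
def MatDeriv {m n : Type*} (F : E → Matrix m n ℂ) (F' : E → E → Matrix m n ℂ) : Prop :=
  ∀ i j, TameDeriv (fun x => F x i j) (fun x h => F' x h i j)

namespace MatDeriv

variable {m n p : Type*} [Fintype m] [Fintype n] [Fintype p]

theorem const (C : Matrix m n ℂ) : MatDeriv (fun _ : E => C) (fun _ _ => 0) :=
  fun i j => TameDeriv.const (C i j)

theorem add {F G : E → Matrix m n ℂ} {F' G' : E → E → Matrix m n ℂ} (hF : MatDeriv F F')
    (hG : MatDeriv G G') : MatDeriv (fun x => F x + G x) (fun x h => F' x h + G' x h) :=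
  fun i j => (hF i j).add (hG i j)

theorem mul {F : E → Matrix m n ℂ} {G : E → Matrix n p ℂ} {F' : E → E → Matrix m n ℂ}
    {G' : E → E → Matrix n p ℂ} (hF : MatDeriv F F') (hG : MatDeriv G G') :
    MatDeriv (fun x => F x * G x) (fun x h => F' x h * G x + F x * G' x h) := by
  intro i j
  have h := TameDeriv.sum Finset.univ fun a (_ : a ∈ Finset.univ) => (hF i a).mul (hG a j)
  simpa only [Matrix.mul_apply, Matrix.add_apply, Finset.sum_add_distrib] using h

theorem const_mul (C : Matrix m n ℂ) {G : E → Matrix n p ℂ} {G' : E → E → Matrix n p ℂ}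
    (hG : MatDeriv G G') : MatDeriv (fun x => C * G x) (fun x h => C * G' x h) := by
  simpa using (const C).mul hG

theorem mul_const {F : E → Matrix m n ℂ} {F' : E → E → Matrix m n ℂ} (hF : MatDeriv F F')
    (C : Matrix n p ℂ) : MatDeriv (fun x => F x * C) (fun x h => F' x h * C) := by
  simpa using hF.mul (const C)

theorem conjTranspose {F : E → Matrix m n ℂ} {F' : E → E → Matrix m n ℂ} (hF : MatDeriv F F') :
    MatDeriv (fun x => (F x)ᴴ) (fun x h => (F' x h)ᴴ) :=
  fun i j => (hF j i).star

theorem trace {F : E → Matrix m m ℂ} {F' : E → E → Matrix m m ℂ} (hF : MatDeriv F F') :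
    TameDeriv (fun x => (F x).trace) (fun x h => (F' x h).trace) :=
  TameDeriv.sum Finset.univ fun a _ => hF a a

/-- The difference quotient is exact by F⁻¹ - G⁻¹ = -F⁻¹(F - G)G⁻¹, and one passes to the limit
using continuity of the inverse. The uniform bound on the entries supplies polynomial growth. -/
theorem inv [DecidableEq m] {F : E → Matrix m m ℂ} {F' : E → E → Matrix m m ℂ}
    (hF : MatDeriv F F') (hu : ∀ x, IsUnit (F x).det) {C : ℝ} (hC : ∀ x i j, ‖(F x)⁻¹ i j‖ ≤ C) :
    MatDeriv (fun x => (F x)⁻¹) (fun x h => -((F x)⁻¹ * F' x h * (F x)⁻¹)) := by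
  have hcont : Continuous F := continuous_pi fun i => continuous_pi fun j => (hF i j).tame.1
  have hcinv : Continuous (fun x => (F x)⁻¹) := by
    simp only [Matrix.inv_def, Ring.inverse_eq_inv']
    exact (hcont.matrix_det.inv₀ fun x => (hu x).ne_zero).smul hcont.matrix_adjugate
  have hce : ∀ i j, Continuous (fun x => (F x)⁻¹ i j) := fun i j =>
    (continuous_apply j).comp ((continuous_apply i).comp hcinv)
  have htame : ∀ i j, Tame (fun x => (F x)⁻¹ i j) := fun i j =>
    ⟨hce i j, |C|, 0, abs_nonneg _, fun x => by simpa using (hC x i j).trans (le_abs_self C)⟩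
  intro i j
  refine ⟨htame i j, ?_, fun c c' t hc => ?_⟩
  · simp only [Matrix.neg_apply, Matrix.mul_apply]
    exact (Tame.sum _ fun b _ => (Tame.sum _ fun a _ =>
      ((htame i a).comp_fst.mul (hF a b).tame')).mul (htame b j).comp_fst).neg
  · rw [hasDerivAt_iff_tendsto_slope]
    have hslope : ∀ s, slope (fun s => (F (c s))⁻¹ i j) t s =
        -∑ b, (∑ a, (F (c s))⁻¹ i a * slope (fun s => F (c s) a b) t s) * (F (c t))⁻¹ b j := by
      intro s
      have hid : (F (c s))⁻¹ - (F (c t))⁻¹ =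
          -((F (c s))⁻¹ * (F (c s) - F (c t)) * (F (c t))⁻¹) := by
        rw [Matrix.mul_sub, Matrix.sub_mul, Matrix.nonsing_inv_mul _ (hu _), Matrix.one_mul,
          Matrix.mul_assoc, Matrix.mul_nonsing_inv _ (hu _), Matrix.mul_one]
        abel
      have hij := congrFun (congrFun hid i) j
      simp only [Matrix.sub_apply, Matrix.neg_apply, Matrix.mul_apply] at hij
      simp only [slope_def_module, hij, smul_neg, Finset.smul_sum, Finset.sum_mul]
      congr 1
      refine Finset.sum_congr rfl fun b _ => Finset.sum_congr rfl fun a _ => ?_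
      rw [mul_smul_comm, smul_mul_assoc]
    have hsl : ∀ a b, Tendsto (slope (fun s => F (c s) a b) t) (𝓝[≠] t) (𝓝 (F' (c t) c' a b)) :=
      fun a b => hasDerivAt_iff_tendsto_slope.1 ((hF a b).hasDerivAt c c' t hc)
    have hc0 : ∀ a, Tendsto (fun s => (F (c s))⁻¹ i a) (𝓝[≠] t) (𝓝 ((F (c t))⁻¹ i a)) :=
      fun a => ((hce i a).continuousAt.tendsto.comp hc.continuousAt.tendsto).mono_left
        nhdsWithin_le_nhds
    have hfun : slope (fun s => (F (c s))⁻¹ i j) t = fun s =>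
        -∑ b, (∑ a, (F (c s))⁻¹ i a * slope (fun s => F (c s) a b) t s) * (F (c t))⁻¹ b j :=
      funext hslope
    rw [hfun]
    simp only [Matrix.neg_apply, Matrix.mul_apply]
    exact (tendsto_finsetSum _ fun b _ => (tendsto_finsetSum _ fun a _ =>
      (hc0 a).mul (hsl a b)).mul_const _).neg

theorem tame_mul_apply {F : E → Matrix m n ℂ} {G : E → Matrix n p ℂ}
    (hF : ∀ i j, Tame fun x => F x i j) (hG : ∀ i j, Tame fun x => G x i j) (i : m) (j : p) :
    Tame (fun x => (F x * G x) i j) := by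
  simp only [Matrix.mul_apply]
  exact Tame.sum _ fun a _ => (hF i a).mul (hG a j)

end MatDeriv

end TameCalculus

/-! ### The Gaussian sample -/

instance : IsGaussian stdComplexGaussian := by
  have h : stdComplexGaussian = ((gaussianReal 0 (1 / 2)).prod (gaussianReal 0 (1 / 2))).map
      (Complex.equivRealProdCLM.symm : ℝ × ℝ →L[ℝ] ℂ) := rfl
  rw [h]
  infer_instance

/-- Under the product measure the coordinates are independent with Gaussian laws, hence jointly
Gaussian. -/
theorem isGaussian_pi {ι : Type*} [Fintype ι] {F : ι → Type*} [∀ i, NormedAddCommGroup (F i)]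
    [∀ i, NormedSpace ℝ (F i)] [∀ i, MeasurableSpace (F i)] [∀ i, BorelSpace (F i)]
    [∀ i, SecondCountableTopology (F i)] [∀ i, CompleteSpace (F i)]
    (μ : ∀ i, Measure (F i)) [∀ i, IsGaussian (μ i)] : IsGaussian (Measure.pi μ) := by
  have h1 : iIndepFun (fun i (x : ∀ i, F i) => x i) (Measure.pi μ) :=
    iIndepFun_pi (X := fun _ x => x) fun i => aemeasurable_id
  have h2 : ∀ i, HasGaussianLaw (fun x : ∀ i, F i => x i) (Measure.pi μ) := fun i =>
    ⟨by rw [(measurePreserving_eval μ i).map_eq]; infer_instance⟩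
  have h3 := (h1.hasGaussianLaw h2).isGaussian_map
  simpa using h3

instance (d : ℕ) : IsGaussian (stdComplexGaussianVec d) :=
  isGaussian_pi _

section Sample

variable {J : Type*} [Fintype J] [DecidableEq J] {d : J → ℕ}

/-- The joint law of independent vectors `x_j ∼ CN(0, I_{d j})`. -/
noncomputable def gaussianSample (d : J → ℕ) : Measure (∀ j, Fin (d j) → ℂ) :=
  Measure.pi fun j => stdComplexGaussianVec (d j)

instance : IsGaussian (gaussianSample d) := isGaussian_pi _

theorem stdComplexGaussian_integral {f : ℂ → ℂ} (hf : Continuous f) :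
    ∫ z, f z ∂stdComplexGaussian = ∫ p : ℝ × ℝ, f (p.1 + p.2 * Complex.I)
      ∂((gaussianReal 0 (1 / 2)).prod (gaussianReal 0 (1 / 2))) := by
  rw [stdComplexGaussian, integral_map (by fun_prop) hf.aestronglyMeasurable]
  congr 1
  ext p
  congr 1
  apply Complex.ext <;> simp [Complex.measurableEquivRealProd]

theorem integral_gaussianReal_sq :
    ∫ u : ℝ, u ^ 2 ∂(gaussianReal 0 (1 / 2)) = 1 / 2 := by
  have h := variance_id_gaussianReal (μ := 0) (v := 1 / 2)
  rw [variance_eq_integral (by fun_prop)] at h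
  simpa using h

theorem stdComplexGaussian_integral_id : ∫ z, z ∂stdComplexGaussian = 0 := by
  rw [stdComplexGaussian_integral (f := fun z => z) continuous_id]
  have hu : Tame (fun u : ℝ => (u : ℂ)) := Tame.of_clm Complex.ofRealCLM
  have h0 : ∫ u : ℝ, (u : ℂ) ∂(gaussianReal 0 (1 / 2)) = 0 := by
    rw [integral_complex_ofReal, integral_id_gaussianReal]; simp
  rw [integral_add (hu.comp_fst.integrable _)
    ((hu.comp_snd.mul (Tame.const Complex.I)).integrable _), integral_mul_const,
    integral_fun_fst (fun u : ℝ => (u : ℂ)), integral_fun_snd (fun u : ℝ => (u : ℂ)), h0]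
  simp

/-- Circular symmetry: the variances of the real and imaginary parts cancel, and the cross term is a
product of independent centred variables. For this reason only pairings of a column with a
conjugated column survive in integration by parts. -/
theorem stdComplexGaussian_integral_mul_self : ∫ z, z * z ∂stdComplexGaussian = 0 := by
  rw [stdComplexGaussian_integral (f := fun z => z * z) (by fun_prop)]
  have hu : Tame (fun u : ℝ => (u : ℂ)) := Tame.of_clm Complex.ofRealCLM
  have h0 : ∫ u : ℝ, (u : ℂ) ∂(gaussianReal 0 (1 / 2)) = 0 := by
    rw [integral_complex_ofReal, integral_id_gaussianReal]; simp
  have h2 : ∀ p : ℝ × ℝ, ((p.1 : ℂ) + p.2 * Complex.I) * (p.1 + p.2 * Complex.I) =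
      ((p.1 : ℂ) * p.1 - p.2 * p.2) + (p.1 * p.2) * (2 * Complex.I) := by
    intro p
    linear_combination (p.2 : ℂ) * p.2 * Complex.I_mul_I
  simp only [h2]
  have i1 := (hu.mul hu).comp_fst (W := ℝ)
  have i2 := (hu.mul hu).comp_snd (V := ℝ)
  rw [integral_add ((i1.sub i2).integrable _)
    (((hu.comp_fst.mul hu.comp_snd).mul (Tame.const _)).integrable _),
    integral_sub (i1.integrable _) (i2.integrable _), integral_mul_const,
    integral_prod_mul, integral_fun_fst (fun u : ℝ => (u : ℂ) * u),
    integral_fun_snd (fun u : ℝ => (u : ℂ) * u), h0]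
  simp

theorem stdComplexGaussian_integral_star_mul_self :
    ∫ z, star z * z ∂stdComplexGaussian = 1 := by
  rw [stdComplexGaussian_integral (f := fun z => star z * z) (by fun_prop)]
  have hu : Tame (fun u : ℝ => (u : ℂ)) := Tame.of_clm Complex.ofRealCLM
  have h2 : ∀ p : ℝ × ℝ, star ((p.1 : ℂ) + p.2 * Complex.I) * (p.1 + p.2 * Complex.I) =
      ((p.1 : ℂ) * p.1 + p.2 * p.2) := by
    intro p
    simp only [RCLike.star_def, map_add, map_mul, Complex.conj_ofReal, Complex.conj_I]
    linear_combination (-(p.2 : ℂ) * p.2) * Complex.I_mul_I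
  simp only [h2]
  have i1 := (hu.mul hu).comp_fst (W := ℝ)
  have i2 := (hu.mul hu).comp_snd (V := ℝ)
  have hs : ∫ u : ℝ, (u : ℂ) * u ∂(gaussianReal 0 (1 / 2)) = 1 / 2 := by
    have : ∀ u : ℝ, (u : ℂ) * u = ((u ^ 2 : ℝ) : ℂ) := by intro u; push_cast; ring
    simp only [this]
    rw [integral_complex_ofReal, integral_gaussianReal_sq]
    norm_num
  rw [integral_add (i1.integrable _) (i2.integrable _),
    integral_fun_fst (fun u : ℝ => (u : ℂ) * u), integral_fun_snd (fun u : ℝ => (u : ℂ) * u), hs]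
  norm_num

theorem integral_pi_mul_of_ne {ι : Type*} [Fintype ι] {F : ι → Type*}
    [∀ i, MeasurableSpace (F i)] (μ : ∀ i, Measure (F i)) [∀ i, IsProbabilityMeasure (μ i)]
    {i j : ι} (hij : i ≠ j) {f : F i → ℂ} {g : F j → ℂ} (hf : Measurable f) (hg : Measurable g) :
    ∫ x, f (x i) * g (x j) ∂(Measure.pi μ) = (∫ y, f y ∂μ i) * ∫ y, g y ∂μ j := by
  have h1 : iIndepFun (fun i (x : ∀ i, F i) => x i) (Measure.pi μ) :=
    iIndepFun_pi (X := fun _ x => x) fun i => aemeasurable_id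
  have h2 : IndepFun (fun x : ∀ i, F i => f (x i)) (fun x : ∀ i, F i => g (x j)) (Measure.pi μ) :=
    (h1.indepFun hij).comp hf hg
  rw [h2.integral_fun_mul_eq_mul_integral
      (hf.comp (measurable_pi_apply i)).aestronglyMeasurable
      (hg.comp (measurable_pi_apply j)).aestronglyMeasurable,
    integral_comp_eval hf.aestronglyMeasurable, integral_comp_eval hg.aestronglyMeasurable]

theorem gaussianSample_integral_eval (j : J) (a : Fin (d j)) {f : ℂ → ℂ} (hf : Continuous f) :
    ∫ x, f (x j a) ∂(gaussianSample d) = ∫ z, f z ∂stdComplexGaussian := by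
  rw [gaussianSample, integral_comp_eval (μ := fun j => stdComplexGaussianVec (d j)) (i := j)
    (f := fun y : Fin (d j) → ℂ => f (y a))
    (hf.comp (continuous_apply a)).aestronglyMeasurable, stdComplexGaussianVec,
    integral_comp_eval (μ := fun _ => stdComplexGaussian) (i := a)
      hf.aestronglyMeasurable]

theorem gaussianSample_integral_same (j : J) (a b : Fin (d j)) {f g : ℂ → ℂ}
    (hf : Continuous f) (hg : Continuous g) (h0 : ∫ z, f z ∂stdComplexGaussian = 0) :
    ∫ x, f (x j a) * g (x j b) ∂(gaussianSample d) =
      if a = b then ∫ z, f z * g z ∂stdComplexGaussian else 0 := by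
  split_ifs with h
  · subst h
    exact gaussianSample_integral_eval j a (f := fun z => f z * g z) (hf.mul hg)
  · rw [gaussianSample, integral_comp_eval (μ := fun j => stdComplexGaussianVec (d j)) (i := j)
      (f := fun y : Fin (d j) → ℂ => f (y a) * g (y b))
      ((hf.comp (continuous_apply a)).mul (hg.comp (continuous_apply b))).aestronglyMeasurable,
      stdComplexGaussianVec,
      integral_pi_mul_of_ne _ h hf.measurable hg.measurable, h0, zero_mul]

theorem gaussianSample_integral_ne {i j : J} (hij : i ≠ j) (a : Fin (d i)) (b : Fin (d j))
    {f g : ℂ → ℂ} (hf : Continuous f) (hg : Continuous g)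
    (h0 : ∫ z, f z ∂stdComplexGaussian = 0) :
    ∫ x, f (x i a) * g (x j b) ∂(gaussianSample d) = 0 := by
  rw [gaussianSample, integral_pi_mul_of_ne (fun j => stdComplexGaussianVec (d j)) hij
    (f := fun y => f (y a)) (g := fun y => g (y b)) (hf.measurable.comp (measurable_pi_apply a))
    (hg.measurable.comp (measurable_pi_apply b))]
  have : ∫ y, f (y a) ∂stdComplexGaussianVec (d i) = 0 := by
    rw [stdComplexGaussianVec, integral_comp_eval (μ := fun _ => stdComplexGaussian) (i := a)
      hf.aestronglyMeasurable, h0]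
  rw [this, zero_mul]

theorem stdComplexGaussian_integral_star : ∫ z, star z ∂stdComplexGaussian = 0 := by
  have := integral_conj (μ := stdComplexGaussian) (f := fun z : ℂ => z)
  rw [stdComplexGaussian_integral_id] at this
  simpa using this

theorem gaussianSample_integral_id : ∫ x, x ∂(gaussianSample d) = 0 := by
  ext j a
  have h1 : Integrable (fun x : (∀ j, Fin (d j) → ℂ) => x) (gaussianSample d) :=
    IsGaussian.integrable_id
  have h2 := (ContinuousLinearMap.proj (R := ℝ) (φ := fun _ : Fin (d j) => ℂ) a ∘L
    ContinuousLinearMap.proj (R := ℝ) (φ := fun j => Fin (d j) → ℂ) j).integral_comp_comm h1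
  simp only [ContinuousLinearMap.comp_apply, ContinuousLinearMap.proj_apply] at h2
  rw [← h2, gaussianSample_integral_eval j a (f := fun z => z) continuous_id,
    stdComplexGaussian_integral_id]
  rfl

end Sample

/-! ### Matrices with independent Gaussian columns -/

section Columns

variable {J : Type*} [Fintype J] [DecidableEq J] {d : J → ℕ}
variable {m n q : Type*} [Fintype m] [DecidableEq m] [Fintype n] [DecidableEq n]
  [Fintype q] [DecidableEq q]

/-- A family of matrices `P_j` of size `m × d j`. -/
abbrev Family (m : Type*) {J : Type*} (d : J → ℕ) := ∀ j : J, Matrix m (Fin (d j)) ℂ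

/-- The matrix with columns `P_j x_j`. -/
def cols (P : Family m d) (x : ∀ j, Fin (d j) → ℂ) : Matrix m J ℂ :=
  Matrix.of fun a j => (P j *ᵥ x j) a

/-- The entries of `cols P x` as linear forms in `x`. -/
noncomputable def colsCLM (P : Family m d) (a : m) (j : J) : (∀ j, Fin (d j) → ℂ) →L[ℝ] ℂ :=
  LinearMap.toContinuousLinearMap
    { toFun := fun x => (P j *ᵥ x j) a
      map_add' := fun x y => by simp [Matrix.mulVec_add]
      map_smul' := fun c x => by simp [Matrix.mulVec_smul] }

theorem cols_matDeriv (P : Family m d) : MatDeriv (cols P) (fun _ h => cols P h) :=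
  fun a j => TameDeriv.clm (colsCLM P a j)

theorem cols_tame (P : Family m d) (a : m) (j : J) : Tame fun x => cols P x a j :=
  (cols_matDeriv P a j).tame

theorem tame_eval (j : J) (a : Fin (d j)) : Tame fun x : (∀ j, Fin (d j) → ℂ) => x j a := by
  exact Tame.of_clm (ContinuousLinearMap.proj (R := ℝ) (φ := fun _ : Fin (d j) => ℂ) a ∘L
    ContinuousLinearMap.proj (R := ℝ) (φ := fun j => Fin (d j) → ℂ) j)

theorem integral_sum_mul_sum {i j : J} (u : Fin (d i) → ℂ) (v : Fin (d j) → ℂ) {f g : ℂ → ℂ}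
    (hf : Tame f) (hg : Tame g) :
    ∫ h : (∀ j, Fin (d j) → ℂ), (∑ a, u a * f (h i a)) * (∑ b, v b * g (h j b))
      ∂(gaussianSample d)
      = ∑ a, ∑ b, u a * v b * ∫ h : (∀ j, Fin (d j) → ℂ), f (h i a) * g (h j b)
        ∂(gaussianSample d) := by
  have hev : ∀ (k : J) (c : Fin (d k)) {φ : ℂ → ℂ}, Tame φ →
      Tame fun h : (∀ j, Fin (d j) → ℂ) => φ (h k c) := by
    intro k c φ hφ
    refine hφ.comp (tame_eval k c).1 (a := 1) fun h => ?_
    rw [one_mul]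
    exact (norm_le_pi_norm (h k) c).trans (norm_le_pi_norm h k)
  have ht : ∀ a b, Tame fun h : (∀ j, Fin (d j) → ℂ) => u a * v b * (f (h i a) * g (h j b)) :=
    fun a b => (Tame.const _).mul ((hev i a hf).mul (hev j b hg))
  have h1 : ∀ h : (∀ j, Fin (d j) → ℂ), (∑ a, u a * f (h i a)) * (∑ b, v b * g (h j b)) =
      ∑ a, ∑ b, u a * v b * (f (h i a) * g (h j b)) := by
    intro h
    rw [Finset.sum_mul_sum]
    refine Finset.sum_congr rfl fun a _ => Finset.sum_congr rfl fun b _ => by ring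
  simp only [h1]
  rw [integral_finsetSum _ fun a _ => (Tame.sum _ fun b _ => ht a b).integrable _]
  refine Finset.sum_congr rfl fun a _ => ?_
  rw [integral_finsetSum _ fun b _ => (ht a b).integrable _]
  refine Finset.sum_congr rfl fun b _ => ?_
  rw [integral_const_mul]

theorem tame_id : Tame (fun z : ℂ => z) := Tame.of_clm (ContinuousLinearMap.id ℝ ℂ)

theorem tame_star : Tame (fun z : ℂ => star z) := tame_id.star

theorem integral_star_form_mul_form_same (j : J) (u v : Fin (d j) → ℂ) :
    ∫ h : (∀ j, Fin (d j) → ℂ), star (∑ a, u a * h j a) * (∑ b, v b * h j b)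
      ∂(gaussianSample d) = ∑ a, star (u a) * v a := by
  have h := integral_sum_mul_sum (d := d) (i := j) (j := j) (fun a => star (u a)) v
    tame_star tame_id
  simp only [star_sum, star_mul']
  rw [h]
  refine Finset.sum_congr rfl fun a _ => ?_
  rw [Finset.sum_eq_single a]
  · rw [gaussianSample_integral_same j a a tame_star.1 tame_id.1 stdComplexGaussian_integral_star,
      if_pos rfl, stdComplexGaussian_integral_star_mul_self, mul_one]
  · intro b _ hb
    rw [gaussianSample_integral_same j a b tame_star.1 tame_id.1 stdComplexGaussian_integral_star,
      if_neg (Ne.symm hb), mul_zero]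
  · simp

theorem integral_star_form_mul_form_ne {i j : J} (hij : i ≠ j) (u : Fin (d i) → ℂ)
    (v : Fin (d j) → ℂ) :
    ∫ h : (∀ j, Fin (d j) → ℂ), star (∑ a, u a * h i a) * (∑ b, v b * h j b)
      ∂(gaussianSample d) = 0 := by
  have h := integral_sum_mul_sum (d := d) (i := i) (j := j) (fun a => star (u a)) v
    tame_star tame_id
  simp only [star_sum, star_mul']
  rw [h]
  refine Finset.sum_eq_zero fun a _ => Finset.sum_eq_zero fun b _ => ?_
  rw [gaussianSample_integral_ne hij a b tame_star.1 tame_id.1 stdComplexGaussian_integral_star,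
    mul_zero]

theorem integral_star_form_mul_star_form (i j : J) (u : Fin (d i) → ℂ) (v : Fin (d j) → ℂ) :
    ∫ h : (∀ j, Fin (d j) → ℂ), star (∑ a, u a * h i a) * star (∑ b, v b * h j b)
      ∂(gaussianSample d) = 0 := by
  have h := integral_sum_mul_sum (d := d) (i := i) (j := j) (fun a => star (u a))
    (fun b => star (v b)) tame_star tame_star
  simp only [star_sum, star_mul']
  rw [h]
  refine Finset.sum_eq_zero fun a _ => Finset.sum_eq_zero fun b _ => ?_
  by_cases hij : i = j
  · subst hij
    have h0 : ∫ z, star z * star z ∂stdComplexGaussian = 0 := by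
      have := integral_conj (μ := stdComplexGaussian) (f := fun z : ℂ => z * z)
      rw [stdComplexGaussian_integral_mul_self] at this
      simpa using this
    rw [gaussianSample_integral_same i a b tame_star.1 tame_star.1
      stdComplexGaussian_integral_star, h0, ite_self, mul_zero]
  · rw [gaussianSample_integral_ne hij a b tame_star.1 tame_star.1
      stdComplexGaussian_integral_star, mul_zero]

theorem integral_star_cols_mul_cols_same (P : Family m d) (R : Family n d) (j : J) (a : m)
    (b : n) : ∫ h, star (cols P h a j) * cols R h b j ∂(gaussianSample d) =
      (R j * (P j)ᴴ) b a := by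
  refine (integral_star_form_mul_form_same j (P j a) (R j b)).trans ?_
  simp [Matrix.mul_apply, mul_comm]

theorem integral_star_cols_mul_cols_ne (P : Family m d) (R : Family n d) {i j : J} (hij : i ≠ j)
    (a : m) (b : n) : ∫ h, star (cols P h a i) * cols R h b j ∂(gaussianSample d) = 0 :=
  integral_star_form_mul_form_ne hij (P i a) (R j b)

theorem integral_star_cols_mul_star_cols (P : Family m d) (R : Family n d) (i j : J)
    (a : m) (b : n) : ∫ h, star (cols P h a i) * star (cols R h b j) ∂(gaussianSample d) = 0 :=
  integral_star_form_mul_star_form i j (P i a) (R j b)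

/-- Different columns are independent and centred, so only column i of the second factor pairs with
the i-th conjugated column. That pairing splits off a trace and leaves the diagonal entry of W. -/
theorem integral_colsH_mul_cols (P : Family m d) (R : Family n d) (U : Matrix m n ℂ)
    (W : Matrix J J ℂ) (i : J) :
    ∫ h, ((cols P h)ᴴ * (U * cols R h * W)) i i ∂(gaussianSample d) =
      ((P i)ᴴ * U * R i).trace * W i i := by
  have h1 : ∀ h, ((cols P h)ᴴ * (U * cols R h * W)) i i =
      ∑ a, ∑ j, ∑ b, U a b * W j i * (star (cols P h a i) * cols R h b j) := by
    intro h
    simp only [Matrix.mul_apply, Matrix.conjTranspose_apply, Finset.mul_sum, Finset.sum_mul]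
    refine Finset.sum_congr rfl fun a _ => Finset.sum_congr rfl fun j _ =>
      Finset.sum_congr rfl fun b _ => by ring
  have ht : ∀ a j b, Tame fun h => U a b * W j i * (star (cols P h a i) * cols R h b j) :=
    fun a j b => (Tame.const _).mul ((cols_tame P a i).star.mul (cols_tame R b j))
  simp only [h1]
  rw [integral_finsetSum _ fun a _ => (Tame.sum _ fun j _ => Tame.sum _ fun b _ =>
    ht a j b).integrable _]
  have h2 : ((P i)ᴴ * U * R i).trace = ∑ a, ∑ b, U a b * (R i * (P i)ᴴ) b a := by
    rw [Matrix.mul_assoc, Matrix.trace_mul_comm, Matrix.mul_assoc]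
    simp only [Matrix.trace, Matrix.diag]
    exact Finset.sum_congr rfl fun a _ => Matrix.mul_apply
  rw [h2, Finset.sum_mul]
  refine Finset.sum_congr rfl fun a _ => ?_
  rw [integral_finsetSum _ fun j _ => (Tame.sum _ fun b _ => ht a j b).integrable _,
    Finset.sum_eq_single i, integral_finsetSum _ fun b _ => (ht a i b).integrable _,
    Finset.sum_mul]
  · refine Finset.sum_congr rfl fun b _ => ?_
    rw [integral_const_mul, integral_star_cols_mul_cols_same]
    ring
  · intro j _ hj
    rw [integral_finsetSum _ fun b _ => (ht a j b).integrable _]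
    refine Finset.sum_eq_zero fun b _ => ?_
    rw [integral_const_mul, integral_star_cols_mul_cols_ne P R (Ne.symm hj), mul_zero]
  · simp

/-- Every term contains two conjugated Gaussian entries, whose product has mean zero. -/
theorem integral_colsH_mul_colsH (P : Family m d) (R : Family n d) (U : Matrix m J ℂ)
    (W : Matrix n J ℂ) (i : J) :
    ∫ h, ((cols P h)ᴴ * (U * (cols R h)ᴴ * W)) i i ∂(gaussianSample d) = 0 := by
  have h1 : ∀ h, ((cols P h)ᴴ * (U * (cols R h)ᴴ * W)) i i =
      ∑ a, ∑ b, ∑ j, U a j * W b i * (star (cols P h a i) * star (cols R h b j)) := by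
    intro h
    simp only [Matrix.mul_apply, Matrix.conjTranspose_apply, Finset.mul_sum, Finset.sum_mul]
    refine Finset.sum_congr rfl fun a _ => Finset.sum_congr rfl fun j _ =>
      Finset.sum_congr rfl fun b _ => by ring
  have ht : ∀ a b j, Tame fun h => U a j * W b i * (star (cols P h a i) * star (cols R h b j)) :=
    fun a b j => (Tame.const _).mul ((cols_tame P a i).star.mul (cols_tame R b j).star)
  simp only [h1]
  rw [integral_finsetSum _ fun a _ => (Tame.sum _ fun j _ => Tame.sum _ fun b _ =>
    ht a j b).integrable _]
  refine Finset.sum_eq_zero fun a _ => ?_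
  rw [integral_finsetSum _ fun j _ => (Tame.sum _ fun b _ => ht a j b).integrable _]
  refine Finset.sum_eq_zero fun b _ => ?_
  rw [integral_finsetSum _ fun j _ => (ht a b j).integrable _]
  refine Finset.sum_eq_zero fun j _ => ?_
  rw [integral_const_mul, integral_star_cols_mul_star_cols, mul_zero]

theorem tame_trace_mul_cols (P : Family m d) (G : Matrix J m ℂ) :
    Tame fun h => (G * cols P h).trace :=
  ((cols_matDeriv P).const_mul G).trace.tame

theorem trace_mul_cols_eq (P : Family m d) (G : Matrix J m ℂ) (h : ∀ j, Fin (d j) → ℂ) :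
    (G * cols P h).trace = ∑ j, ∑ a, (G j ᵥ* P j) a * h j a := by
  simp only [Matrix.trace, Matrix.diag]
  refine Finset.sum_congr rfl fun j _ => ?_
  have : (G * cols P h) j j = G j ⬝ᵥ (P j *ᵥ h j) := rfl
  rw [this, Matrix.dotProduct_mulVec]
  rfl

/-- The columns are independent and white, so the second moment is exactly the sum of ‖G_j P_j‖²
over the rows G_j of G. -/
theorem integral_norm_trace_mul_cols_sq_le {β : ℝ} (P : Family m d) (hP : ∀ j, ‖P j‖ ≤ β)
    (G : Matrix J m ℂ) :
    ∫ h, ‖(G * cols P h).trace‖ ^ 2 ∂(gaussianSample d) ≤ β ^ 2 * frSq G := by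
  set S : J → (∀ j, Fin (d j) → ℂ) → ℂ := fun j h => ∑ a, (G j ᵥ* P j) a * h j a with hS
  have hSt : ∀ j, Tame (S j) := fun j =>
    Tame.sum _ fun a _ => (Tame.const _).mul (tame_eval j a)
  have h1 : ((∫ h, ‖(G * cols P h).trace‖ ^ 2 ∂(gaussianSample d) : ℝ) : ℂ) =
      ((∑ j, ∑ a, ‖(G j ᵥ* P j) a‖ ^ 2 : ℝ) : ℂ) := by
    rw [← integral_complex_ofReal]
    have h2 : ∀ h : (∀ j, Fin (d j) → ℂ), ((‖(G * cols P h).trace‖ ^ 2 : ℝ) : ℂ) =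
        ∑ i, ∑ j, star (S i h) * S j h := by
      intro h
      rw [trace_mul_cols_eq, ← Finset.sum_mul_sum, ← star_sum, RCLike.star_def, mul_comm,
        Complex.mul_conj, Complex.normSq_eq_norm_sq]
    simp only [h2]
    rw [integral_finsetSum _ fun i _ => (Tame.sum _ fun j _ =>
      (hSt i).star.mul (hSt j)).integrable _]
    push_cast
    refine Finset.sum_congr rfl fun i _ => ?_
    rw [integral_finsetSum _ fun j _ => ((hSt i).star.mul (hSt j)).integrable _,
      Finset.sum_eq_single i]
    · rw [hS, integral_star_form_mul_form_same]
      refine Finset.sum_congr rfl fun a _ => ?_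
      rw [RCLike.star_def, mul_comm, Complex.mul_conj, Complex.normSq_eq_norm_sq]
      push_cast
      rfl
    · intro j _ hj
      exact integral_star_form_mul_form_ne (Ne.symm hj) _ _
    · simp
  rw [Complex.ofReal_inj.1 h1, frSq, Finset.mul_sum]
  refine Finset.sum_le_sum fun j _ => (sum_norm_vecMul_sq_le (P j) (G j)).trans ?_
  have := hP j
  gcongr

theorem integral_norm_trace_mul_colsH_sq_le {β : ℝ} (P : Family m d) (hP : ∀ j, ‖P j‖ ≤ β)
    (G : Matrix m J ℂ) :
    ∫ h, ‖(G * (cols P h)ᴴ).trace‖ ^ 2 ∂(gaussianSample d) ≤ β ^ 2 * frSq G := by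
  have h1 : ∀ h, ‖(G * (cols P h)ᴴ).trace‖ = ‖(Gᴴ * cols P h).trace‖ := by
    intro h
    rw [← norm_star, ← Matrix.trace_conjTranspose, Matrix.conjTranspose_mul,
      Matrix.conjTranspose_conjTranspose, Matrix.trace_mul_comm]
  simp only [h1]
  rw [← frSq_conjTranspose G]
  exact integral_norm_trace_mul_cols_sq_le P hP Gᴴ

/-- Integration by parts for one column. -/
theorem integral_colsH_mul_eq (P : Family m d) {V : (∀ j, Fin (d j) → ℂ) → Matrix m J ℂ}
    {V' : (∀ j, Fin (d j) → ℂ) → (∀ j, Fin (d j) → ℂ) → Matrix m J ℂ} (hV : MatDeriv V V')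
    (i : J) :
    ∫ x, ((cols P x)ᴴ * V x) i i ∂(gaussianSample d) =
      ∫ x, ∫ h, ((cols P h)ᴴ * V' x h) i i ∂(gaussianSample d) ∂(gaussianSample d) := by
  have ht : Tame fun p : (∀ j, Fin (d j) → ℂ) × (∀ j, Fin (d j) → ℂ) =>
      ((cols P p.2)ᴴ * V' p.1 p.2) i i := by
    simp only [Matrix.mul_apply, Matrix.conjTranspose_apply]
    exact Tame.sum _ fun a _ => ((cols_tame P a i).star.comp_snd).mul (hV a i).tame'
  rw [← integral_prod _ (ht.integrable _)]
  simp only [Matrix.mul_apply, Matrix.conjTranspose_apply]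
  rw [integral_finsetSum _ fun a _ => ((cols_tame P a i).star.mul (hV a i).tame).integrable _,
    integral_finsetSum _ fun a _ =>
      (((cols_tame P a i).star.comp_snd).mul (hV a i).tame').integrable _]
  refine Finset.sum_congr rfl fun a _ => ?_
  -- The linear form is the conjugate of an entry of P x. It is only real linear, which is why
  -- derivatives are taken over ℝ throughout.
  exact (hV a i).integral_mul_eq (gaussianSample d) gaussianSample_integral_id
    ((Complex.conjCLE : ℂ →L[ℝ] ℂ) ∘L colsCLM P a i)

/-! ### The resolvent -/

/-- `(X Xᴴ + T)⁻¹`, where `X` has columns `A_j x_j`. -/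
noncomputable def resolv (A : Family m d) (T : Matrix m m ℂ) (x : ∀ j, Fin (d j) → ℂ) :
    Matrix m m ℂ := (cols A x * (cols A x)ᴴ + T)⁻¹

/-- The directional derivative of `resolv`. -/
noncomputable def dResolv (A : Family m d) (T : Matrix m m ℂ) (x h : ∀ j, Fin (d j) → ℂ) :
    Matrix m m ℂ :=
  -(resolv A T x * (cols A h * (cols A x)ᴴ + cols A x * (cols A h)ᴴ) * resolv A T x)

/-- Uniform bounds on a family `A` and a matrix `T`. -/
structure Bounded (B β : ℝ) (A : Family m d) (T : Matrix m m ℂ) : Prop where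
  one_le : 1 ≤ B
  pos : 0 < β
  lower : LowerBdd B⁻¹ T
  norm_le : ∀ j, ‖A j‖ ≤ β
  card_row : Fintype.card m * β ^ 2 ≤ B
  card_col : Fintype.card J * β ^ 2 ≤ B

namespace Bounded

variable {B β : ℝ} {A : Family m d} {T : Matrix m m ℂ} (hA : Bounded B β A T)
include hA

theorem B_pos : 0 < B := zero_lt_one.trans_le hA.one_le

theorem inv_pos : 0 < B⁻¹ := _root_.inv_pos.2 hA.B_pos

theorem posDef (x : ∀ j, Fin (d j) → ℂ) : (cols A x * (cols A x)ᴴ + T).PosDef :=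
  resolvent_posDef hA.inv_pos hA.lower _

theorem isUnit_det (x : ∀ j, Fin (d j) → ℂ) : IsUnit (cols A x * (cols A x)ᴴ + T).det :=
  (Matrix.isUnit_iff_isUnit_det _).1 (hA.posDef x).isUnit

theorem resolv_posDef (x : ∀ j, Fin (d j) → ℂ) : (resolv A T x).PosDef := (hA.posDef x).inv

theorem norm_resolv_le (x : ∀ j, Fin (d j) → ℂ) : ‖resolv A T x‖ ≤ B := by
  have h := norm_inv_le_of_lowerBdd hA.inv_pos hA.lower (cols A x)
  rwa [inv_inv] at h

theorem norm_colsH_mul_resolv_sq_le (x : ∀ j, Fin (d j) → ℂ) :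
    ‖(cols A x)ᴴ * resolv A T x‖ ^ 2 ≤ B := by
  have h := norm_conjTranspose_mul_inv_sq_le hA.inv_pos hA.lower (cols A x)
  rwa [inv_inv] at h

theorem norm_resolv_mul_cols_sq_le (x : ∀ j, Fin (d j) → ℂ) :
    ‖resolv A T x * cols A x‖ ^ 2 ≤ B := by
  have h := norm_inv_mul_sq_le hA.inv_pos hA.lower (cols A x)
  rwa [inv_inv] at h

theorem resolv_matDeriv : MatDeriv (resolv A T) (dResolv A T) := by
  have h0 := ((cols_matDeriv A).mul (cols_matDeriv A).conjTranspose).add (MatDeriv.const T)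
  have h1 := h0.inv (C := B) hA.isUnit_det fun x i j =>
    (norm_entry_le _ i j).trans (hA.norm_resolv_le x)
  simp only [add_zero] at h1
  exact h1

/-- By cyclicity the derivative -Q(hXᴴ + Xhᴴ)Q becomes a trace of (XᴴQ)(LQ) against the increment
plus one of QL(QX) against its adjoint. Here X occurs only in XᴴQ and QX, of squared norm at most B,
while ‖Q‖² ≤ B², which makes B³ for each half. -/
theorem integral_norm_trace_mul_dResolv_sq_le (x : ∀ j, Fin (d j) → ℂ) (L : Matrix m m ℂ) :
    ∫ h, ‖(L * dResolv A T x h).trace‖ ^ 2 ∂(gaussianSample d) ≤ 4 * B ^ 3 * β ^ 2 * frSq L := by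
  set Q := resolv A T x with hQ
  set X := cols A x with hX
  have hQn : ‖Q‖ ^ 2 ≤ B ^ 2 := pow_le_pow_left₀ (norm_nonneg _) (hA.norm_resolv_le x) 2
  have hB := hA.B_pos
  have h1 : ∀ h, ‖(L * dResolv A T x h).trace‖ ^ 2 ≤
      2 * ‖(((Xᴴ * Q) * (L * Q)) * cols A h).trace‖ ^ 2 +
      2 * ‖((Q * L * (Q * X)) * (cols A h)ᴴ).trace‖ ^ 2 := by
    intro h
    have h2 : (L * dResolv A T x h).trace = -((((Xᴴ * Q) * (L * Q)) * cols A h).trace +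
        ((Q * L * (Q * X)) * (cols A h)ᴴ).trace) := by
      rw [dResolv, ← hQ, ← hX, Matrix.mul_neg, Matrix.trace_neg, Matrix.mul_add, Matrix.add_mul,
        Matrix.mul_add, Matrix.trace_add]
      congr 2
      · rw [Matrix.trace_mul_comm, Matrix.trace_mul_comm (Xᴴ * Q * (L * Q))]
        have : Q * (cols A h * Xᴴ) * Q * L = Q * (cols A h * (Xᴴ * Q * L)) := by
          simp only [Matrix.mul_assoc]
        rw [this, Matrix.trace_mul_comm]
        simp only [Matrix.mul_assoc]
      · rw [Matrix.trace_mul_comm, Matrix.mul_assoc Q L,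
          Matrix.mul_assoc Q (L * (Q * X)), Matrix.trace_mul_comm Q]
        rw [Matrix.trace_mul_comm]
        simp only [Matrix.mul_assoc]
    rw [h2, norm_neg]
    have h3 := norm_add_le (((Xᴴ * Q) * (L * Q)) * cols A h).trace
      ((Q * L * (Q * X)) * (cols A h)ᴴ).trace
    nlinarith [norm_nonneg ((((Xᴴ * Q) * (L * Q)) * cols A h).trace +
        ((Q * L * (Q * X)) * (cols A h)ᴴ).trace),
      sq_nonneg (‖(((Xᴴ * Q) * (L * Q)) * cols A h).trace‖ -
        ‖((Q * L * (Q * X)) * (cols A h)ᴴ).trace‖)]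
  have t1 : Tame fun h => ‖(((Xᴴ * Q) * (L * Q)) * cols A h).trace‖ ^ 2 :=
    (tame_trace_mul_cols A _).norm_sq
  have t2 : Tame fun h => ‖((Q * L * (Q * X)) * (cols A h)ᴴ).trace‖ ^ 2 :=
    ((cols_matDeriv A).conjTranspose.const_mul _).trace.tame.norm_sq
  have f1 : frSq ((Xᴴ * Q) * (L * Q)) ≤ B ^ 3 * frSq L := by
    have h5 := frSq_mul_le (Xᴴ * Q) (L * Q)
    have h6 := frSq_mul_le' L Q
    have h7 := hA.norm_colsH_mul_resolv_sq_le x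
    have h8 := frSq_nonneg L
    calc _ ≤ B * (frSq L * B ^ 2) := h5.trans (mul_le_mul h7 (h6.trans (by gcongr))
            (frSq_nonneg _) hB.le)
      _ = _ := by ring
  have f2 : frSq (Q * L * (Q * X)) ≤ B ^ 3 * frSq L := by
    have h5 := frSq_mul_le' (Q * L) (Q * X)
    have h6 := frSq_mul_le Q L
    have h7 := hA.norm_resolv_mul_cols_sq_le x
    have h8 := frSq_nonneg L
    calc _ ≤ (B ^ 2 * frSq L) * B := h5.trans (mul_le_mul (h6.trans (by gcongr)) h7
            (sq_nonneg _) (by positivity))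
      _ = _ := by ring
  have g1 := integral_norm_trace_mul_cols_sq_le A hA.norm_le ((Xᴴ * Q) * (L * Q))
  have g2 := integral_norm_trace_mul_colsH_sq_le A hA.norm_le (Q * L * (Q * X))
  have h9 := integral_mono_of_nonneg (Eventually.of_forall fun h => sq_nonneg _)
    (((t1.integrable (gaussianSample d)).const_mul 2).add ((t2.integrable _).const_mul 2))
    (Eventually.of_forall h1)
  simp only [Pi.add_apply] at h9
  rw [integral_add ((t1.integrable (gaussianSample d)).const_mul 2) ((t2.integrable _).const_mul 2),
    integral_const_mul, integral_const_mul] at h9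
  nlinarith [mul_le_mul_of_nonneg_left f1 (sq_nonneg β), mul_le_mul_of_nonneg_left f2 (sq_nonneg β)]

end Bounded

end Columns

/-! ### Variance bounds -/

section Variance

variable {J : Type*} [Fintype J] [DecidableEq J] {d : J → ℕ}
variable {m n : Type*} [Fintype m] [DecidableEq m] [Fintype n] [DecidableEq n]

/-- The expectation under the law of the Gaussian sample. -/
noncomputable def gMean (f : (∀ j, Fin (d j) → ℂ) → ℂ) : ℂ := ∫ x, f x ∂(gaussianSample d)

/-- The variance under the law of the Gaussian sample. -/
noncomputable def gVar (f : (∀ j, Fin (d j) → ℂ) → ℂ) : ℝ :=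
  ∫ x, ‖f x - gMean f‖ ^ 2 ∂(gaussianSample d)

theorem gVar_le_of_deriv {f : (∀ j, Fin (d j) → ℂ) → ℂ}
    {f' : (∀ j, Fin (d j) → ℂ) → (∀ j, Fin (d j) → ℂ) → ℂ} (hf : TameDeriv f f')
    {b : (∀ j, Fin (d j) → ℂ) → ℝ} (hb : Tame b)
    (h : ∀ x, ∫ y, ‖f' x y‖ ^ 2 ∂(gaussianSample d) ≤ b x) :
    gVar f ≤ 3 * ∫ x, b x ∂(gaussianSample d) := by
  refine (hf.integral_norm_sub_sq_le (gaussianSample d) gaussianSample_integral_id).trans ?_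
  rw [integral_prod _ (hf.tame'.norm_sq.integrable _)]
  have := integral_mono_of_nonneg
    (Eventually.of_forall fun x => integral_nonneg fun y => sq_nonneg ‖f' x y‖)
    (hb.integrable (gaussianSample d)) (Eventually.of_forall h)
  linarith

theorem norm_gMean_mul_sub_le {f g : (∀ j, Fin (d j) → ℂ) → ℂ} (hf : Tame f) (hg : Tame g)
    {a b : ℝ} (ha : 0 < a) (hb : 0 < b) (hfa : gVar f ≤ a ^ 2) (hgb : gVar g ≤ b ^ 2) :
    ‖gMean (fun x => f x * g x) - gMean f * gMean g‖ ≤ a * b :=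
  norm_integral_mul_sub_le _ hf hg ha hb hfa hgb

theorem gMean_add {f g : (∀ j, Fin (d j) → ℂ) → ℂ} (hf : Tame f) (hg : Tame g) :
    gMean (fun x => f x + g x) = gMean f + gMean g :=
  integral_add (hf.integrable _) (hg.integrable _)

theorem gMean_sub {f g : (∀ j, Fin (d j) → ℂ) → ℂ} (hf : Tame f) (hg : Tame g) :
    gMean (fun x => f x - g x) = gMean f - gMean g :=
  integral_sub (hf.integrable _) (hg.integrable _)

theorem gMean_sum {ι : Type*} (s : Finset ι) {f : ι → (∀ j, Fin (d j) → ℂ) → ℂ}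
    (hf : ∀ i ∈ s, Tame (f i)) : gMean (fun x => ∑ i ∈ s, f i x) = ∑ i ∈ s, gMean (f i) :=
  integral_finsetSum _ fun i hi => (hf i hi).integrable _

theorem gMean_const_mul (c : ℂ) (f : (∀ j, Fin (d j) → ℂ) → ℂ) :
    gMean (fun x => c * f x) = c * gMean f :=
  integral_const_mul _ _

theorem gMean_const (c : ℂ) : gMean (fun _ : (∀ j, Fin (d j) → ℂ) => c) = c := by
  simp [gMean]

theorem norm_gMean_le {f : (∀ j, Fin (d j) → ℂ) → ℂ} {C : ℝ} (h : ∀ x, ‖f x‖ ≤ C) :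
    ‖gMean f‖ ≤ C := by
  have := norm_integral_le_of_norm_le_const (μ := gaussianSample d) (Eventually.of_forall h)
  simpa [gMean] using this

theorem tame_frSq {V : Type*} [NormedAddCommGroup V] {F : V → Matrix m n ℂ}
    (hF : ∀ i j, Tame fun x => F x i j) : Tame fun x => frSq (F x) :=
  Tame.sum _ fun i _ => Tame.sum _ fun j _ => (hF i j).norm_sq

theorem norm_add_sq_le_two (a b : ℂ) : ‖a + b‖ ^ 2 ≤ 2 * ‖a‖ ^ 2 + 2 * ‖b‖ ^ 2 := by
  have h := norm_add_le a b
  nlinarith [norm_nonneg (a + b), sq_nonneg (‖a‖ - ‖b‖)]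

theorem norm_add_sq_le_four (a b c e : ℂ) :
    ‖a + b + c + e‖ ^ 2 ≤ 4 * ‖a‖ ^ 2 + 4 * ‖b‖ ^ 2 + 4 * ‖c‖ ^ 2 + 4 * ‖e‖ ^ 2 := by
  have h1 := norm_add_sq_le_two (a + b) (c + e)
  have h2 := norm_add_sq_le_two a b
  have h3 := norm_add_sq_le_two c e
  rw [← add_assoc] at h1
  linarith

theorem integral_four_le {E : Type*} [MeasurableSpace E] {μ : Measure E}
    {f f₁ f₂ f₃ f₄ : E → ℂ} (h : ∀ x, f x = f₁ x + f₂ x + f₃ x + f₄ x)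
    (h₁ : Integrable (fun x => ‖f₁ x‖ ^ 2) μ) (h₂ : Integrable (fun x => ‖f₂ x‖ ^ 2) μ)
    (h₃ : Integrable (fun x => ‖f₃ x‖ ^ 2) μ) (h₄ : Integrable (fun x => ‖f₄ x‖ ^ 2) μ) :
    ∫ x, ‖f x‖ ^ 2 ∂μ ≤ 4 * ∫ x, ‖f₁ x‖ ^ 2 ∂μ + 4 * ∫ x, ‖f₂ x‖ ^ 2 ∂μ +
      4 * ∫ x, ‖f₃ x‖ ^ 2 ∂μ + 4 * ∫ x, ‖f₄ x‖ ^ 2 ∂μ := by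
  have i1 := h₁.const_mul 4
  have i2 := h₂.const_mul 4
  have i3 := h₃.const_mul 4
  have i4 := h₄.const_mul 4
  have i12 : Integrable (fun x => 4 * ‖f₁ x‖ ^ 2 + 4 * ‖f₂ x‖ ^ 2) μ := i1.add i2
  have i123 : Integrable (fun x => 4 * ‖f₁ x‖ ^ 2 + 4 * ‖f₂ x‖ ^ 2 + 4 * ‖f₃ x‖ ^ 2) μ :=
    i12.add i3
  have i1234 : Integrable (fun x => 4 * ‖f₁ x‖ ^ 2 + 4 * ‖f₂ x‖ ^ 2 + 4 * ‖f₃ x‖ ^ 2 +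
    4 * ‖f₄ x‖ ^ 2) μ := i123.add i4
  have := integral_mono_of_nonneg (Eventually.of_forall fun x => sq_nonneg ‖f x‖) i1234
    (Eventually.of_forall fun x => by
      simp only [h x]
      exact norm_add_sq_le_four _ _ _ _)
  rw [integral_add i123 i4, integral_add i12 i3, integral_add i1 i2, integral_const_mul,
    integral_const_mul, integral_const_mul, integral_const_mul] at this
  exact this

theorem Tame.slice {V W F : Type*} [NormedAddCommGroup V] [NormedAddCommGroup W]
    [NormedAddCommGroup F] {f : V → W → F} (hf : Tame fun p : V × W => f p.1 p.2) (v : V) :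
    Tame (f v) := by
  obtain ⟨hc, C, p, hC, hp⟩ := hf
  refine ⟨hc.comp (Continuous.prodMk continuous_const continuous_id), C * (1 + ‖v‖) ^ p, p,
    by positivity, fun w => (hp (v, w)).trans ?_⟩
  rw [mul_assoc, ← mul_pow]
  have : ‖(v, w)‖ ≤ ‖v‖ + ‖w‖ := by
    rw [Prod.norm_def]
    exact max_le (by simp) (by simp)
  gcongr
  nlinarith [norm_nonneg v, norm_nonneg w]

theorem Tame.ofReal {V : Type*} [NormedAddCommGroup V] {f : V → ℝ} (hf : Tame f) :
    Tame fun v => (f v : ℂ) := by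
  obtain ⟨hc, C, p, hC, hp⟩ := hf
  exact ⟨Complex.continuous_ofReal.comp hc, C, p, hC, fun v => by
    rw [Complex.norm_real]; exact hp v⟩

namespace Bounded

variable {B β : ℝ} {A : Family m d} {T : Matrix m m ℂ} (hA : Bounded B β A T)
  {A' : Family n d} {T' : Matrix n n ℂ} (hA' : Bounded B β A' T')

include hA in
theorem tame_trace_mul_resolv (C : Matrix m m ℂ) : Tame fun x => (C * resolv A T x).trace :=
  (hA.resolv_matDeriv.const_mul C).trace.tame

include hA in
-- The dependence on the Frobenius norm is what matters. A bounded C has squared Frobenius norm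
-- O(β⁻²) and gives variance O(1), whereas C = R_i P_iᴴ has squared Frobenius norm O(β²) and gives
-- O(β⁴).
theorem gVar_trace_mul_resolv_le (C : Matrix m m ℂ) :
    gVar (fun x => (C * resolv A T x).trace) ≤ 12 * B ^ 3 * β ^ 2 * frSq C := by
  have h := gVar_le_of_deriv (hA.resolv_matDeriv.const_mul C).trace
    (Tame.const (4 * B ^ 3 * β ^ 2 * frSq C))
    (fun x => hA.integral_norm_trace_mul_dResolv_sq_le x C)
  refine h.trans (le_of_eq ?_)
  simp only [integral_const, probReal_univ, one_smul]
  ring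

include hA hA' in
theorem tame_trace_resolv_mul_resolv (C : Matrix n m ℂ) (D : Matrix m n ℂ) :
    Tame fun x => (C * resolv A T x * D * resolv A' T' x).trace :=
  (((hA.resolv_matDeriv.const_mul C).mul_const D).mul hA'.resolv_matDeriv).trace.tame

include hA hA' in
-- In the product rule each half is, after a cyclic shift, a trace against the derivative of a
-- single resolvent with a bounded coefficient.
theorem gVar_trace_resolv_mul_resolv_le (C : Matrix n m ℂ) (D : Matrix m n ℂ) :
    gVar (fun x => (C * resolv A T x * D * resolv A' T' x).trace) ≤
      48 * B ^ 5 * β ^ 2 * (‖D‖ ^ 2 * frSq C) := by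
  have hB := hA.B_pos
  have hd := (((hA.resolv_matDeriv.const_mul C).mul_const D).mul hA'.resolv_matDeriv).trace
  have h := gVar_le_of_deriv hd (Tame.const (16 * B ^ 5 * β ^ 2 * (‖D‖ ^ 2 * frSq C)))
    (fun x => ?_)
  · refine h.trans (le_of_eq ?_)
    simp only [integral_const, probReal_univ, one_smul]
    ring
  · have h1 : ∀ y, (C * dResolv A T x y * D * resolv A' T' x +
        C * resolv A T x * D * dResolv A' T' x y).trace =
        (D * resolv A' T' x * C * dResolv A T x y).trace +
        (C * resolv A T x * D * dResolv A' T' x y).trace := by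
      intro y
      rw [Matrix.trace_add, Matrix.mul_assoc _ D, Matrix.trace_mul_comm, ← Matrix.mul_assoc]
    simp only [h1]
    have t1 : Tame fun y => (D * resolv A' T' x * C * dResolv A T x y).trace :=
      Tame.slice (f := fun x' y => (D * resolv A' T' x * C * dResolv A T x' y).trace)
        (hA.resolv_matDeriv.const_mul _).trace.tame' x
    have t2 : Tame fun y => (C * resolv A T x * D * dResolv A' T' x y).trace :=
      Tame.slice (f := fun x' y => (C * resolv A T x * D * dResolv A' T' x' y).trace)
        (hA'.resolv_matDeriv.const_mul _).trace.tame' x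
    have h2 := integral_mono_of_nonneg (μ := gaussianSample d)
      (Eventually.of_forall fun y => sq_nonneg ‖(D * resolv A' T' x * C * dResolv A T x y).trace +
        (C * resolv A T x * D * dResolv A' T' x y).trace‖)
      (((t1.norm_sq.integrable _).const_mul 2).add ((t2.norm_sq.integrable _).const_mul 2))
      (Eventually.of_forall fun y => norm_add_sq_le_two _ _)
    simp only [Pi.add_apply] at h2
    rw [integral_add ((t1.norm_sq.integrable _).const_mul 2)
      ((t2.norm_sq.integrable _).const_mul 2), integral_const_mul, integral_const_mul] at h2
    have h3 := hA.integral_norm_trace_mul_dResolv_sq_le x (D * resolv A' T' x * C)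
    have h4 := hA'.integral_norm_trace_mul_dResolv_sq_le x (C * resolv A T x * D)
    have hQ : ‖resolv A T x‖ ^ 2 ≤ B ^ 2 :=
      pow_le_pow_left₀ (norm_nonneg _) (hA.norm_resolv_le x) 2
    have hQ' : ‖resolv A' T' x‖ ^ 2 ≤ B ^ 2 :=
      pow_le_pow_left₀ (norm_nonneg _) (hA'.norm_resolv_le x) 2
    have hC := frSq_nonneg C
    have h5 : frSq (D * resolv A' T' x * C) ≤ B ^ 2 * (‖D‖ ^ 2 * frSq C) := by
      rw [Matrix.mul_assoc]
      refine (frSq_mul_le _ _).trans ?_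
      calc _ ≤ ‖D‖ ^ 2 * (B ^ 2 * frSq C) :=
            mul_le_mul_of_nonneg_left ((frSq_mul_le _ _).trans (by gcongr)) (sq_nonneg _)
        _ = _ := by ring
    have h6 : frSq (C * resolv A T x * D) ≤ B ^ 2 * (‖D‖ ^ 2 * frSq C) := by
      refine (frSq_mul_le' _ _).trans ?_
      calc _ ≤ (frSq C * B ^ 2) * ‖D‖ ^ 2 :=
            mul_le_mul_of_nonneg_right ((frSq_mul_le' _ _).trans (by gcongr)) (sq_nonneg _)
        _ = _ := by ring
    have h7 : 0 ≤ 4 * B ^ 3 * β ^ 2 := by positivity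
    nlinarith [mul_le_mul_of_nonneg_left h5 h7, mul_le_mul_of_nonneg_left h6 h7]

end Bounded

/-! ### Moments of the columns -/

/-- The family `P` with the members outside `s` replaced by zero. -/
def Family.restrict (s : Finset J) (P : Family m d) : Family m d :=
  fun j => if j ∈ s then P j else 0

theorem Family.restrict_norm_le {β : ℝ} (hβ : 0 ≤ β) (s : Finset J) {P : Family m d}
    (hP : ∀ j, ‖P j‖ ≤ β) (j : J) : ‖P.restrict s j‖ ≤ β := by
  unfold Family.restrict
  split_ifs
  · exact hP j
  · simpa using hβ

theorem cols_restrict (s : Finset J) (P : Family m d) (x : ∀ j, Fin (d j) → ℂ) (a : m) (j : J) :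
    cols (P.restrict s) x a j = if j ∈ s then cols P x a j else 0 := by
  simp only [cols, Matrix.of_apply, Family.restrict]
  split_ifs <;> simp

/-- A partial sum of diagonal entries becomes a full trace for the restricted families. One variance
bound, linear in the size of s, thus serves a single entry and the whole trace. -/
theorem trace_cols_restrict (s : Finset J) (P : Family m d) (R : Family n d) (U : Matrix m n ℂ)
    (x : ∀ j, Fin (d j) → ℂ) :
    ((cols (P.restrict s) x)ᴴ * U * cols (R.restrict s) x).trace =
      ∑ j ∈ s, ((cols P x)ᴴ * U * cols R x) j j := by
  rw [Matrix.trace, ← Finset.sum_subset (Finset.subset_univ s)]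
  · refine Finset.sum_congr rfl fun j hj => ?_
    simp [Matrix.mul_apply, cols_restrict, hj]
  · intro j _ hj
    simp [Matrix.mul_apply, cols_restrict, hj]

theorem integral_frSq_cols (P : Family m d) :
    ∫ x, frSq (cols P x) ∂(gaussianSample d) = ∑ j, frSq (P j) := by
  have h0 : ∀ a j, ∫ x, ‖cols P x a j‖ ^ 2 ∂(gaussianSample d) = ∑ c, ‖P j a c‖ ^ 2 := by
    intro a j
    have h := integral_star_cols_mul_cols_same P P j a a
    have h1 : ∀ x, star (cols P x a j) * cols P x a j = ((‖cols P x a j‖ ^ 2 : ℝ) : ℂ) := by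
      intro x
      rw [RCLike.star_def, mul_comm, Complex.mul_conj, Complex.normSq_eq_norm_sq]
    simp only [h1] at h
    rw [integral_complex_ofReal, Matrix.mul_apply] at h
    have h2 : ∑ c, P j a c * (P j)ᴴ c a = ((∑ c, ‖P j a c‖ ^ 2 : ℝ) : ℂ) := by
      push_cast
      refine Finset.sum_congr rfl fun c _ => ?_
      rw [Matrix.conjTranspose_apply, RCLike.star_def, Complex.mul_conj,
        Complex.normSq_eq_norm_sq]
      push_cast
      rfl
    rw [h2] at h
    exact Complex.ofReal_inj.1 h
  unfold frSq
  rw [integral_finsetSum _ fun a _ => (Tame.sum _ fun j _ =>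
    (cols_tame P a j).norm_sq).integrable _, Finset.sum_comm]
  refine Finset.sum_congr rfl fun a _ => ?_
  rw [integral_finsetSum _ fun j _ => (cols_tame P a j).norm_sq.integrable _]
  exact Finset.sum_congr rfl fun j _ => h0 a j

theorem integral_frSq_cols_restrict_le {B β : ℝ} (hm : Fintype.card m * β ^ 2 ≤ B)
    {P : Family m d} (hP : ∀ j, ‖P j‖ ≤ β) (s : Finset J) :
    ∫ x, frSq (cols (P.restrict s) x) ∂(gaussianSample d) ≤ B * s.card := by
  rw [integral_frSq_cols, ← Finset.sum_subset (Finset.subset_univ s)]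
  · have : ∀ j ∈ s, frSq (P.restrict s j) ≤ B := by
      intro j hj
      simp only [Family.restrict, hj, if_true]
      refine (frSq_le_card_mul _).trans (le_trans ?_ hm)
      have := hP j
      gcongr
    calc _ ≤ ∑ j ∈ s, B := Finset.sum_le_sum this
      _ = _ := by simp [mul_comm]
  · intro j _ hj
    simp [Family.restrict, hj, frSq]

/-- A fourth moment by one integration by parts: the integrand is ∑ i, (Yᴴ · Y Yᴴ Y)_{ii}. Of the
three factors being differentiated the conjugated one averages to zero; the other two give the two
summands. -/
theorem integral_frSq_gram (P : Family m d) :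
    ∫ x, frSq ((cols P x)ᴴ * cols P x) ∂(gaussianSample d) =
      ∫ x, ∑ i, (frSq (P i) * ∑ a, ‖cols P x a i‖ ^ 2 + frSq ((cols P x)ᴴ * P i))
        ∂(gaussianSample d) := by
  have hY := cols_matDeriv P
  have hV := hY.mul (hY.conjTranspose.mul hY)
  rw [← Complex.ofReal_inj, ← integral_complex_ofReal, ← integral_complex_ofReal]
  have h1 : ∀ x, (frSq ((cols P x)ᴴ * cols P x) : ℂ) =
      ∑ i, ((cols P x)ᴴ * (cols P x * ((cols P x)ᴴ * cols P x))) i i := by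
    intro x
    rw [← trace_mul_conjTranspose_eq_frSq, Matrix.conjTranspose_mul,
      Matrix.conjTranspose_conjTranspose, Matrix.mul_assoc]
    rfl
  simp only [h1]
  have ht : ∀ i, Tame fun x => ((cols P x)ᴴ * (cols P x * ((cols P x)ᴴ * cols P x))) i i :=
    fun i => (hY.conjTranspose.mul hV i i).tame
  have ht2 : ∀ i, Tame fun x => (((frSq (P i) * ∑ a, ‖cols P x a i‖ ^ 2 +
      frSq ((cols P x)ᴴ * P i) : ℝ)) : ℂ) := by
    intro i
    have h3 : Tame fun x => (frSq (P i) * ∑ a, ‖cols P x a i‖ ^ 2 +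
      frSq ((cols P x)ᴴ * P i) : ℝ) :=
      ((Tame.const _).mul (Tame.sum _ fun a _ => (cols_tame P a i).norm_sq)).add
        (tame_frSq fun a b => (hY.conjTranspose.mul_const (P i) a b).tame)
    exact h3.ofReal
  push_cast
  rw [integral_finsetSum _ fun i _ => (ht i).integrable _]
  rw [integral_finsetSum _ fun i _ => by simpa using (ht2 i).integrable (gaussianSample d)]
  refine Finset.sum_congr rfl fun i _ => ?_
  rw [integral_colsH_mul_eq P hV i]
  congr 1
  ext x
  have e1 : ∀ h, ((cols P h)ᴴ * (cols P h * ((cols P x)ᴴ * cols P x) +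
      cols P x * ((cols P h)ᴴ * cols P x + (cols P x)ᴴ * cols P h))) i i =
      ((cols P h)ᴴ * ((1 : Matrix m m ℂ) * cols P h * ((cols P x)ᴴ * cols P x))) i i +
      ((cols P h)ᴴ * (cols P x * (cols P h)ᴴ * cols P x)) i i +
      ((cols P h)ᴴ * ((cols P x * (cols P x)ᴴ) * cols P h * (1 : Matrix J J ℂ))) i i := by
    intro h
    simp only [Matrix.one_mul, Matrix.mul_one, Matrix.mul_add, Matrix.add_apply, Matrix.mul_assoc,
      add_assoc]
  simp only [e1]
  have i1 : ∀ (U : Matrix m m ℂ) (W : Matrix J J ℂ),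
      Integrable (fun h => ((cols P h)ᴴ * (U * cols P h * W)) i i) (gaussianSample d) :=
    fun U W => ((hY.conjTranspose.mul ((hY.const_mul U).mul_const W)) i i).tame.integrable _
  have i2 : Integrable (fun h => ((cols P h)ᴴ * (cols P x * (cols P h)ᴴ * cols P x)) i i)
      (gaussianSample d) :=
    ((hY.conjTranspose.mul ((hY.conjTranspose.const_mul _).mul_const _)) i i).tame.integrable _
  have i12 : Integrable (fun h => ((cols P h)ᴴ * ((1 : Matrix m m ℂ) * cols P h *
      ((cols P x)ᴴ * cols P x))) i i +
      ((cols P h)ᴴ * (cols P x * (cols P h)ᴴ * cols P x)) i i) (gaussianSample d) :=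
    (i1 _ _).add i2
  rw [integral_add i12 (i1 _ _), integral_add (i1 _ _) i2, integral_colsH_mul_cols,
    integral_colsH_mul_colsH, integral_colsH_mul_cols, Matrix.mul_one,
    trace_conjTranspose_mul_eq_frSq, add_zero, Matrix.one_apply_eq, mul_one]
  congr 1
  · congr 1
    rw [Matrix.mul_apply]
    refine Finset.sum_congr rfl fun a _ => ?_
    rw [Matrix.conjTranspose_apply, RCLike.star_def, mul_comm, Complex.mul_conj,
      Complex.normSq_eq_norm_sq]
    push_cast
    rfl
  · rw [← trace_conjTranspose_mul_eq_frSq, Matrix.conjTranspose_mul,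
      Matrix.conjTranspose_conjTranspose]
    simp only [Matrix.mul_assoc]

/-- In the exact formula the first summand costs the number of rows times β², the second the number
of columns times β². Each is at most B, and the remaining second moment is at most B times the size
of s. -/
theorem integral_frSq_gram_restrict_le {B β : ℝ} (hm : Fintype.card m * β ^ 2 ≤ B)
    (hJ : Fintype.card J * β ^ 2 ≤ B) (hB : 0 ≤ B) (hβ : 0 ≤ β)
    {P : Family m d} (hP : ∀ j, ‖P j‖ ≤ β) (s : Finset J) :
    ∫ x, frSq ((cols (P.restrict s) x)ᴴ * cols (P.restrict s) x) ∂(gaussianSample d) ≤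
      2 * B ^ 2 * s.card := by
  have hR := Family.restrict_norm_le hβ s hP
  rw [integral_frSq_gram]
  have hY := cols_matDeriv (P.restrict s)
  have hb : ∀ x, ∑ i, (frSq (P.restrict s i) * ∑ a, ‖cols (P.restrict s) x a i‖ ^ 2 +
      frSq ((cols (P.restrict s) x)ᴴ * P.restrict s i)) ≤
      2 * B * frSq (cols (P.restrict s) x) := by
    intro x
    have h1 : ∀ i, frSq (P.restrict s i) ≤ B := fun i =>
      (frSq_le_card_mul _).trans (le_trans (by have := hR i; gcongr) hm)
    have h2 : ∀ i, frSq ((cols (P.restrict s) x)ᴴ * P.restrict s i) ≤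
        frSq (cols (P.restrict s) x) * β ^ 2 := by
      intro i
      refine (frSq_mul_le' _ _).trans ?_
      rw [frSq_conjTranspose]
      have := hR i
      have := frSq_nonneg (cols (P.restrict s) x)
      gcongr
    have h3 : ∑ i, ∑ a, ‖cols (P.restrict s) x a i‖ ^ 2 = frSq (cols (P.restrict s) x) :=
      Finset.sum_comm
    calc _ ≤ ∑ i, (B * ∑ a, ‖cols (P.restrict s) x a i‖ ^ 2 +
          frSq (cols (P.restrict s) x) * β ^ 2) := by
          refine Finset.sum_le_sum fun i _ => add_le_add ?_ (h2 i)
          exact mul_le_mul_of_nonneg_right (h1 i) (Finset.sum_nonneg fun _ _ => sq_nonneg _)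
      _ = B * frSq (cols (P.restrict s) x) +
          (Fintype.card J * β ^ 2) * frSq (cols (P.restrict s) x) := by
          rw [Finset.sum_add_distrib, ← Finset.mul_sum, h3]
          simp
          ring
      _ ≤ _ := by nlinarith [frSq_nonneg (cols (P.restrict s) x)]
  have ht : Tame fun x => frSq (cols (P.restrict s) x) :=
    tame_frSq fun a j => cols_tame _ a j
  have h4 := integral_mono_of_nonneg (μ := gaussianSample d)
    (Eventually.of_forall fun x => Finset.sum_nonneg fun i _ => add_nonneg
      (mul_nonneg (frSq_nonneg (P.restrict s i))
        (Finset.sum_nonneg fun a _ => sq_nonneg ‖cols (P.restrict s) x a i‖))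
      (frSq_nonneg ((cols (P.restrict s) x)ᴴ * P.restrict s i)))
    ((ht.integrable _).const_mul (2 * B)) (Eventually.of_forall hb)
  rw [integral_const_mul] at h4
  have h5 := integral_frSq_cols_restrict_le hm hP s
  nlinarith [mul_le_mul_of_nonneg_left h5 hB]

end Variance

/-! ### Variance of quadratic forms in the columns -/

section Forms

variable {J : Type*} [Fintype J] [DecidableEq J] {d : J → ℕ}
variable {m n : Type*} [Fintype m] [DecidableEq m] [Fintype n] [DecidableEq n]

namespace Bounded

variable {B β : ℝ} {A : Family m d} {T : Matrix m m ℂ} (hA : Bounded B β A T)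
  {A' : Family n d} {T' : Matrix n n ℂ} (hA' : Bounded B β A' T')

include hA in
theorem gVar_form_le_integral {P R : Family m d} (hP : ∀ j, ‖P j‖ ≤ β) (hR : ∀ j, ‖R j‖ ≤ β) :
    gVar (fun x => ((cols P x)ᴴ * resolv A T x * cols R x).trace) ≤
      12 * B ^ 2 * β ^ 2 * (∫ x, frSq (cols P x) ∂(gaussianSample d) +
        ∫ x, frSq (cols R x) ∂(gaussianSample d)) +
      48 * B ^ 3 * β ^ 2 * ∫ x, frSq (cols R x * (cols P x)ᴴ) ∂(gaussianSample d) := by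
  have hB := hA.B_pos
  have dP := cols_matDeriv P
  have dR := cols_matDeriv R
  have dQ := hA.resolv_matDeriv
  have tP : Tame fun x => frSq (cols P x) := tame_frSq fun a j => cols_tame _ a j
  have tR : Tame fun x => frSq (cols R x) := tame_frSq fun a j => cols_tame _ a j
  have tRP : Tame fun x => frSq (cols R x * (cols P x)ᴴ) :=
    tame_frSq fun a b => (dR.mul dP.conjTranspose a b).tame
  have hd := ((dP.conjTranspose.mul dQ).mul dR).trace
  have tb : Tame fun x => 4 * B ^ 2 * β ^ 2 * (frSq (cols P x) + frSq (cols R x)) +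
      16 * B ^ 3 * β ^ 2 * frSq (cols R x * (cols P x)ᴴ) :=
    ((Tame.const _).mul (tP.add tR)).add ((Tame.const _).mul tRP)
  have h := gVar_le_of_deriv hd tb (fun x => ?_)
  · have i1 : Integrable (fun x => 4 * B ^ 2 * β ^ 2 * (frSq (cols P x) + frSq (cols R x)))
        (gaussianSample d) := ((tP.add tR).integrable _).const_mul _
    rw [integral_add i1 ((tRP.integrable _).const_mul _), integral_const_mul, integral_const_mul,
      integral_add (tP.integrable _) (tR.integrable _)] at h
    refine h.trans (le_of_eq ?_)
    ring
  -- The three terms of the product rule, each rotated so that the increment stands last. The zero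
  -- is padding for the four-term inequality.
  · have key : ∀ y, (((cols P y)ᴴ * resolv A T x + (cols P x)ᴴ * dResolv A T x y) * cols R x +
        (cols P x)ᴴ * resolv A T x * cols R y).trace =
        (resolv A T x * cols R x * (cols P y)ᴴ).trace +
        (cols R x * (cols P x)ᴴ * dResolv A T x y).trace +
        ((cols P x)ᴴ * resolv A T x * cols R y).trace + 0 := by
      intro y
      rw [Matrix.trace_add, Matrix.add_mul, Matrix.trace_add, add_zero]
      congr 2
      · rw [Matrix.mul_assoc, Matrix.trace_mul_comm]
      · rw [Matrix.trace_mul_comm, Matrix.mul_assoc]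
    have t1 : Tame fun y => (resolv A T x * cols R x * (cols P y)ᴴ).trace :=
      (dP.conjTranspose.const_mul _).trace.tame
    have t2 : Tame fun y => (cols R x * (cols P x)ᴴ * dResolv A T x y).trace :=
      Tame.slice (f := fun x' y => (cols R x * (cols P x)ᴴ * dResolv A T x' y).trace)
        (dQ.const_mul _).trace.tame' x
    have t3 : Tame fun y => ((cols P x)ᴴ * resolv A T x * cols R y).trace :=
      (dR.const_mul _).trace.tame
    have h4 := integral_four_le key (t1.norm_sq.integrable (gaussianSample d))
      (t2.norm_sq.integrable _) (t3.norm_sq.integrable _) (by simp)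
    have b1 := integral_norm_trace_mul_colsH_sq_le P hP (resolv A T x * cols R x)
    have b2 := hA.integral_norm_trace_mul_dResolv_sq_le x (cols R x * (cols P x)ᴴ)
    have b3 := integral_norm_trace_mul_cols_sq_le R hR ((cols P x)ᴴ * resolv A T x)
    have hQ : ‖resolv A T x‖ ^ 2 ≤ B ^ 2 :=
      pow_le_pow_left₀ (norm_nonneg _) (hA.norm_resolv_le x) 2
    have f1 : frSq (resolv A T x * cols R x) ≤ B ^ 2 * frSq (cols R x) :=
      (frSq_mul_le _ _).trans (mul_le_mul_of_nonneg_right hQ (frSq_nonneg _))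
    have f3 : frSq ((cols P x)ᴴ * resolv A T x) ≤ B ^ 2 * frSq (cols P x) := by
      refine (frSq_mul_le' _ _).trans ?_
      rw [frSq_conjTranspose, mul_comm]
      exact mul_le_mul_of_nonneg_right hQ (frSq_nonneg _)
    simp only [norm_zero, ne_eq, OfNat.ofNat_ne_zero, not_false_eq_true, zero_pow,
      integral_zero, mul_zero, add_zero] at h4
    refine h4.trans ?_
    nlinarith [mul_le_mul_of_nonneg_left f1 (sq_nonneg β),
      mul_le_mul_of_nonneg_left f3 (sq_nonneg β)]

include hA hA' in
theorem gVar_form2_le_integral {P : Family n d} {R : Family m d} (hP : ∀ j, ‖P j‖ ≤ β)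
    (hR : ∀ j, ‖R j‖ ≤ β) {C : Matrix n m ℂ} (hC : ‖C‖ ≤ B) :
    gVar (fun x => ((cols P x)ᴴ * (resolv A' T' x * C * resolv A T x) * cols R x).trace) ≤
      12 * B ^ 6 * β ^ 2 * (∫ x, frSq (cols P x) ∂(gaussianSample d) +
        ∫ x, frSq (cols R x) ∂(gaussianSample d)) +
      96 * B ^ 7 * β ^ 2 * ∫ x, frSq (cols R x * (cols P x)ᴴ) ∂(gaussianSample d) := by
  have hB := hA.B_pos
  have dP := cols_matDeriv P
  have dR := cols_matDeriv R
  have dQ := hA.resolv_matDeriv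
  have dQ' := hA'.resolv_matDeriv
  have tP : Tame fun x => frSq (cols P x) := tame_frSq fun a j => cols_tame _ a j
  have tR : Tame fun x => frSq (cols R x) := tame_frSq fun a j => cols_tame _ a j
  have tRP : Tame fun x => frSq (cols R x * (cols P x)ᴴ) :=
    tame_frSq fun a b => (dR.mul dP.conjTranspose a b).tame
  have hd := ((dP.conjTranspose.mul ((dQ'.mul_const C).mul dQ)).mul dR).trace
  have tb : Tame fun x => 4 * B ^ 6 * β ^ 2 * (frSq (cols P x) + frSq (cols R x)) +
      32 * B ^ 7 * β ^ 2 * frSq (cols R x * (cols P x)ᴴ) :=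
    ((Tame.const _).mul (tP.add tR)).add ((Tame.const _).mul tRP)
  have h := gVar_le_of_deriv hd tb (fun x => ?_)
  · have i1 : Integrable (fun x => 4 * B ^ 6 * β ^ 2 * (frSq (cols P x) + frSq (cols R x)))
        (gaussianSample d) := ((tP.add tR).integrable _).const_mul _
    rw [integral_add i1 ((tRP.integrable _).const_mul _), integral_const_mul, integral_const_mul,
      integral_add (tP.integrable _) (tR.integrable _)] at h
    refine h.trans (le_of_eq ?_)
    ring
  · have key : ∀ y, (((cols P y)ᴴ * (resolv A' T' x * C * resolv A T x) +
        (cols P x)ᴴ * (dResolv A' T' x y * C * resolv A T x +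
          resolv A' T' x * C * dResolv A T x y)) * cols R x +
        (cols P x)ᴴ * (resolv A' T' x * C * resolv A T x) * cols R y).trace =
        (resolv A' T' x * C * resolv A T x * cols R x * (cols P y)ᴴ).trace +
        (C * resolv A T x * (cols R x * (cols P x)ᴴ) * dResolv A' T' x y).trace +
        (cols R x * (cols P x)ᴴ * (resolv A' T' x * C) * dResolv A T x y).trace +
        ((cols P x)ᴴ * (resolv A' T' x * C * resolv A T x) * cols R y).trace := by
      intro y
      rw [Matrix.trace_add, Matrix.add_mul, Matrix.mul_add, Matrix.add_mul, Matrix.trace_add,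
        Matrix.trace_add, ← add_assoc]
      congr 3
      · rw [Matrix.mul_assoc, Matrix.trace_mul_comm]
      · rw [Matrix.trace_mul_comm (C * resolv A T x * (cols R x * (cols P x)ᴴ))]
        have e : dResolv A' T' x y * (C * resolv A T x * (cols R x * (cols P x)ᴴ)) =
            (dResolv A' T' x y * C * resolv A T x * cols R x) * (cols P x)ᴴ := by
          simp only [Matrix.mul_assoc]
        rw [e, Matrix.trace_mul_comm _ (cols P x)ᴴ]
        simp only [Matrix.mul_assoc]
      · rw [Matrix.trace_mul_comm]
        simp only [Matrix.mul_assoc]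
    have t1 : Tame fun y => (resolv A' T' x * C * resolv A T x * cols R x * (cols P y)ᴴ).trace :=
      (dP.conjTranspose.const_mul _).trace.tame
    have t2 : Tame fun y =>
        (C * resolv A T x * (cols R x * (cols P x)ᴴ) * dResolv A' T' x y).trace :=
      Tame.slice (f := fun x' y =>
        (C * resolv A T x * (cols R x * (cols P x)ᴴ) * dResolv A' T' x' y).trace)
        (dQ'.const_mul _).trace.tame' x
    have t3 : Tame fun y =>
        (cols R x * (cols P x)ᴴ * (resolv A' T' x * C) * dResolv A T x y).trace :=
      Tame.slice (f := fun x' y =>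
        (cols R x * (cols P x)ᴴ * (resolv A' T' x * C) * dResolv A T x' y).trace)
        (dQ.const_mul _).trace.tame' x
    have t4 : Tame fun y =>
        ((cols P x)ᴴ * (resolv A' T' x * C * resolv A T x) * cols R y).trace :=
      (dR.const_mul _).trace.tame
    have h4 := integral_four_le key (t1.norm_sq.integrable (gaussianSample d))
      (t2.norm_sq.integrable _) (t3.norm_sq.integrable _) (t4.norm_sq.integrable _)
    have b1 := integral_norm_trace_mul_colsH_sq_le P hP
      (resolv A' T' x * C * resolv A T x * cols R x)
    have b2 := hA'.integral_norm_trace_mul_dResolv_sq_le x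
      (C * resolv A T x * (cols R x * (cols P x)ᴴ))
    have b3 := hA.integral_norm_trace_mul_dResolv_sq_le x
      (cols R x * (cols P x)ᴴ * (resolv A' T' x * C))
    have b4 := integral_norm_trace_mul_cols_sq_le R hR
      ((cols P x)ᴴ * (resolv A' T' x * C * resolv A T x))
    have hQ := hA.norm_resolv_le x
    have hQ' := hA'.norm_resolv_le x
    have n1 : ‖resolv A' T' x * C‖ ≤ B * B :=
      (Matrix.l2_opNorm_mul _ _).trans (mul_le_mul hQ' hC (norm_nonneg _) hB.le)
    have n2 : ‖C * resolv A T x‖ ≤ B * B :=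
      (Matrix.l2_opNorm_mul _ _).trans (mul_le_mul hC hQ (norm_nonneg _) hB.le)
    have n3 : ‖resolv A' T' x * C * resolv A T x‖ ≤ B * B * B :=
      (Matrix.l2_opNorm_mul _ _).trans (mul_le_mul n1 hQ (norm_nonneg _) (by positivity))
    have s1 := pow_le_pow_left₀ (norm_nonneg _) n1 2
    have s2 := pow_le_pow_left₀ (norm_nonneg _) n2 2
    have s3 := pow_le_pow_left₀ (norm_nonneg _) n3 2
    have f1 : frSq (resolv A' T' x * C * resolv A T x * cols R x) ≤ B ^ 6 * frSq (cols R x) :=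
      (frSq_mul_le _ _).trans (mul_le_mul_of_nonneg_right (s3.trans_eq (by ring)) (frSq_nonneg _))
    have f2 : frSq (C * resolv A T x * (cols R x * (cols P x)ᴴ)) ≤
        B ^ 4 * frSq (cols R x * (cols P x)ᴴ) :=
      (frSq_mul_le _ _).trans (mul_le_mul_of_nonneg_right (s2.trans_eq (by ring)) (frSq_nonneg _))
    have f3 : frSq (cols R x * (cols P x)ᴴ * (resolv A' T' x * C)) ≤
        B ^ 4 * frSq (cols R x * (cols P x)ᴴ) := by
      refine (frSq_mul_le' _ _).trans ?_
      rw [mul_comm]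
      exact mul_le_mul_of_nonneg_right (s1.trans_eq (by ring)) (frSq_nonneg _)
    have f4 : frSq ((cols P x)ᴴ * (resolv A' T' x * C * resolv A T x)) ≤
        B ^ 6 * frSq (cols P x) := by
      refine (frSq_mul_le' _ _).trans ?_
      rw [frSq_conjTranspose, mul_comm]
      exact mul_le_mul_of_nonneg_right (s3.trans_eq (by ring)) (frSq_nonneg _)
    have h7 : 0 ≤ B ^ 3 * β ^ 2 := by positivity
    refine h4.trans ?_
    nlinarith [mul_le_mul_of_nonneg_left f1 (sq_nonneg β),
      mul_le_mul_of_nonneg_left f4 (sq_nonneg β),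
      mul_le_mul_of_nonneg_left f2 h7, mul_le_mul_of_nonneg_left f3 h7]

theorem integral_frSq_cols_mul_colsH_le {B β : ℝ} {P : Family n d} {R : Family m d}
    (hm : Fintype.card m * β ^ 2 ≤ B) (hn : Fintype.card n * β ^ 2 ≤ B)
    (hJ : Fintype.card J * β ^ 2 ≤ B) (hB : 0 ≤ B) (hβ : 0 ≤ β)
    (hP : ∀ j, ‖P j‖ ≤ β) (hR : ∀ j, ‖R j‖ ≤ β) (s : Finset J) :
    ∫ x, frSq (cols (R.restrict s) x * (cols (P.restrict s) x)ᴴ) ∂(gaussianSample d) ≤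
      2 * B ^ 2 * s.card := by
  have dP := cols_matDeriv (P.restrict s)
  have dR := cols_matDeriv (R.restrict s)
  have t1 : Tame fun x => frSq ((cols (R.restrict s) x)ᴴ * cols (R.restrict s) x) :=
    tame_frSq fun a b => (dR.conjTranspose.mul dR a b).tame
  have t2 : Tame fun x => frSq ((cols (P.restrict s) x)ᴴ * cols (P.restrict s) x) :=
    tame_frSq fun a b => (dP.conjTranspose.mul dP a b).tame
  have h := integral_mono_of_nonneg (μ := gaussianSample d)
    (Eventually.of_forall fun x =>
      frSq_nonneg (cols (R.restrict s) x * (cols (P.restrict s) x)ᴴ))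
    (((t1.integrable _).add (t2.integrable _)).div_const 2)
    (Eventually.of_forall fun x =>
      frSq_mul_conjTranspose_le (cols (R.restrict s) x) (cols (P.restrict s) x))
  simp only [Pi.add_apply] at h
  rw [integral_div, integral_add (t1.integrable _) (t2.integrable _)] at h
  have h1 := integral_frSq_gram_restrict_le hm hJ hB hβ hR s
  have h2 := integral_frSq_gram_restrict_le hn hJ hB hβ hP s
  linarith

include hA in
-- The mean over x of the gradient bound is linear in the size of s. The constant is rounded up to
-- the one needed with two resolvents, so that both variance bounds have the same form.
theorem gVar_form_le {P R : Family m d} (hP : ∀ j, ‖P j‖ ≤ β) (hR : ∀ j, ‖R j‖ ≤ β)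
    (s : Finset J) :
    gVar (fun x => ∑ j ∈ s, ((cols P x)ᴴ * resolv A T x * cols R x) j j) ≤
      216 * B ^ 9 * β ^ 2 * s.card := by
  have hB := hA.B_pos
  have h := hA.gVar_form_le_integral (Family.restrict_norm_le hA.pos.le s hP)
    (Family.restrict_norm_le hA.pos.le s hR)
  simp only [trace_cols_restrict] at h
  have h1 := integral_frSq_cols_restrict_le hA.card_row hP s
  have h2 := integral_frSq_cols_restrict_le hA.card_row hR s
  have h3 := integral_frSq_cols_mul_colsH_le hA.card_row hA.card_row hA.card_col hB.le hA.pos.le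
    hP hR s
  have p3 : B ^ 3 ≤ B ^ 9 := pow_le_pow_right₀ hA.one_le (by norm_num)
  have p5 : B ^ 5 ≤ B ^ 9 := pow_le_pow_right₀ hA.one_le (by norm_num)
  have c1 : 0 ≤ 12 * B ^ 2 * β ^ 2 := by positivity
  have c2 : 0 ≤ 48 * B ^ 3 * β ^ 2 := by positivity
  have c3 : 0 ≤ β ^ 2 * (s.card : ℝ) := by positivity
  calc _ ≤ 12 * B ^ 2 * β ^ 2 * (B * s.card + B * s.card) +
        48 * B ^ 3 * β ^ 2 * (2 * B ^ 2 * s.card) :=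
        h.trans (add_le_add (mul_le_mul_of_nonneg_left (add_le_add h1 h2) c1)
          (mul_le_mul_of_nonneg_left h3 c2))
    _ = 24 * (B ^ 3 * (β ^ 2 * s.card)) + 96 * (B ^ 5 * (β ^ 2 * s.card)) := by ring
    _ ≤ 24 * (B ^ 9 * (β ^ 2 * s.card)) + 96 * (B ^ 9 * (β ^ 2 * s.card)) := by gcongr
    _ ≤ _ := by nlinarith [mul_nonneg (by positivity : 0 ≤ B ^ 9) c3]

include hA hA' in
theorem gVar_form2_le {P : Family n d} {R : Family m d} (hP : ∀ j, ‖P j‖ ≤ β)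
    (hR : ∀ j, ‖R j‖ ≤ β) {C : Matrix n m ℂ} (hC : ‖C‖ ≤ B) (s : Finset J) :
    gVar (fun x => ∑ j ∈ s,
      ((cols P x)ᴴ * (resolv A' T' x * C * resolv A T x) * cols R x) j j) ≤
      216 * B ^ 9 * β ^ 2 * s.card := by
  have hB := hA.B_pos
  have h := hA.gVar_form2_le_integral hA' (Family.restrict_norm_le hA.pos.le s hP)
    (Family.restrict_norm_le hA.pos.le s hR) hC
  simp only [trace_cols_restrict] at h
  have h1 := integral_frSq_cols_restrict_le hA'.card_row hP s
  have h2 := integral_frSq_cols_restrict_le hA.card_row hR s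
  have h3 := integral_frSq_cols_mul_colsH_le hA.card_row hA'.card_row hA.card_col hB.le hA.pos.le
    hP hR s
  have p7 : B ^ 7 ≤ B ^ 9 := pow_le_pow_right₀ hA.one_le (by norm_num)
  have c1 : 0 ≤ 12 * B ^ 6 * β ^ 2 := by positivity
  have c2 : 0 ≤ 96 * B ^ 7 * β ^ 2 := by positivity
  calc _ ≤ 12 * B ^ 6 * β ^ 2 * (B * s.card + B * s.card) +
        96 * B ^ 7 * β ^ 2 * (2 * B ^ 2 * s.card) :=
        h.trans (add_le_add (mul_le_mul_of_nonneg_left (add_le_add h1 h2) c1)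
          (mul_le_mul_of_nonneg_left h3 c2))
    _ = 24 * (B ^ 7 * (β ^ 2 * s.card)) + 192 * (B ^ 9 * (β ^ 2 * s.card)) := by ring
    _ ≤ 24 * (B ^ 9 * (β ^ 2 * s.card)) + 192 * (B ^ 9 * (β ^ 2 * s.card)) := by gcongr
    _ = _ := by ring

/-! ### Integration by parts for the quadratic forms -/

include hA in
theorem tame_form (P R : Family m d) (i : J) :
    Tame fun x => ((cols P x)ᴴ * resolv A T x * cols R x) i i :=
  (((cols_matDeriv P).conjTranspose.mul hA.resolv_matDeriv).mul (cols_matDeriv R) i i).tame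

include hA hA' in
theorem tame_form2 (P : Family n d) (R : Family m d) (C : Matrix n m ℂ) (i : J) :
    Tame fun x => ((cols P x)ᴴ * (resolv A' T' x * C * resolv A T x) * cols R x) i i :=
  (((cols_matDeriv P).conjTranspose.mul ((hA'.resolv_matDeriv.mul_const C).mul
    hA.resolv_matDeriv)).mul (cols_matDeriv R) i i).tame

/-- Only the term of the derivative with an unconjugated increment pairs with the conjugated column
in front; the other one has mean zero. -/
theorem integral_colsH_mul_dResolv_mul (A : Family m d) (T : Matrix m m ℂ)
    (x : ∀ j, Fin (d j) → ℂ) (P : Family n d)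
    (U : Matrix n m ℂ) (W : Matrix m J ℂ) (i : J) :
    ∫ h, ((cols P h)ᴴ * (U * dResolv A T x h * W)) i i ∂(gaussianSample d) =
      -(((P i)ᴴ * (U * resolv A T x) * A i).trace * ((cols A x)ᴴ * resolv A T x * W) i i) := by
  have e : ∀ h, ((cols P h)ᴴ * (U * dResolv A T x h * W)) i i =
      -(((cols P h)ᴴ * ((U * resolv A T x) * cols A h * ((cols A x)ᴴ * resolv A T x * W))) i i +
      ((cols P h)ᴴ * ((U * resolv A T x * cols A x) * (cols A h)ᴴ * (resolv A T x * W))) i i) := by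
    intro h
    simp only [dResolv, Matrix.mul_neg, Matrix.neg_mul, Matrix.mul_add, Matrix.add_mul,
      Matrix.neg_apply, Matrix.add_apply, Matrix.mul_assoc]
  have dA := cols_matDeriv A
  have dP := cols_matDeriv P
  have i1 : Integrable (fun h => ((cols P h)ᴴ * ((U * resolv A T x) * cols A h *
      ((cols A x)ᴴ * resolv A T x * W))) i i) (gaussianSample d) :=
    ((dP.conjTranspose.mul ((dA.const_mul _).mul_const _)) i i).tame.integrable _
  have i2 : Integrable (fun h => ((cols P h)ᴴ * ((U * resolv A T x * cols A x) * (cols A h)ᴴ *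
      (resolv A T x * W))) i i) (gaussianSample d) :=
    ((dP.conjTranspose.mul ((dA.conjTranspose.const_mul _).mul_const _)) i i).tame.integrable _
  simp only [e]
  rw [integral_neg, integral_add i1 i2, integral_colsH_mul_cols, integral_colsH_mul_colsH,
    add_zero]

include hA in
theorem integrable_colsH_mul_dResolv_mul (x : ∀ j, Fin (d j) → ℂ) (P : Family n d)
    (U : Matrix n m ℂ) (W : Matrix m J ℂ) (i : J) :
    Integrable (fun h => ((cols P h)ᴴ * (U * dResolv A T x h * W)) i i) (gaussianSample d) := by
  have t : ∀ a b, Tame fun h => (U * dResolv A T x h * W) a b := fun a b =>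
    Tame.slice (f := fun x' h => (U * dResolv A T x' h * W) a b)
      (((hA.resolv_matDeriv.const_mul U).mul_const W) a b).tame' x
  exact (MatDeriv.tame_mul_apply (fun a b => ((cols_matDeriv P).conjTranspose a b).tame) t
    i i).integrable _

include hA in
-- Integration by parts in the column P_i x_i: differentiating the last factor gives the trace,
-- differentiating the resolvent gives the product. The form in the product has A on the left, so
-- the formula closes on itself when P = A.
theorem gMean_form (P R : Family m d) (i : J) :
    gMean (fun x => ((cols P x)ᴴ * resolv A T x * cols R x) i i) =
      gMean (fun x => ((P i)ᴴ * resolv A T x * R i).trace) -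
      gMean (fun x => ((P i)ᴴ * resolv A T x * A i).trace *
        ((cols A x)ᴴ * resolv A T x * cols R x) i i) := by
  have dQ := hA.resolv_matDeriv
  have tt : ∀ R : Family m d, Tame fun x => ((P i)ᴴ * resolv A T x * R i).trace := fun R =>
    ((dQ.const_mul _).mul_const _).trace.tame
  have h := integral_colsH_mul_eq P (dQ.mul (cols_matDeriv R)) i
  simp only [← Matrix.mul_assoc] at h
  have hx : ∀ x, ∫ h, ((cols P h)ᴴ * (dResolv A T x h * cols R x + resolv A T x * cols R h)) i i
      ∂(gaussianSample d) = ((P i)ᴴ * resolv A T x * R i).trace -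
        ((P i)ᴴ * resolv A T x * A i).trace * ((cols A x)ᴴ * resolv A T x * cols R x) i i := by
    intro x
    have e : ∀ h, ((cols P h)ᴴ * (dResolv A T x h * cols R x + resolv A T x * cols R h)) i i =
        ((cols P h)ᴴ * ((1 : Matrix m m ℂ) * dResolv A T x h * cols R x)) i i +
        ((cols P h)ᴴ * (resolv A T x * cols R h * (1 : Matrix J J ℂ))) i i := by
      intro h
      simp only [Matrix.one_mul, Matrix.mul_one, Matrix.mul_add, Matrix.add_apply]
    simp only [e]
    rw [integral_add (hA.integrable_colsH_mul_dResolv_mul x P _ _ i)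
      (((cols_matDeriv P).conjTranspose.mul
        (((cols_matDeriv R).const_mul _).mul_const _) i i).tame.integrable _),
      integral_colsH_mul_dResolv_mul, integral_colsH_mul_cols, Matrix.one_mul,
      Matrix.one_apply_eq, mul_one]
    ring
  simp only [hx] at h
  rw [← gMean_sub (tt R) ((tt A).mul (hA.tame_form A R i))]
  exact h

include hA hA' in
-- There are three factors to differentiate. The derivative of Q' reproduces a form with two
-- resolvents, whereas that of Q cuts the product into a two-resolvent trace and a one-resolvent
-- form, which is already understood.
theorem gMean_form2 (P : Family n d) (R : Family m d) (C : Matrix n m ℂ) (i : J) :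
    gMean (fun x => ((cols P x)ᴴ * (resolv A' T' x * C * resolv A T x) * cols R x) i i) =
      gMean (fun x => ((P i)ᴴ * (resolv A' T' x * C * resolv A T x) * R i).trace) -
      gMean (fun x => ((P i)ᴴ * resolv A' T' x * A' i).trace *
        ((cols A' x)ᴴ * (resolv A' T' x * C * resolv A T x) * cols R x) i i) -
      gMean (fun x => ((P i)ᴴ * (resolv A' T' x * C * resolv A T x) * A i).trace *
        ((cols A x)ᴴ * resolv A T x * cols R x) i i) := by
  have dQ := hA.resolv_matDeriv
  have dQ' := hA'.resolv_matDeriv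
  have dU := (dQ'.mul_const C).mul dQ
  have tt : ∀ R : Family m d, Tame fun x =>
      ((P i)ᴴ * (resolv A' T' x * C * resolv A T x) * R i).trace := fun R =>
    ((dU.const_mul _).mul_const _).trace.tame
  have tt' : Tame fun x => ((P i)ᴴ * resolv A' T' x * A' i).trace :=
    ((dQ'.const_mul _).mul_const _).trace.tame
  have h := integral_colsH_mul_eq P (dU.mul (cols_matDeriv R)) i
  have hx : ∀ x, ∫ h, ((cols P h)ᴴ * ((dResolv A' T' x h * C * resolv A T x +
      resolv A' T' x * C * dResolv A T x h) * cols R x +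
      resolv A' T' x * C * resolv A T x * cols R h)) i i
      ∂(gaussianSample d) = ((P i)ᴴ * (resolv A' T' x * C * resolv A T x) * R i).trace -
        ((P i)ᴴ * resolv A' T' x * A' i).trace *
          ((cols A' x)ᴴ * (resolv A' T' x * C * resolv A T x) * cols R x) i i -
        ((P i)ᴴ * (resolv A' T' x * C * resolv A T x) * A i).trace *
          ((cols A x)ᴴ * resolv A T x * cols R x) i i := by
    intro x
    have e : ∀ h, ((cols P h)ᴴ * ((dResolv A' T' x h * C * resolv A T x +
      resolv A' T' x * C * dResolv A T x h) * cols R x +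
      resolv A' T' x * C * resolv A T x * cols R h)) i i =
        ((cols P h)ᴴ * ((1 : Matrix n n ℂ) * dResolv A' T' x h *
          (C * resolv A T x * cols R x))) i i +
        ((cols P h)ᴴ * ((resolv A' T' x * C) * dResolv A T x h * cols R x)) i i +
        ((cols P h)ᴴ * ((resolv A' T' x * C * resolv A T x) * cols R h *
          (1 : Matrix J J ℂ))) i i := by
      intro h
      simp only [Matrix.one_mul, Matrix.mul_one, Matrix.mul_add, Matrix.add_mul, Matrix.add_apply,
        Matrix.mul_assoc]
    simp only [e]
    have i1 := hA'.integrable_colsH_mul_dResolv_mul x P (1 : Matrix n n ℂ)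
      (C * resolv A T x * cols R x) i
    have i2 := hA.integrable_colsH_mul_dResolv_mul x P (resolv A' T' x * C) (cols R x) i
    have i12 := i1.add i2
    simp only [Pi.add_def] at i12
    rw [integral_add i12 (((cols_matDeriv P).conjTranspose.mul
        (((cols_matDeriv R).const_mul _).mul_const _) i i).tame.integrable _),
      integral_add i1 i2,
      integral_colsH_mul_dResolv_mul, integral_colsH_mul_dResolv_mul, integral_colsH_mul_cols,
      Matrix.one_mul, Matrix.one_apply_eq, mul_one]
    simp only [Matrix.mul_assoc]
    ring
  simp only [hx] at h
  rw [← gMean_sub (tt R) (tt'.mul (hA.tame_form2 hA' A' R C i)),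
    ← gMean_sub ((tt R).sub (tt'.mul (hA.tame_form2 hA' A' R C i)))
      ((tt A).mul (hA.tame_form A R i))]
  simp only [← Matrix.mul_assoc] at h ⊢
  exact h

end Bounded

end Forms

/-! ### The deterministic equivalent and its fixed-point system -/

section Weighted

variable {J : Type*} [Fintype J] [DecidableEq J]

/-- A system with weighted row sums at most `ρ < 1` is stable. -/
theorem norm_le_of_weighted_contraction {a : J → J → ℝ} {w : J → ℝ} {e : J → ℂ} {ρ ε : ℝ}
    (ha : ∀ i j, 0 ≤ a i j) (hw : ∀ i, 1 ≤ w i) (hρ : ρ < 1)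
    (hrow : ∀ i, ∑ j, a i j * w j ≤ ρ * w i) (he : ∀ i, ‖e i‖ ≤ ∑ j, a i j * ‖e j‖ + ε) (i : J) :
    ‖e i‖ ≤ w i * (ε / (1 - ρ)) := by
  have : Nonempty J := ⟨i⟩
  -- The inequality is read at an index where ‖e j‖ / w j is largest; w k ≥ 1 then permits dropping
  -- the weight against ε.
  obtain ⟨k, hk⟩ := Finite.exists_max fun j => ‖e j‖ / w j
  have hw0 : ∀ j, 0 < w j := fun j => zero_lt_one.trans_le (hw j)
  set s := ‖e k‖ / w k with hs
  have hs0 : 0 ≤ s := div_nonneg (norm_nonneg _) (hw0 k).le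
  have hle : ∀ j, ‖e j‖ ≤ s * w j := fun j => (div_le_iff₀ (hw0 j)).1 (hk j)
  have h1 : s * w k ≤ s * (ρ * w k) + ε := by
    have h2 : s * w k = ‖e k‖ := div_mul_cancel₀ _ (hw0 k).ne'
    rw [h2]
    refine (he k).trans (add_le_add ?_ le_rfl)
    calc ∑ j, a k j * ‖e j‖ ≤ ∑ j, s * (a k j * w j) :=
          Finset.sum_le_sum fun j _ => by
            have := mul_le_mul_of_nonneg_left (hle j) (ha k j)
            linarith
      _ = s * ∑ j, a k j * w j := by rw [Finset.mul_sum]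
      _ ≤ _ := mul_le_mul_of_nonneg_left (hrow k) hs0
  have h3 : s ≤ ε / (1 - ρ) := by
    rw [le_div_iff₀ (by linarith)]
    have h4 : s * (1 - ρ) * w k ≤ ε := by nlinarith
    have h5 : 0 ≤ s * (1 - ρ) := mul_nonneg hs0 (by linarith)
    nlinarith [hw k]
  calc ‖e i‖ ≤ s * w i := hle i
    _ ≤ _ := by rw [mul_comm]; exact mul_le_mul_of_nonneg_left h3 (hw0 i).le

/-- A kernel vector satisfies the stability inequality with ε = 0 and therefore vanishes. -/
theorem isUnit_one_sub_of_weighted {M : Matrix J J ℂ} {w : J → ℝ} {ρ : ℝ} (hw : ∀ i, 1 ≤ w i)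
    (hρ : ρ < 1) (hrow : ∀ i, ∑ j, ‖M i j‖ * w j ≤ ρ * w i) : IsUnit (1 - M) := by
  rw [← Matrix.mulVec_injective_iff_isUnit]
  intro u v huv
  have h0 : ∀ i, (u - v) i = ∑ j, M i j * (u - v) j := by
    intro i
    have h1 : (1 - M) *ᵥ (u - v) = 0 := by
      rw [Matrix.mulVec_sub]
      exact sub_eq_zero.2 huv
    rw [Matrix.sub_mulVec, Matrix.one_mulVec, sub_eq_zero] at h1
    exact congrFun h1 i
  have h2 := norm_le_of_weighted_contraction (e := u - v) (ε := 0) (fun i j => norm_nonneg (M i j))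
    hw hρ hrow fun i => by
      rw [add_zero]
      calc ‖(u - v) i‖ = ‖∑ j, M i j * (u - v) j‖ := by rw [← h0]
        _ ≤ ∑ j, ‖M i j * (u - v) j‖ := norm_sum_le _ _
        _ = _ := by simp
  funext i
  have h3 := h2 i
  rw [zero_div, mul_zero] at h3
  exact sub_eq_zero.1 (norm_le_zero_iff.1 h3)

end Weighted

section DetEquiv

variable {J : Type*} [Fintype J] [DecidableEq J] {d : J → ℕ}
variable {m n q : Type*} [Fintype m] [DecidableEq m] [Fintype n] [DecidableEq n]
  [Fintype q] [DecidableEq q]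

/-- The matrix `∑ j, A_j A_jᴴ / (1 + δ_j) + T`. -/
noncomputable def detInv (A : Family m d) (T : Matrix m m ℂ) (δ : J → ℝ) : Matrix m m ℂ :=
  ∑ j, (((1 + δ j)⁻¹ : ℝ) : ℂ) • (A j * (A j)ᴴ) + T

/-- The deterministic equivalent of the resolvent for given `δ`. -/
noncomputable def detEquiv (A : Family m d) (T : Matrix m m ℂ) (δ : J → ℝ) : Matrix m m ℂ :=
  (detInv A T δ)⁻¹

/-- The right-hand side of the fixed-point system. -/
noncomputable def fixMap (A : Family m d) (T : Matrix m m ℂ) (δ : J → ℝ) (i : J) : ℝ :=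
  ((A i)ᴴ * detEquiv A T δ * A i).trace.re

/-- Nonnegative solutions of the fixed-point system. -/
def IsFixedPoint (A : Family m d) (T : Matrix m m ℂ) (δ : J → ℝ) : Prop :=
  ∀ i, 0 ≤ δ i ∧ δ i = fixMap A T δ i

/-- The weight `√((1 + δ_j)(1 + δ'_j))`. -/
noncomputable def weight (δ δ' : J → ℝ) (j : J) : ℝ := √(1 + δ j) * √(1 + δ' j)

theorem one_le_weight {δ δ' : J → ℝ} (hδ : ∀ j, 0 ≤ δ j) (hδ' : ∀ j, 0 ≤ δ' j) (j : J) :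
    1 ≤ weight δ δ' j := by
  have h1 : 1 ≤ √(1 + δ j) := by rw [Real.one_le_sqrt]; linarith [hδ j]
  have h2 : 1 ≤ √(1 + δ' j) := by rw [Real.one_le_sqrt]; linarith [hδ' j]
  unfold weight
  nlinarith

theorem weight_sq {δ δ' : J → ℝ} (hδ : ∀ j, 0 ≤ δ j) (hδ' : ∀ j, 0 ≤ δ' j) (j : J) :
    weight δ δ' j * weight δ δ' j = (1 + δ j) * (1 + δ' j) := by
  unfold weight
  have h1 := Real.mul_self_sqrt (by linarith [hδ j] : 0 ≤ 1 + δ j)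
  have h2 := Real.mul_self_sqrt (by linarith [hδ' j] : 0 ≤ 1 + δ' j)
  calc _ = (√(1 + δ j) * √(1 + δ j)) * (√(1 + δ' j) * √(1 + δ' j)) := by ring
    _ = _ := by rw [h1, h2]

theorem weight_le {δ δ' : J → ℝ} {b : ℝ} (hδ : ∀ j, 0 ≤ δ j) (hb : ∀ j, δ j ≤ b)
    (hb' : ∀ j, δ' j ≤ b) (j : J) : weight δ δ' j ≤ 1 + b := by
  have h0 : 0 ≤ 1 + b := by linarith [hδ j, hb j]
  unfold weight
  calc _ ≤ √(1 + b) * √(1 + b) := by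
        gcongr
        · exact hb j
        · exact hb' j
    _ = _ := Real.mul_self_sqrt h0

section LowerBound

variable {t : ℝ} (ht : 0 < t) {A : Family m d} {T : Matrix m m ℂ} (hT : LowerBdd t T)
  {δ : J → ℝ} (hδ : ∀ j, 0 ≤ δ j)

include hδ in
theorem sum_posSemidef :
    (∑ j, (((1 + δ j)⁻¹ : ℝ) : ℂ) • (A j * (A j)ᴴ)).PosSemidef := by
  refine Matrix.posSemidef_sum _ fun j _ =>
    (Matrix.posSemidef_self_mul_conjTranspose (A j)).smul ?_
  have : 0 ≤ (1 + δ j)⁻¹ := by have := hδ j; positivity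
  exact_mod_cast this

include ht hT hδ

theorem detInv_posDef : (detInv A T δ).PosDef := (hT.add (sum_posSemidef hδ)).posDef ht

theorem detInv_isUnit_det : IsUnit (detInv A T δ).det :=
  (Matrix.isUnit_iff_isUnit_det _).1 (detInv_posDef ht hT hδ).isUnit

theorem detEquiv_posDef : (detEquiv A T δ).PosDef := (detInv_posDef ht hT hδ).inv

theorem detEquiv_conjTranspose : (detEquiv A T δ)ᴴ = detEquiv A T δ :=
  (detEquiv_posDef ht hT hδ).isHermitian.eq

theorem norm_detEquiv_le : ‖detEquiv A T δ‖ ≤ t⁻¹ := by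
  have h := norm_inv_le_of_lowerBdd ht (hT.add (sum_posSemidef (A := A) hδ)) (0 : Matrix m J ℂ)
  rwa [Matrix.zero_mul, zero_add] at h

theorem trace_conj_detEquiv (C : Matrix m q ℂ) :
    0 ≤ (Cᴴ * detEquiv A T δ * C).trace.re ∧
      (Cᴴ * detEquiv A T δ * C).trace = ((Cᴴ * detEquiv A T δ * C).trace.re : ℂ) := by
  have h := ((detEquiv_posDef (A := A) ht hT hδ).posSemidef.conjTranspose_mul_mul_same
    C).trace_nonneg
  rw [Complex.nonneg_iff] at h
  exact ⟨h.1, by apply Complex.ext <;> simp [← h.2]⟩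

theorem fixMap_nonneg (i : J) : 0 ≤ fixMap A T δ i := (trace_conj_detEquiv ht hT hδ (A i)).1

theorem fixMap_eq (i : J) : ((A i)ᴴ * detEquiv A T δ * A i).trace = (fixMap A T δ i : ℂ) :=
  (trace_conj_detEquiv ht hT hδ (A i)).2

/-- The energy identity for the deterministic equivalent. -/
theorem sum_frSq_detEquiv_le (C : Matrix m q ℂ) :
    ∑ j, (1 + δ j)⁻¹ * frSq (Cᴴ * detEquiv A T δ * A j) ≤
      (Cᴴ * detEquiv A T δ * C).trace.re := by
  have hH := detEquiv_conjTranspose ht hT hδ (A := A)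
  have h1 : (Cᴴ * detEquiv A T δ * C) = ∑ j, (((1 + δ j)⁻¹ : ℝ) : ℂ) •
      ((Cᴴ * detEquiv A T δ * A j) * (Cᴴ * detEquiv A T δ * A j)ᴴ) +
      (detEquiv A T δ * C)ᴴ * T * (detEquiv A T δ * C) := by
    -- Sandwiching Θ = Θ Θ⁻¹ Θ and inserting the sum that defines Θ⁻¹ produces the Frobenius norms,
    -- plus a nonnegative contribution of T that is discarded.
    have h2 : detEquiv A T δ = detEquiv A T δ * detInv A T δ * detEquiv A T δ := by
      rw [detEquiv, Matrix.nonsing_inv_mul _ (detInv_isUnit_det ht hT hδ), Matrix.one_mul]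
    conv_lhs => rw [h2, detInv]
    simp only [Matrix.mul_add, Matrix.add_mul, Matrix.mul_sum, Matrix.sum_mul,
      Matrix.mul_smul, Matrix.smul_mul, Matrix.conjTranspose_mul, hH,
      Matrix.conjTranspose_conjTranspose, Matrix.mul_assoc]
  have h3 : 0 ≤ ((detEquiv A T δ * C)ᴴ * T * (detEquiv A T δ * C)).trace.re :=
    (Complex.nonneg_iff.1 (((hT.posSemidef ht.le).conjTranspose_mul_mul_same
      (detEquiv A T δ * C)).trace_nonneg)).1
  have h4 : (Cᴴ * detEquiv A T δ * C).trace.re =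
      ∑ j, (1 + δ j)⁻¹ * frSq (Cᴴ * detEquiv A T δ * A j) +
      ((detEquiv A T δ * C)ᴴ * T * (detEquiv A T δ * C)).trace.re := by
    conv_lhs => rw [h1]
    rw [Matrix.trace_add, Matrix.trace_sum, Complex.add_re, Complex.re_sum]
    congr 1
    refine Finset.sum_congr rfl fun j _ => ?_
    rw [Matrix.trace_smul, trace_mul_conjTranspose_eq_frSq, smul_eq_mul, ← Complex.ofReal_mul,
      Complex.ofReal_re]
  linarith

theorem detEquiv_sub {δ' : J → ℝ} (hδ' : ∀ j, 0 ≤ δ' j) :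
    detEquiv A T δ - detEquiv A T δ' = ∑ j, (((δ j - δ' j) / ((1 + δ j) * (1 + δ' j)) : ℝ) : ℂ) •
      (detEquiv A T δ * (A j * (A j)ᴴ) * detEquiv A T δ') := by
  have h1 : detEquiv A T δ - detEquiv A T δ' =
      detEquiv A T δ * (detInv A T δ' - detInv A T δ) * detEquiv A T δ' := by
    rw [Matrix.mul_sub, Matrix.sub_mul, detEquiv, detEquiv,
      Matrix.nonsing_inv_mul _ (detInv_isUnit_det ht hT hδ), Matrix.mul_assoc,
      Matrix.mul_nonsing_inv _ (detInv_isUnit_det ht hT hδ'), Matrix.mul_one, Matrix.one_mul]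
  rw [h1, detInv, detInv, add_sub_add_right_eq_sub, ← Finset.sum_sub_distrib, Matrix.mul_sum,
    Matrix.sum_mul]
  refine Finset.sum_congr rfl fun j _ => ?_
  rw [← sub_smul, Matrix.mul_smul, Matrix.smul_mul]
  congr 1
  have e1 : (1 + δ j) ≠ 0 := by have := hδ j; positivity
  have e2 : (1 + δ' j) ≠ 0 := by have := hδ' j; positivity
  rw [← Complex.ofReal_sub]
  congr 1
  field_simp
  ring

end LowerBound

/-- Weighted row sums of the stability matrices. -/
theorem sum_norm_trace_div_weight_le {t : ℝ} (ht : 0 < t) {A : Family m d} {T : Matrix m m ℂ}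
    (hT : LowerBdd t T) {A' : Family n d} {T' : Matrix n n ℂ} (hT' : LowerBdd t T')
    {δ δ' : J → ℝ} (hδ : ∀ j, 0 ≤ δ j) (hδ' : ∀ j, 0 ≤ δ' j) (i : J) :
    ∑ j, ‖((A i)ᴴ * detEquiv A T δ * A j * ((A' j)ᴴ * detEquiv A' T' δ' * A' i)).trace‖ /
      weight δ δ' j ≤ √(fixMap A T δ i) * √(fixMap A' T' δ' i) := by
  have h1 := sum_frSq_detEquiv_le (A := A) ht hT hδ (A i)
  have h2 := sum_frSq_detEquiv_le (A := A') ht hT' hδ' (A' i)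
  -- Cauchy–Schwarz is used for each trace and then for the sum over j. The weight is a product of
  -- two square roots, one for each of the two energy inequalities.
  have h0 : ∀ j, ‖((A i)ᴴ * detEquiv A T δ * A j *
      ((A' j)ᴴ * detEquiv A' T' δ' * A' i)).trace‖ / weight δ δ' j ≤
      √((1 + δ j)⁻¹ * frSq ((A i)ᴴ * detEquiv A T δ * A j)) *
      √((1 + δ' j)⁻¹ * frSq ((A' i)ᴴ * detEquiv A' T' δ' * A' j)) := by
    intro j
    have p1 : 0 ≤ 1 + δ j := by linarith [hδ j]
    have p2 : 0 ≤ 1 + δ' j := by linarith [hδ' j]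
    have h3 : frSq ((A' j)ᴴ * detEquiv A' T' δ' * A' i) =
        frSq ((A' i)ᴴ * detEquiv A' T' δ' * A' j) := by
      rw [← frSq_conjTranspose]
      simp only [Matrix.conjTranspose_mul, Matrix.conjTranspose_conjTranspose,
        detEquiv_conjTranspose ht hT' hδ', Matrix.mul_assoc]
    have h4 := norm_trace_mul_le ((A i)ᴴ * detEquiv A T δ * A j)
      ((A' j)ᴴ * detEquiv A' T' δ' * A' i)
    rw [h3] at h4
    rw [Real.sqrt_mul (by positivity), Real.sqrt_mul (by positivity), Real.sqrt_inv, Real.sqrt_inv,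
      weight, div_eq_mul_inv, mul_inv]
    calc _ ≤ (√(frSq ((A i)ᴴ * detEquiv A T δ * A j)) *
          √(frSq ((A' i)ᴴ * detEquiv A' T' δ' * A' j))) *
          ((√(1 + δ j))⁻¹ * (√(1 + δ' j))⁻¹) := by gcongr
      _ = _ := by ring
  refine (Finset.sum_le_sum fun j _ => h0 j).trans ?_
  refine (Real.sum_sqrt_mul_sqrt_le _ (fun j => ?_) (fun j => ?_)).trans ?_
  · have := hδ j
    have := frSq_nonneg ((A i)ᴴ * detEquiv A T δ * A j)
    positivity
  · have := hδ' j
    have := frSq_nonneg ((A' i)ᴴ * detEquiv A' T' δ' * A' j)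
    positivity
  · gcongr
    · exact h1
    · exact h2

theorem trace_detEquiv_sub {t : ℝ} (ht : 0 < t) {A : Family m d} {T : Matrix m m ℂ}
    (hT : LowerBdd t T) {δ δ' : J → ℝ} (hδ : ∀ j, 0 ≤ δ j) (hδ' : ∀ j, 0 ≤ δ' j) (i : J) :
    ((fixMap A T δ i - fixMap A T δ' i : ℝ) : ℂ) =
      ∑ j, (((δ j - δ' j) / ((1 + δ j) * (1 + δ' j)) : ℝ) : ℂ) *
        ((A i)ᴴ * detEquiv A T δ * A j * ((A j)ᴴ * detEquiv A T δ' * A i)).trace := by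
  push_cast
  rw [← fixMap_eq ht hT hδ, ← fixMap_eq ht hT hδ', ← Matrix.trace_sub, ← Matrix.sub_mul,
    ← Matrix.mul_sub, detEquiv_sub ht hT hδ hδ', Matrix.mul_sum, Matrix.sum_mul,
    Matrix.trace_sum]
  refine Finset.sum_congr rfl fun j _ => ?_
  rw [Matrix.mul_smul, Matrix.smul_mul, Matrix.trace_smul, smul_eq_mul]
  push_cast
  simp only [Matrix.mul_assoc]

/-- This comes from an exact difference formula rather than a derivative bound: the coefficients mix
Θ(δ) and Θ(δ'), so the weighted row sums apply globally, with no smallness of δ - δ'. -/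
theorem abs_fixMap_sub_le {t : ℝ} (ht : 0 < t) {A : Family m d} {T : Matrix m m ℂ}
    (hT : LowerBdd t T) {δ δ' : J → ℝ} (hδ : ∀ j, 0 ≤ δ j) (hδ' : ∀ j, 0 ≤ δ' j) (i : J) :
    |fixMap A T δ i - fixMap A T δ' i| ≤
      ∑ j, ‖((A i)ᴴ * detEquiv A T δ * A j * ((A j)ᴴ * detEquiv A T δ' * A i)).trace‖ /
        (weight δ δ' j * weight δ δ' j) * ‖((δ j - δ' j : ℝ) : ℂ)‖ := by
  rw [← Real.norm_eq_abs, ← Complex.norm_real, trace_detEquiv_sub ht hT hδ hδ']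
  refine (norm_sum_le _ _).trans (le_of_eq (Finset.sum_congr rfl fun j _ => ?_))
  have p1 : 0 ≤ (1 + δ j) * (1 + δ' j) := by have := hδ j; have := hδ' j; positivity
  rw [norm_mul, weight_sq hδ hδ', Complex.norm_real, Complex.norm_real, norm_div,
    Real.norm_of_nonneg p1]
  ring

/-- The contraction factor attached to the bound `b` on the fixed points. -/
noncomputable def contr (b : ℝ) : ℝ := 1 - (2 * (1 + b))⁻¹

theorem contr_lt_one {b : ℝ} (hb : 0 ≤ b) : contr b < 1 := by
  have : 0 < (2 * (1 + b))⁻¹ := by positivity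
  unfold contr
  linarith

theorem contr_nonneg {b : ℝ} (hb : 0 ≤ b) : 0 ≤ contr b := by
  have : (2 * (1 + b))⁻¹ ≤ 1 := inv_le_one_of_one_le₀ (by linarith)
  unfold contr
  linarith

/-- Indeed x/(1+x) = 1 - 1/(1+x) ≤ 1 - 1/(1+b), and the factor 2 in `contr` makes its square
dominate the right side. -/
theorem sqrt_le_contr_mul {b x : ℝ} (hx : 0 ≤ x) (hxb : x ≤ b) :
    √x ≤ contr b * √(1 + x) := by
  have hb : 0 ≤ b := hx.trans hxb
  have hc := contr_nonneg hb
  rw [Real.sqrt_le_left (by positivity), mul_pow, Real.sq_sqrt (by positivity)]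
  have h1 : 1 - (1 + b)⁻¹ ≤ contr b ^ 2 := by
    unfold contr
    rw [mul_inv]
    nlinarith [sq_nonneg ((1 + b)⁻¹)]
  have h2 : (1 + b)⁻¹ ≤ (1 + x)⁻¹ := by gcongr
  have h3 : (1 + x)⁻¹ * (1 + x) = 1 := inv_mul_cancel₀ (by positivity)
  nlinarith

/-- The whole gain comes from the exact solution δ', where √δ' is a fixed fraction of √(1+δ'). For δ
the inequality `hi` is enough, so that an approximate solution with error at most 1 is allowed. -/
theorem sum_norm_trace_div_le_contr {t b : ℝ} (ht : 0 < t) {A : Family m d} {T : Matrix m m ℂ}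
    (hT : LowerBdd t T) {A' : Family n d} {T' : Matrix n n ℂ} (hT' : LowerBdd t T')
    {δ δ' : J → ℝ} (hδ : ∀ j, 0 ≤ δ j) (hfix : IsFixedPoint A' T' δ') (hb : ∀ j, δ' j ≤ b)
    (i : J) (hi : fixMap A T δ i ≤ 1 + δ i) :
    ∑ j, ‖((A i)ᴴ * detEquiv A T δ * A j * ((A' j)ᴴ * detEquiv A' T' δ' * A' i)).trace‖ /
      (weight δ δ' j * weight δ δ' j) * weight δ δ' j ≤ contr b * weight δ δ' i := by
  have hδ' := fun j => (hfix j).1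
  have h := sum_norm_trace_div_weight_le ht hT hT' hδ hδ' i (A := A) (A' := A')
  refine le_trans (le_of_eq (Finset.sum_congr rfl fun j _ => ?_)) (h.trans ?_)
  · have := zero_lt_one.trans_le (one_le_weight hδ hδ' j)
    field_simp
  · rw [← (hfix i).2, weight]
    have h1 : √(fixMap A T δ i) ≤ √(1 + δ i) := Real.sqrt_le_sqrt hi
    have h2 := sqrt_le_contr_mul (hδ' i) (hb i)
    calc _ ≤ √(1 + δ i) * (contr b * √(1 + δ' i)) := by gcongr
      _ = _ := by ring

theorem IsFixedPoint.unique {t : ℝ} (ht : 0 < t) {A : Family m d} {T : Matrix m m ℂ}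
    (hT : LowerBdd t T) {δ δ' : J → ℝ} (h : IsFixedPoint A T δ) (h' : IsFixedPoint A T δ') :
    δ = δ' := by
  have hδ := fun j => (h j).1
  have hδ' := fun j => (h' j).1
  have hb : ∀ j, δ' j ≤ ∑ k, δ' k := fun j =>
    Finset.single_le_sum (fun k _ => hδ' k) (Finset.mem_univ j)
  have hb0 : 0 ≤ ∑ k, δ' k := Finset.sum_nonneg fun k _ => hδ' k
  have hc := norm_le_of_weighted_contraction (e := fun j => ((δ j - δ' j : ℝ) : ℂ)) (ε := 0)
    (a := fun i j => ‖((A i)ᴴ * detEquiv A T δ * A j * ((A j)ᴴ * detEquiv A T δ' * A i)).trace‖ /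
        (weight δ δ' j * weight δ δ' j))
    (fun i j => div_nonneg (norm_nonneg _) (mul_self_nonneg _))
    (one_le_weight hδ hδ') (contr_lt_one hb0)
    (fun i => sum_norm_trace_div_le_contr ht hT hT hδ h' hb i (by rw [← (h i).2]; linarith))
    (fun i => by
      have h1 := abs_fixMap_sub_le (A := A) ht hT hδ hδ' i
      rw [← (h i).2, ← (h' i).2] at h1
      rwa [add_zero, Complex.norm_real, Real.norm_eq_abs])
  funext i
  have := hc i
  rw [zero_div, mul_zero, norm_le_zero_iff, Complex.ofReal_eq_zero] at this
  linarith

theorem fixMap_le {t : ℝ} (ht : 0 < t) {A : Family m d} {T : Matrix m m ℂ}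
    (hT : LowerBdd t T) {β : ℝ} (hA : ∀ j, ‖A j‖ ≤ β) {δ : J → ℝ} (hδ : ∀ j, 0 ≤ δ j) (i : J) :
    fixMap A T δ i ≤ Fintype.card m * (t⁻¹ * β ^ 2) := by
  have hβ : 0 ≤ β := (norm_nonneg _).trans (hA i)
  refine (Complex.re_le_norm _).trans ?_
  rw [Matrix.mul_assoc, Matrix.trace_mul_comm, Matrix.mul_assoc]
  refine (norm_trace_mul_le_card _ _).trans ?_
  have h1 := norm_detEquiv_le ht hT hδ (A := A)
  have h2 : ‖A i * (A i)ᴴ‖ ≤ β ^ 2 := by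
    refine (Matrix.l2_opNorm_mul _ _).trans ?_
    rw [Matrix.l2_opNorm_conjTranspose, sq]
    exact mul_le_mul (hA i) (hA i) (norm_nonneg _) hβ
  gcongr

theorem continuousOn_fixMap {t : ℝ} (ht : 0 < t) {A : Family m d} {T : Matrix m m ℂ}
    (hT : LowerBdd t T) (i : J) :
    ContinuousOn (fun δ => fixMap A T δ i) {δ : J → ℝ | ∀ j, 0 ≤ δ j} := by
  have h0 : ContinuousOn (fun δ : J → ℝ => detInv A T δ) {δ : J → ℝ | ∀ j, 0 ≤ δ j} := by
    unfold detInv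
    refine ContinuousOn.add (continuousOn_finsetSum _ fun j _ => ?_) continuousOn_const
    refine ContinuousOn.smul (f := fun δ : J → ℝ => (((1 + δ j)⁻¹ : ℝ) : ℂ)) ?_ continuousOn_const
    refine Complex.continuous_ofReal.comp_continuousOn (ContinuousOn.inv₀ (by fun_prop) ?_)
    intro δ hδ
    have : 0 ≤ δ j := hδ j
    positivity
  have h1 : ContinuousOn (fun δ : J → ℝ => detEquiv A T δ) {δ : J → ℝ | ∀ j, 0 ≤ δ j} := by
    simp only [detEquiv, Matrix.inv_def, Ring.inverse_eq_inv']
    refine ContinuousOn.smul (ContinuousOn.inv₀ ?_ fun δ hδ =>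
      (detInv_isUnit_det ht hT hδ).ne_zero) ?_
    · exact (continuous_id.matrix_det).comp_continuousOn h0
    · exact (continuous_id.matrix_adjugate).comp_continuousOn h0
  have h2 : Continuous fun M : Matrix m m ℂ => ((A i)ᴴ * M * A i).trace.re :=
    Complex.continuous_re.comp
      ((continuous_const.matrix_mul continuous_id).matrix_mul continuous_const).matrix_trace
  exact h2.comp_continuousOn h1

/-- On the compact box [0, b]^J, which the map preserves, take a minimiser of the weighted
displacement D(x, F x). The row sum estimate gives D(F x, F² x) ≤ `contr b` · D(x, F x), so a
positive minimum is impossible. The weights depend on both points and D is not used as a metric,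
hence compactness in place of iteration. -/
theorem exists_isFixedPoint {t : ℝ} (ht : 0 < t) (A : Family m d) {T : Matrix m m ℂ}
    (hT : LowerBdd t T) : ∃ δ, IsFixedPoint A T δ := by
  have hA : ∀ j, ‖A j‖ ≤ ∑ k, ‖A k‖ := fun j =>
    Finset.single_le_sum (f := fun k => ‖A k‖) (fun k _ => norm_nonneg _) (Finset.mem_univ j)
  set b : ℝ := Fintype.card m * (t⁻¹ * (∑ k, ‖A k‖) ^ 2) with hbdef
  have hb0 : 0 ≤ b := by positivity
  set K : Set (J → ℝ) := Set.Icc 0 (fun _ => b) with hK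
  have hKc : IsCompact K := isCompact_Icc
  have hK0 : ∀ x ∈ K, ∀ j, 0 ≤ x j := fun x hx j => hx.1 j
  have hmaps : ∀ x ∈ K, fixMap A T x ∈ K := fun x hx =>
    ⟨fun j => fixMap_nonneg ht hT (hK0 x hx) j, fun j => fixMap_le ht hT hA (hK0 x hx) j⟩
  have hcont : ContinuousOn (fun x => fixMap A T x) K :=
    continuousOn_pi.2 fun j => (continuousOn_fixMap ht hT j).mono fun x hx => hK0 x hx
  set D : (J → ℝ) → (J → ℝ) → ℝ := fun x y => ‖fun j => (x j - y j) / weight x y j‖ with hD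
  have hDc : ContinuousOn (fun x => D x (fixMap A T x)) K := by
    refine (continuousOn_pi.2 fun j => ?_).norm
    have hj : ContinuousOn (fun x => fixMap A T x j) K :=
      (continuous_apply j).comp_continuousOn hcont
    have hx : ContinuousOn (fun x : J → ℝ => x j) K := (continuous_apply j).continuousOn
    refine (hx.sub hj).div ?_ fun x hx => ?_
    · exact (Real.continuous_sqrt.comp_continuousOn (continuousOn_const.add hx)).mul
        (Real.continuous_sqrt.comp_continuousOn (continuousOn_const.add hj))
    · exact (zero_lt_one.trans_le (one_le_weight (hK0 x hx) (hK0 _ (hmaps x hx)) j)).ne'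
  obtain ⟨x, hxK, hmin⟩ := hKc.exists_isMinOn ⟨0, ⟨le_rfl, fun _ => hb0⟩⟩ hDc
  set y := fixMap A T x with hy
  have hx0 := hK0 x hxK
  have hy0 := hK0 y (hmaps x hxK)
  have hz0 := hK0 _ (hmaps y (hmaps x hxK))
  have hw := one_le_weight hx0 hy0
  have hcontr : D y (fixMap A T y) ≤ contr b * D x y := by
    have hD0 : 0 ≤ D x y := norm_nonneg _
    refine (pi_norm_le_iff_of_nonneg (mul_nonneg (contr_nonneg hb0) hD0)).2 fun i => ?_
    have hwi := zero_lt_one.trans_le (one_le_weight hy0 hz0 i)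
    rw [norm_div, Real.norm_of_nonneg hwi.le, div_le_iff₀ hwi, Real.norm_eq_abs]
    have h1 := abs_fixMap_sub_le ht hT hx0 hy0 i (A := A)
    have h2 : ∀ j, ‖((x j - y j : ℝ) : ℂ)‖ ≤ D x y * weight x y j := by
      intro j
      have hwj := zero_lt_one.trans_le (hw j)
      have := norm_le_pi_norm (fun j => (x j - y j) / weight x y j) j
      rw [norm_div, Real.norm_of_nonneg hwj.le, div_le_iff₀ hwj] at this
      rwa [Complex.norm_real]
    have h3 := sum_norm_trace_div_weight_le ht hT hT hx0 hy0 i (A := A) (A' := A)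
    have h4 := sqrt_le_contr_mul (hy0 i) ((hmaps x hxK).2 i)
    have h5 : √(fixMap A T y i) ≤ √(1 + fixMap A T y i) := Real.sqrt_le_sqrt (by linarith)
    calc |y i - fixMap A T y i| ≤ _ := h1
      _ ≤ ∑ j, ‖((A i)ᴴ * detEquiv A T x * A j * ((A j)ᴴ * detEquiv A T y * A i)).trace‖ /
        (weight x y j * weight x y j) * (D x y * weight x y j) := by
          refine Finset.sum_le_sum fun j _ => mul_le_mul_of_nonneg_left (h2 j) ?_
          exact div_nonneg (norm_nonneg _) (mul_self_nonneg _)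
      _ = D x y * ∑ j, ‖((A i)ᴴ * detEquiv A T x * A j *
            ((A j)ᴴ * detEquiv A T y * A i)).trace‖ / weight x y j := by
          rw [Finset.mul_sum]
          refine Finset.sum_congr rfl fun j _ => ?_
          have hwj := zero_lt_one.trans_le (hw j)
          field_simp
      _ ≤ D x y * (√(y i) * √(fixMap A T y i)) := mul_le_mul_of_nonneg_left h3 hD0
      _ ≤ D x y * ((contr b * √(1 + y i)) * √(1 + fixMap A T y i)) :=
          mul_le_mul_of_nonneg_left (mul_le_mul h4 h5 (Real.sqrt_nonneg _)
            (mul_nonneg (contr_nonneg hb0) (Real.sqrt_nonneg _))) hD0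
      _ = _ := by unfold weight; ring
  have hle : D x y ≤ D y (fixMap A T y) := hmin (hmaps x hxK)
  have hzero : D x y = 0 := by
    have h1 : 0 ≤ D x y := norm_nonneg _
    nlinarith [contr_lt_one hb0]
  refine ⟨x, fun i => ⟨hx0 i, ?_⟩⟩
  have h6 := congrFun (norm_eq_zero.1 hzero) i
  have hwi := zero_lt_one.trans_le (hw i)
  simp only [Pi.zero_apply, div_eq_zero_iff, hwi.ne', or_false] at h6
  linarith

end DetEquiv

/-! ### First-order deterministic equivalents -/

section FirstOrder

variable {J : Type*} [Fintype J] [DecidableEq J] {d : J → ℕ}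
variable {m n q : Type*} [Fintype m] [DecidableEq m] [Fintype n] [DecidableEq n]
  [Fintype q] [DecidableEq q]

theorem norm_mul_conjTranspose_le {β : ℝ} {P : Matrix m q ℂ} {R : Matrix n q ℂ}
    (hP : ‖P‖ ≤ β) (hR : ‖R‖ ≤ β) : ‖R * Pᴴ‖ ≤ β ^ 2 := by
  refine (Matrix.l2_opNorm_mul _ _).trans ?_
  rw [Matrix.l2_opNorm_conjTranspose, sq]
  exact mul_le_mul hR hP (norm_nonneg _) ((norm_nonneg _).trans hR)

theorem trace_conjTranspose_mul_mul (P : Matrix m q ℂ) (U : Matrix m n ℂ) (R : Matrix n q ℂ) :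
    (Pᴴ * U * R).trace = (R * Pᴴ * U).trace := by
  rw [Matrix.trace_mul_comm, Matrix.mul_assoc]

/-- A functional that is homogeneous and bounded on the unit ball is bounded. -/
theorem norm_le_mul_of_homogeneous {f : Matrix m n ℂ → ℂ} {c : ℝ}
    (hf : ∀ (s : ℝ) C, f ((s : ℂ) • C) = s * f C) (h : ∀ C, ‖C‖ ≤ 1 → ‖f C‖ ≤ c)
    (C : Matrix m n ℂ) : ‖f C‖ ≤ c * ‖C‖ := by
  have h1 := h (((‖C‖⁻¹ : ℝ) : ℂ) • C) (by
    rw [norm_smul, Complex.norm_real, norm_inv, norm_norm]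
    exact inv_mul_le_one)
  rcases eq_or_ne ‖C‖ 0 with h0 | h0
  · have h2 := hf 0 C
    rw [norm_eq_zero.1 h0] at h2 ⊢
    simp only [smul_zero, Complex.ofReal_zero, zero_mul] at h2
    simp [h2]
  · rw [hf, norm_mul, Complex.norm_real, norm_inv, norm_norm,
      inv_mul_le_iff₀ (lt_of_le_of_ne (norm_nonneg _) h0.symm)] at h1
    linarith

namespace Bounded

variable {B β : ℝ} {A : Family m d} {T : Matrix m m ℂ} (hA : Bounded B β A T)

include hA in
-- Families such as C Θ A_j with ‖C‖ ≤ 1 have norm at most B β instead of β; these constants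
-- accommodate them while keeping A and T admissible.
theorem enlarge : Bounded (B ^ 3) (B * β) A T where
  one_le := one_le_pow₀ hA.one_le
  pos := mul_pos hA.B_pos hA.pos
  lower := by
    refine hA.lower.mono (inv_anti₀ hA.B_pos ?_)
    exact le_self_pow₀ hA.one_le (by norm_num)
  norm_le := fun j => (hA.norm_le j).trans (le_mul_of_one_le_left hA.pos.le hA.one_le)
  card_row := by
    have h := mul_le_mul_of_nonneg_left hA.card_row (sq_nonneg B)
    calc _ = B ^ 2 * (Fintype.card m * β ^ 2) := by ring
      _ ≤ B ^ 2 * B := h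
      _ = _ := by ring
  card_col := by
    have h := mul_le_mul_of_nonneg_left hA.card_col (sq_nonneg B)
    calc _ = B ^ 2 * (Fintype.card J * β ^ 2) := by ring
      _ ≤ B ^ 2 * B := h
      _ = _ := by ring

include hA in
theorem pow_mul_le {p q : ℕ} (h : p ≤ q) {c : ℝ} (hc : 0 ≤ c) : c * B ^ p ≤ c * B ^ q :=
  mul_le_mul_of_nonneg_left (pow_le_pow_right₀ hA.one_le h) hc

include hA in
theorem tame_traceForm (P R : Family m d) (i : J) :
    Tame fun x => ((P i)ᴴ * resolv A T x * R i).trace :=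
  ((hA.resolv_matDeriv.const_mul (P i)ᴴ).mul_const (R i)).trace.tame

include hA in
theorem norm_trace_mul_resolv_le (C : Matrix m m ℂ) (x : ∀ j, Fin (d j) → ℂ) :
    ‖(C * resolv A T x).trace‖ ≤ Fintype.card m * (‖C‖ * B) :=
  (norm_trace_mul_le_card _ _).trans (by gcongr; exact hA.norm_resolv_le x)

include hA in
theorem norm_gMean_traceForm_le {P R : Family m d} (hP : ∀ j, ‖P j‖ ≤ β) (hR : ∀ j, ‖R j‖ ≤ β)
    (i : J) : ‖gMean fun x => ((P i)ᴴ * resolv A T x * R i).trace‖ ≤ B ^ 2 := by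
  refine norm_gMean_le fun x => ?_
  rw [trace_conjTranspose_mul_mul]
  refine (hA.norm_trace_mul_resolv_le _ x).trans ?_
  have h1 := norm_mul_conjTranspose_le (hP i) (hR i)
  have hB := hA.B_pos
  calc _ ≤ Fintype.card m * (β ^ 2 * B) := by gcongr
    _ = Fintype.card m * β ^ 2 * B := by ring
    _ ≤ B * B := by gcongr; exact hA.card_row
    _ = _ := by ring

include hA in
-- The coefficient R_i P_iᴴ has norm at most β², so its squared Frobenius norm is at most B β².
-- Numerical constants are rounded up to squares because `norm_gMean_mul_sub_le` takes standard
-- deviations.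
theorem gVar_traceForm_le {P R : Family m d} (hP : ∀ j, ‖P j‖ ≤ β) (hR : ∀ j, ‖R j‖ ≤ β)
    (i : J) : gVar (fun x => ((P i)ᴴ * resolv A T x * R i).trace) ≤ (4 * B ^ 2 * β ^ 2) ^ 2 := by
  simp only [trace_conjTranspose_mul_mul]
  refine (hA.gVar_trace_mul_resolv_le _).trans ?_
  have h1 := norm_mul_conjTranspose_le (hP i) (hR i)
  have hB := hA.B_pos
  have h2 : frSq (R i * (P i)ᴴ) ≤ B * β ^ 2 :=
    calc _ ≤ Fintype.card m * ‖R i * (P i)ᴴ‖ ^ 2 := frSq_le_card_mul _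
      _ ≤ Fintype.card m * (β ^ 2) ^ 2 := by gcongr
      _ = Fintype.card m * β ^ 2 * β ^ 2 := by ring
      _ ≤ _ := by gcongr; exact hA.card_row
  calc _ ≤ 12 * B ^ 3 * β ^ 2 * (B * β ^ 2) := by gcongr
    _ = 12 * (B ^ 4 * β ^ 4) := by ring
    _ ≤ 16 * (B ^ 4 * β ^ 4) := by gcongr; norm_num
    _ = _ := by ring

include hA in
theorem gVar_form_single_le {P R : Family m d} (hP : ∀ j, ‖P j‖ ≤ β) (hR : ∀ j, ‖R j‖ ≤ β)
    (i : J) : gVar (fun x => ((cols P x)ᴴ * resolv A T x * cols R x) i i) ≤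
      (15 * B ^ 5 * β) ^ 2 := by
  have h := hA.gVar_form_le hP hR {i}
  simp only [Finset.sum_singleton, Finset.card_singleton, Nat.cast_one, mul_one] at h
  refine h.trans ?_
  have hB := hA.B_pos
  have h1 := hA.pow_mul_le (p := 9) (q := 10) (by norm_num) (show (0 : ℝ) ≤ 1 by norm_num)
  calc 216 * B ^ 9 * β ^ 2 = 216 * β ^ 2 * (1 * B ^ 9) := by ring
    _ ≤ 216 * β ^ 2 * (1 * B ^ 10) := by gcongr
    _ = 216 * (B ^ 10 * β ^ 2) := by ring
    _ ≤ 225 * (B ^ 10 * β ^ 2) := by gcongr; norm_num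
    _ = _ := by ring

include hA in
/-- Decoupled form of the integration by parts formula. -/
theorem norm_gMean_form_sub_le {P R : Family m d} (hP : ∀ j, ‖P j‖ ≤ β) (hR : ∀ j, ‖R j‖ ≤ β)
    (i : J) :
    ‖gMean (fun x => ((cols P x)ᴴ * resolv A T x * cols R x) i i) -
      (gMean (fun x => ((P i)ᴴ * resolv A T x * R i).trace) -
        gMean (fun x => ((P i)ᴴ * resolv A T x * A i).trace) *
        gMean (fun x => ((cols A x)ᴴ * resolv A T x * cols R x) i i))‖ ≤ 60 * B ^ 7 * β ^ 3 := by
  have hB := hA.B_pos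
  have hβ := hA.pos
  -- A standard deviation O(β²) times one O(β): the covariance is O(β³), small enough to be summed
  -- over O(β⁻²) columns.
  have h := norm_gMean_mul_sub_le (hA.tame_traceForm P A i) (hA.tame_form A R i)
    (a := 4 * B ^ 2 * β ^ 2) (b := 15 * B ^ 5 * β) (by positivity) (by positivity)
    (hA.gVar_traceForm_le hP hA.norm_le i) (hA.gVar_form_single_le hA.norm_le hR i)
  rw [hA.gMean_form P R i, sub_sub_sub_cancel_left, norm_sub_rev]
  refine h.trans (le_of_eq (by ring))

/-- The mean of `Tr(A_iᴴ Q A_i)`. -/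
noncomputable def _root_.meanForm (A : Family m d) (T : Matrix m m ℂ) (i : J) : ℝ :=
  (gMean fun x => ((A i)ᴴ * resolv A T x * A i).trace).re

include hA in
theorem gMean_traceForm_eq (i : J) :
    gMean (fun x => ((A i)ᴴ * resolv A T x * A i).trace) = (meanForm A T i : ℂ) := by
  have h : ∀ x, ((A i)ᴴ * resolv A T x * A i).trace =
      (((A i)ᴴ * resolv A T x * A i).trace.re : ℂ) := by
    intro x
    have h := ((hA.resolv_posDef x).posSemidef.conjTranspose_mul_mul_same (A i)).trace_nonneg
    rw [Complex.nonneg_iff] at h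
    apply Complex.ext <;> simp [← h.2]
  unfold meanForm
  have h1 : (fun x => ((A i)ᴴ * resolv A T x * A i).trace) =
      fun x => (((A i)ᴴ * resolv A T x * A i).trace.re : ℂ) := funext h
  rw [h1, gMean, integral_complex_ofReal, Complex.ofReal_re]

include hA in
theorem meanForm_nonneg (i : J) : 0 ≤ meanForm A T i := by
  have h1 := hA.gMean_traceForm_eq i
  have h : ∀ x, ((A i)ᴴ * resolv A T x * A i).trace =
      (((A i)ᴴ * resolv A T x * A i).trace.re : ℂ) ∧
      0 ≤ ((A i)ᴴ * resolv A T x * A i).trace.re := by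
    intro x
    have h := ((hA.resolv_posDef x).posSemidef.conjTranspose_mul_mul_same (A i)).trace_nonneg
    rw [Complex.nonneg_iff] at h
    exact ⟨by apply Complex.ext <;> simp [← h.2], h.1⟩
  have h2 : (fun x => ((A i)ᴴ * resolv A T x * A i).trace) =
      fun x => (((A i)ᴴ * resolv A T x * A i).trace.re : ℂ) := funext fun x => (h x).1
  unfold meanForm
  rw [h2, gMean, integral_complex_ofReal, Complex.ofReal_re]
  exact integral_nonneg fun x => (h x).2

include hA in
theorem meanForm_le (i : J) : meanForm A T i ≤ B ^ 2 :=
  (Complex.re_le_norm _).trans (hA.norm_gMean_traceForm_le hA.norm_le hA.norm_le i)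

/-- Solving y ≈ t - a y for y divides the error by 1 + a ≥ 1, so nothing is lost. -/
theorem _root_.norm_sub_div_one_add_le {y t : ℂ} {a c : ℝ} (ha : 0 ≤ a)
    (h : ‖y - (t - a * y)‖ ≤ c) : ‖y - t / (1 + a)‖ ≤ c := by
  have h0 : (1 : ℂ) + a ≠ 0 := by
    have : (0 : ℝ) < 1 + a := by linarith
    exact_mod_cast this.ne'
  have h1 : y - t / (1 + a) = (y - (t - a * y)) / (1 + a) := by
    field_simp
    ring
  have h2 : ‖(1 : ℂ) + a‖ = 1 + a := by
    rw [← Complex.ofReal_one, ← Complex.ofReal_add, Complex.norm_real, Real.norm_of_nonneg]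
    linarith
  rw [h1, norm_div, h2]
  exact (div_le_self (norm_nonneg _) (by linarith)).trans h

include hA in
theorem norm_gMean_form_left_sub_le {R : Family m d} (hR : ∀ j, ‖R j‖ ≤ β) (i : J) :
    ‖gMean (fun x => ((cols A x)ᴴ * resolv A T x * cols R x) i i) -
      gMean (fun x => ((A i)ᴴ * resolv A T x * R i).trace) / (1 + meanForm A T i)‖ ≤
      60 * B ^ 7 * β ^ 3 := by
  have h := hA.norm_gMean_form_sub_le hA.norm_le hR i
  rw [hA.gMean_traceForm_eq i] at h
  exact norm_sub_div_one_add_le (hA.meanForm_nonneg i) h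

theorem _root_.cols_mul_left (U : Matrix n m ℂ) (A : Family m d) (x : ∀ j, Fin (d j) → ℂ) :
    cols (fun j => U * A j) x = U * cols A x := by
  ext a j
  simp only [cols, Matrix.of_apply, ← Matrix.mulVec_mulVec]
  rfl

include hA in
theorem detEquiv_sub_resolv {δ : J → ℝ} (hδ : ∀ j, 0 ≤ δ j) (x : ∀ j, Fin (d j) → ℂ) :
    resolv A T x - detEquiv A T δ = detEquiv A T δ *
      (∑ j, (((1 + δ j)⁻¹ : ℝ) : ℂ) • (A j * (A j)ᴴ) - cols A x * (cols A x)ᴴ) *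
      resolv A T x := by
  have h1 : ∑ j, (((1 + δ j)⁻¹ : ℝ) : ℂ) • (A j * (A j)ᴴ) - cols A x * (cols A x)ᴴ =
      detInv A T δ - (cols A x * (cols A x)ᴴ + T) := by
    rw [detInv]; abel
  rw [h1, Matrix.mul_sub, Matrix.sub_mul, resolv, detEquiv,
    Matrix.nonsing_inv_mul _ (detInv_isUnit_det hA.inv_pos hA.lower hδ), Matrix.one_mul,
    Matrix.mul_assoc, Matrix.mul_nonsing_inv _ (hA.isUnit_det x), Matrix.mul_one]

include hA in
theorem resolv_sub_detEquiv {δ : J → ℝ} (hδ : ∀ j, 0 ≤ δ j) (x : ∀ j, Fin (d j) → ℂ) :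
    resolv A T x - detEquiv A T δ = resolv A T x *
      (∑ j, (((1 + δ j)⁻¹ : ℝ) : ℂ) • (A j * (A j)ᴴ) - cols A x * (cols A x)ᴴ) *
      detEquiv A T δ := by
  have h1 : ∑ j, (((1 + δ j)⁻¹ : ℝ) : ℂ) • (A j * (A j)ᴴ) - cols A x * (cols A x)ᴴ =
      detInv A T δ - (cols A x * (cols A x)ᴴ + T) := by
    rw [detInv]; abel
  rw [h1, Matrix.mul_sub, Matrix.sub_mul, resolv, detEquiv, Matrix.mul_assoc,
    Matrix.mul_nonsing_inv _ (detInv_isUnit_det hA.inv_pos hA.lower hδ), Matrix.mul_one,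
    Matrix.nonsing_inv_mul _ (hA.isUnit_det x), Matrix.one_mul]

include hA in
theorem norm_detEquiv_le {δ : J → ℝ} (hδ : ∀ j, 0 ≤ δ j) : ‖detEquiv A T δ‖ ≤ B := by
  have h := _root_.norm_detEquiv_le (A := A) hA.inv_pos hA.lower hδ
  rwa [inv_inv] at h

include hA in
-- The resolvent identity expresses Q - Θ through XXᴴ, and by cyclicity the XXᴴ part is a sum of
-- one-resolvent forms whose right-hand family is C Θ A_j. Each summand compares such a form with
-- its predicted mean.
theorem gMean_trace_mul_resolv_sub {δ : J → ℝ} (hδ : ∀ j, 0 ≤ δ j) (C : Matrix m m ℂ) :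
    gMean (fun x => (C * resolv A T x).trace) - (C * detEquiv A T δ).trace =
      ∑ j, (gMean (fun x => ((A j)ᴴ * resolv A T x * (C * detEquiv A T δ * A j)).trace) /
          (1 + (δ j : ℂ)) -
        gMean (fun x => ((cols A x)ᴴ * resolv A T x *
          cols (fun j => C * detEquiv A T δ * A j) x) j j)) := by
  have h0 : ∀ x, (C * resolv A T x).trace - (C * detEquiv A T δ).trace =
      ∑ j, ((1 + (δ j : ℂ))⁻¹ * ((A j)ᴴ * resolv A T x * (C * detEquiv A T δ * A j)).trace -
        ((cols A x)ᴴ * resolv A T x * cols (fun j => C * detEquiv A T δ * A j) x) j j) := by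
    intro x
    rw [← Matrix.trace_sub, ← Matrix.mul_sub, hA.detEquiv_sub_resolv hδ x, Matrix.mul_sub,
      Matrix.sub_mul, Matrix.mul_sub, Matrix.trace_sub, Finset.sum_sub_distrib]
    congr 1
    · rw [Matrix.mul_sum, Matrix.sum_mul, Matrix.mul_sum, Matrix.trace_sum]
      refine Finset.sum_congr rfl fun j _ => ?_
      rw [Matrix.mul_smul, Matrix.smul_mul, Matrix.mul_smul, Matrix.trace_smul, smul_eq_mul]
      congr 1
      · push_cast; rfl
      · rw [trace_conjTranspose_mul_mul]
        simp only [Matrix.mul_assoc]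
    · change _ = Matrix.trace _
      rw [cols_mul_left, trace_conjTranspose_mul_mul]
      simp only [Matrix.mul_assoc]
  have t1 : ∀ j, Tame fun x => (1 + (δ j : ℂ))⁻¹ *
      ((A j)ᴴ * resolv A T x * (C * detEquiv A T δ * A j)).trace := fun j =>
    (Tame.const _).mul (hA.tame_traceForm A (fun j => C * detEquiv A T δ * A j) j)
  have t2 := fun j => hA.tame_form A (fun j => C * detEquiv A T δ * A j) j
  calc _ = gMean (fun x => (C * resolv A T x).trace - (C * detEquiv A T δ).trace) := by
        rw [gMean_sub (hA.tame_trace_mul_resolv C) (Tame.const _), gMean_const]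
    _ = _ := by
        simp only [h0]
        rw [gMean_sum _ fun j _ => (t1 j).sub (t2 j)]
        refine Finset.sum_congr rfl fun j _ => ?_
        rw [gMean_sub (t1 j) (t2 j), gMean_const_mul, div_eq_inv_mul]

include hA in
theorem norm_mul_detEquiv_mul_le {δ : J → ℝ} (hδ : ∀ j, 0 ≤ δ j) {C : Matrix n m ℂ} (hC : ‖C‖ ≤ 1)
    (j : J) : ‖C * detEquiv A T δ * A j‖ ≤ B * β := by
  have hB := hA.B_pos
  calc _ ≤ ‖C‖ * ‖detEquiv A T δ‖ * ‖A j‖ := by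
        refine (Matrix.l2_opNorm_mul _ _).trans ?_
        gcongr
        exact Matrix.l2_opNorm_mul _ _
    _ ≤ 1 * B * β := by
        gcongr
        · exact hA.norm_detEquiv_le hδ
        · exact hA.norm_le j
    _ = _ := by ring

include hA in
theorem card_col_mul_le {c : ℝ} (hc : 0 ≤ c) : Fintype.card J * (c * β ^ 3) ≤ c * B * β := by
  have h := mul_le_mul_of_nonneg_left hA.card_col (mul_nonneg hc hA.pos.le)
  calc _ = c * β * (Fintype.card J * β ^ 2) := by ring
    _ ≤ _ := h
    _ = _ := by ring

include hA in
-- At δ = `meanForm A T` each summand of the preceding identity is exactly the error in the solved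
-- integration by parts formula. By homogeneity ‖C‖ ≤ 1 may be assumed, which puts C Θ A_j within
-- the enlarged bounds.
theorem norm_gMean_trace_mul_resolv_sub_meanForm_le (C : Matrix m m ℂ) :
    ‖gMean (fun x => (C * resolv A T x).trace) - (C * detEquiv A T (meanForm A T)).trace‖ ≤
      60 * B ^ 25 * β * ‖C‖ := by
  refine norm_le_mul_of_homogeneous (f := fun C => gMean (fun x => (C * resolv A T x).trace) -
    (C * detEquiv A T (meanForm A T)).trace) (fun s C => ?_) (fun C hC => ?_) C
  · simp only [Matrix.smul_mul, Matrix.trace_smul, smul_eq_mul]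
    rw [gMean_const_mul, mul_sub]
  · have hα := hA.meanForm_nonneg
    have hB := hA.B_pos
    have hβ := hA.pos
    rw [hA.gMean_trace_mul_resolv_sub hα C]
    refine (norm_sum_le _ _).trans ((Finset.sum_le_sum fun j _ => ?_).trans (b := ∑ _j : J,
      60 * (B ^ 3) ^ 7 * (B * β) ^ 3) ?_)
    · rw [norm_sub_rev]
      exact hA.enlarge.norm_gMean_form_left_sub_le (hA.norm_mul_detEquiv_mul_le hα hC) j
    · rw [Finset.sum_const, Finset.card_univ, nsmul_eq_mul]
      have := hA.card_col_mul_le (c := 60 * B ^ 24) (by positivity)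
      calc _ = (Fintype.card J : ℝ) * (60 * B ^ 24 * β ^ 3) := by ring
        _ ≤ _ := this
        _ = _ := by ring

variable {δ : J → ℝ} (hfix : IsFixedPoint A T δ)

include hA hfix in
theorem fixedPoint_le (i : J) : δ i ≤ B ^ 2 := by
  have h := fixMap_le hA.inv_pos hA.lower hA.norm_le (fun j => (hfix j).1) i
  rw [← (hfix i).2, inv_inv] at h
  have hB := hA.B_pos
  calc _ ≤ _ := h
    _ = B * (Fintype.card m * β ^ 2) := by ring
    _ ≤ B * B := by gcongr; exact hA.card_row
    _ = _ := by ring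

theorem _root_.inv_one_sub_contr (b : ℝ) : (1 - contr b)⁻¹ = 2 * (1 + b) := by
  rw [contr, sub_sub_cancel, inv_inv]

include hA in
theorem weight_mul_div_le {δ δ' : J → ℝ} (hδ : ∀ j, 0 ≤ δ j) (hb : ∀ j, δ j ≤ B ^ 2)
    (hb' : ∀ j, δ' j ≤ B ^ 2) {ε : ℝ} (hε : 0 ≤ ε) (i : J) :
    weight δ δ' i * (ε / (1 - contr (B ^ 2))) ≤ 8 * B ^ 4 * ε := by
  have h1 := weight_le hδ hb hb' i
  have h2 : 1 + B ^ 2 ≤ 2 * B ^ 2 := by nlinarith [hA.one_le]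
  have h0 : 0 ≤ 1 + B ^ 2 := by positivity
  rw [div_eq_mul_inv, inv_one_sub_contr]
  calc _ ≤ (2 * B ^ 2) * (ε * (2 * (2 * B ^ 2))) := by
        gcongr
        exact h1.trans h2
    _ = _ := by ring

include hA hfix in
theorem abs_meanForm_sub_le (i : J) : |meanForm A T i - δ i| ≤ 480 * B ^ 29 * β ^ 3 := by
  have hα := hA.meanForm_nonneg
  have hδ := fun j => (hfix j).1
  have hB := hA.B_pos
  have hβ := hA.pos
  have hb := hA.fixedPoint_le hfix
  set ε : ℝ := 60 * B ^ 25 * β ^ 3 with hε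
  have hε0 : 0 ≤ ε := by positivity
  have h1 : ∀ j, |meanForm A T j - fixMap A T (meanForm A T) j| ≤ ε := by
    intro j
    have h := hA.norm_gMean_trace_mul_resolv_sub_meanForm_le (A j * (A j)ᴴ)
    simp only [← trace_conjTranspose_mul_mul] at h
    rw [hA.gMean_traceForm_eq, fixMap_eq hA.inv_pos hA.lower hα, ← Complex.ofReal_sub,
      Complex.norm_real, Real.norm_eq_abs] at h
    refine h.trans ?_
    calc _ ≤ 60 * B ^ 25 * β * β ^ 2 := by
          gcongr
          exact norm_mul_conjTranspose_le (hA.norm_le j) (hA.norm_le j)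
      _ = _ := by rw [hε]; ring
  have key : |meanForm A T i - δ i| ≤ 8 * B ^ 4 * ε := by
    -- The contraction tolerates approximate solutions with error at most 1. If ε > 1 the trivial
    -- bound B² on both quantities is already good enough.
    rcases le_or_gt ε 1 with hε1 | hε1
    · have hc := norm_le_of_weighted_contraction (e := fun j => ((meanForm A T j - δ j : ℝ) : ℂ))
        (ε := ε) (a := fun i j => ‖((A i)ᴴ * detEquiv A T (meanForm A T) * A j *
            ((A j)ᴴ * detEquiv A T δ * A i)).trace‖ /
            (weight (meanForm A T) δ j * weight (meanForm A T) δ j))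
        (fun i j => div_nonneg (norm_nonneg _) (mul_self_nonneg _))
        (one_le_weight hα hδ) (contr_lt_one (sq_nonneg B))
        (fun i => sum_norm_trace_div_le_contr hA.inv_pos hA.lower hA.lower hα hfix hb i
          (by have := abs_le.1 (h1 i); linarith))
        (fun i => by
          have h2 := abs_fixMap_sub_le (A := A) hA.inv_pos hA.lower hα hδ i
          rw [← (hfix i).2] at h2
          rw [Complex.norm_real, Real.norm_eq_abs]
          calc _ = |(fixMap A T (meanForm A T) i - δ i) +
                (meanForm A T i - fixMap A T (meanForm A T) i)| := by congr 1; ring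
            _ ≤ _ := abs_add_le _ _
            _ ≤ _ := add_le_add h2 (h1 i)) i
      rw [Complex.norm_real, Real.norm_eq_abs] at hc
      exact hc.trans (hA.weight_mul_div_le hα hA.meanForm_le hb hε0 i)
    · have h2 : |meanForm A T i - δ i| ≤ B ^ 2 := by
        rw [abs_le]
        constructor <;> linarith [hα i, hδ i, hb i, hA.meanForm_le i]
      have h3 := hA.pow_mul_le (p := 2) (q := 4) (by norm_num) (show (0 : ℝ) ≤ 1 by norm_num)
      calc _ ≤ B ^ 2 := h2
        _ ≤ B ^ 4 * 1 := by linarith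
        _ ≤ B ^ 4 * ε := by gcongr
        _ ≤ 8 * B ^ 4 * ε := by
            have : 0 ≤ B ^ 4 * ε := by positivity
            linarith
  calc _ ≤ _ := key
    _ = _ := by rw [hε]; ring

include hA in
theorem norm_trace_detEquiv_le {δ δ' : J → ℝ} (hδ : ∀ j, 0 ≤ δ j) (hδ' : ∀ j, 0 ≤ δ' j)
    (C : Matrix m m ℂ) (j : J) :
    ‖(C * (detEquiv A T δ * (A j * (A j)ᴴ) * detEquiv A T δ')).trace‖ ≤ B ^ 3 * ‖C‖ := by
  have hB := hA.B_pos
  refine (norm_trace_mul_le_card _ _).trans ?_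
  calc _ ≤ Fintype.card m * (‖C‖ * (B * β ^ 2 * B)) := by
        gcongr
        refine (Matrix.l2_opNorm_mul _ _).trans ?_
        gcongr
        · refine (Matrix.l2_opNorm_mul _ _).trans ?_
          gcongr
          · exact hA.norm_detEquiv_le hδ
          · exact norm_mul_conjTranspose_le (hA.norm_le j) (hA.norm_le j)
        · exact hA.norm_detEquiv_le hδ'
    _ = B ^ 2 * ‖C‖ * (Fintype.card m * β ^ 2) := by ring
    _ ≤ B ^ 2 * ‖C‖ * B := by gcongr; exact hA.card_row
    _ = _ := by ring

include hA hfix in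
/-- `𝔼 Tr C Q` is close to `Tr C Θ`. -/
theorem norm_gMean_trace_mul_resolv_sub_le (C : Matrix m m ℂ) :
    ‖gMean (fun x => (C * resolv A T x).trace) - (C * detEquiv A T δ).trace‖ ≤
      540 * B ^ 33 * β * ‖C‖ := by
  have hα := hA.meanForm_nonneg
  have hδ := fun j => (hfix j).1
  have hB := hA.B_pos
  have hβ := hA.pos
  have h1 := hA.norm_gMean_trace_mul_resolv_sub_meanForm_le C
  have h2 : ‖(C * detEquiv A T (meanForm A T)).trace - (C * detEquiv A T δ).trace‖ ≤
      480 * B ^ 33 * β * ‖C‖ := by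
    rw [← Matrix.trace_sub, ← Matrix.mul_sub, detEquiv_sub hA.inv_pos hA.lower hα hδ,
      Matrix.mul_sum, Matrix.trace_sum]
    refine (norm_sum_le _ _).trans ((Finset.sum_le_sum fun j _ => ?_).trans (b := ∑ _j : J,
      480 * B ^ 29 * β ^ 3 * (B ^ 3 * ‖C‖)) ?_)
    · rw [Matrix.mul_smul, Matrix.trace_smul, norm_smul, Complex.norm_real]
      refine mul_le_mul ?_ (hA.norm_trace_detEquiv_le hα hδ C j) (norm_nonneg _) (by positivity)
      have h3 : 1 ≤ (1 + meanForm A T j) * (1 + δ j) := by nlinarith [hα j, hδ j]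
      rw [norm_div, Real.norm_eq_abs, Real.norm_of_nonneg (by linarith)]
      exact (div_le_self (abs_nonneg _) h3).trans (hA.abs_meanForm_sub_le hfix j)
    · rw [Finset.sum_const, Finset.card_univ, nsmul_eq_mul]
      have := hA.card_col_mul_le (c := 480 * B ^ 32 * ‖C‖) (by positivity)
      calc _ = (Fintype.card J : ℝ) * (480 * B ^ 32 * ‖C‖ * β ^ 3) := by ring
        _ ≤ _ := this
        _ = _ := by ring
  have h3 : 60 * B ^ 25 * β * ‖C‖ ≤ 60 * B ^ 33 * β * ‖C‖ := by
    have := hA.pow_mul_le (p := 25) (q := 33) (by norm_num) (show (0 : ℝ) ≤ 60 by norm_num)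
    gcongr
  calc _ ≤ _ := norm_sub_le_norm_sub_add_norm_sub _ (C * detEquiv A T (meanForm A T)).trace _
    _ ≤ 60 * B ^ 33 * β * ‖C‖ + 480 * B ^ 33 * β * ‖C‖ := add_le_add (h1.trans h3) h2
    _ = _ := by ring

include hA hfix in
theorem norm_gMean_traceForm_sub_le {P R : Family m d} (hP : ∀ j, ‖P j‖ ≤ β)
    (hR : ∀ j, ‖R j‖ ≤ β) (i : J) :
    ‖gMean (fun x => ((P i)ᴴ * resolv A T x * R i).trace) -
      ((P i)ᴴ * detEquiv A T δ * R i).trace‖ ≤ 540 * B ^ 33 * β ^ 3 := by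
  have hB := hA.B_pos
  have hβ := hA.pos
  simp only [trace_conjTranspose_mul_mul]
  refine (hA.norm_gMean_trace_mul_resolv_sub_le hfix _).trans ?_
  calc _ ≤ 540 * B ^ 33 * β * β ^ 2 := by
        gcongr
        exact norm_mul_conjTranspose_le (hP i) (hR i)
    _ = _ := by ring

include hA in
theorem norm_traceForm_detEquiv_le {δ : J → ℝ} (hδ : ∀ j, 0 ≤ δ j) {P R : Family m d}
    (hP : ∀ j, ‖P j‖ ≤ β) (hR : ∀ j, ‖R j‖ ≤ β) (i : J) :
    ‖((P i)ᴴ * detEquiv A T δ * R i).trace‖ ≤ B ^ 2 := by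
  have hB := hA.B_pos
  rw [trace_conjTranspose_mul_mul]
  refine (norm_trace_mul_le_card _ _).trans ?_
  calc _ ≤ Fintype.card m * (β ^ 2 * B) := by
        gcongr
        · exact norm_mul_conjTranspose_le (hP i) (hR i)
        · exact hA.norm_detEquiv_le hδ
    _ = Fintype.card m * β ^ 2 * B := by ring
    _ ≤ B * B := by gcongr; exact hA.card_row
    _ = _ := by ring

theorem _root_.norm_div_one_add_sub_le {t t' : ℂ} {a b e e' K : ℝ} (ha : 0 ≤ a) (hb : 0 ≤ b)
    (ht : ‖t - t'‖ ≤ e) (hab : |a - b| ≤ e') (hK : ‖t'‖ ≤ K) :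
    ‖t / (1 + a) - t' / (1 + b)‖ ≤ e + K * e' := by
  have n1 : ∀ {c : ℝ}, 0 ≤ c → (1 : ℂ) + c ≠ 0 ∧ 1 ≤ ‖(1 : ℂ) + c‖ := by
    intro c hc
    have h1 : ‖(1 : ℂ) + c‖ = 1 + c := by
      rw [← Complex.ofReal_one, ← Complex.ofReal_add, Complex.norm_real, Real.norm_of_nonneg]
      linarith
    refine ⟨fun h => ?_, by linarith⟩
    rw [h, norm_zero] at h1
    linarith
  obtain ⟨a0, a1⟩ := n1 ha
  obtain ⟨b0, b1⟩ := n1 hb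
  have h1 : t / (1 + a) - t' / (1 + b) =
      (t - t') / (1 + a) + t' * ((b - a : ℝ) : ℂ) / ((1 + a) * (1 + b)) := by
    push_cast
    field_simp
    ring
  rw [h1]
  refine (norm_add_le _ _).trans (add_le_add ?_ ?_)
  · rw [norm_div]
    exact (div_le_self (norm_nonneg _) a1).trans ht
  · rw [norm_div, norm_mul, norm_mul, Complex.norm_real, Real.norm_eq_abs, abs_sub_comm]
    refine (div_le_self (by positivity) (by nlinarith)).trans ?_
    exact mul_le_mul hK hab (abs_nonneg _) ((norm_nonneg _).trans hK)

include hA hfix in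
theorem norm_gMean_form_left_sub_det_le {R : Family m d} (hR : ∀ j, ‖R j‖ ≤ β) (i : J) :
    ‖gMean (fun x => ((cols A x)ᴴ * resolv A T x * cols R x) i i) -
      ((A i)ᴴ * detEquiv A T δ * R i).trace / (1 + δ i)‖ ≤ 1080 * B ^ 33 * β ^ 3 := by
  have hB := hA.B_pos
  have hβ := hA.pos
  have hδ := fun j => (hfix j).1
  have h1 := hA.norm_gMean_form_left_sub_le hR i
  have h2 := norm_div_one_add_sub_le (hA.meanForm_nonneg i) (hδ i)
    (hA.norm_gMean_traceForm_sub_le hfix hA.norm_le hR i) (hA.abs_meanForm_sub_le hfix i)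
    (hA.norm_traceForm_detEquiv_le hδ hA.norm_le hR i)
  have h3 : 60 * B ^ 7 * β ^ 3 ≤ 60 * B ^ 33 * β ^ 3 := by
    have := hA.pow_mul_le (p := 7) (q := 33) (by norm_num) (show (0 : ℝ) ≤ 60 by norm_num)
    gcongr
  have h4 : 480 * B ^ 31 * β ^ 3 ≤ 480 * B ^ 33 * β ^ 3 := by
    have := hA.pow_mul_le (p := 31) (q := 33) (by norm_num) (show (0 : ℝ) ≤ 480 by norm_num)
    gcongr
  refine (norm_sub_le_norm_sub_add_norm_sub _ _ _).trans ((add_le_add h1 h2).trans ?_)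
  calc _ = 60 * B ^ 7 * β ^ 3 + 540 * B ^ 33 * β ^ 3 + 480 * B ^ 31 * β ^ 3 := by ring
    _ ≤ 60 * B ^ 33 * β ^ 3 + 540 * B ^ 33 * β ^ 3 + 480 * B ^ 33 * β ^ 3 := by linarith
    _ = _ := by ring

theorem _root_.gMean_star (f : (∀ j, Fin (d j) → ℂ) → ℂ) :
    gMean (fun x => star (f x)) = star (gMean f) :=
  integral_conj

include hA hfix in
-- The conjugate of the case with A on the left, since Q and Θ are Hermitian and δ is real.
theorem norm_gMean_form_right_sub_det_le {P : Family m d} (hP : ∀ j, ‖P j‖ ≤ β) (i : J) :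
    ‖gMean (fun x => ((cols P x)ᴴ * resolv A T x * cols A x) i i) -
      ((P i)ᴴ * detEquiv A T δ * A i).trace / (1 + δ i)‖ ≤ 1080 * B ^ 33 * β ^ 3 := by
  have hδ := fun j => (hfix j).1
  have h := hA.norm_gMean_form_left_sub_det_le hfix hP i
  rw [← norm_star, star_sub, ← gMean_star] at h
  have e1 : ∀ x, star (((cols A x)ᴴ * resolv A T x * cols P x) i i) =
      ((cols P x)ᴴ * resolv A T x * cols A x) i i := by
    intro x
    rw [← Matrix.conjTranspose_apply]
    simp only [Matrix.conjTranspose_mul, Matrix.conjTranspose_conjTranspose,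
      (hA.resolv_posDef x).isHermitian.eq, Matrix.mul_assoc]
  have e2 : star (((A i)ᴴ * detEquiv A T δ * P i).trace / (1 + (δ i : ℂ))) =
      ((P i)ᴴ * detEquiv A T δ * A i).trace / (1 + δ i) := by
    have e3 : star (1 + (δ i : ℂ)) = 1 + δ i := by
      rw [star_add, star_one]
      exact congrArg _ (Complex.conj_ofReal _)
    rw [star_div₀, ← Matrix.trace_conjTranspose, e3]
    simp only [Matrix.conjTranspose_mul, Matrix.conjTranspose_conjTranspose,
      detEquiv_conjTranspose hA.inv_pos hA.lower hδ, Matrix.mul_assoc]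
  simpa only [e1, e2] using h

end Bounded

end FirstOrder

/-! ### Second-order deterministic equivalents -/

section SecondOrder

variable {J : Type*} [Fintype J] [DecidableEq J] {d : J → ℕ}
variable {m n q : Type*} [Fintype m] [DecidableEq m] [Fintype n] [DecidableEq n]
  [Fintype q] [DecidableEq q]

theorem norm_mul_sub_mul_le {a a' b b' : ℂ} {K L e e' : ℝ} (ha : ‖a‖ ≤ K) (hb : ‖b - b'‖ ≤ e)
    (haa : ‖a - a'‖ ≤ e') (hL : ‖b'‖ ≤ L) : ‖a * b - a' * b'‖ ≤ K * e + e' * L := by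
  have h : a * b - a' * b' = a * (b - b') + (a - a') * b' := by ring
  rw [h]
  refine (norm_add_le _ _).trans ?_
  rw [norm_mul, norm_mul]
  have h1 := (norm_nonneg _).trans ha
  have h2 := (norm_nonneg _).trans haa
  gcongr

theorem norm_div_one_add_le {t : ℂ} {a K : ℝ} (ha : 0 ≤ a) (ht : ‖t‖ ≤ K) :
    ‖t / (1 + a)‖ ≤ K := by
  have h1 : ‖(1 : ℂ) + a‖ = 1 + a := by
    rw [← Complex.ofReal_one, ← Complex.ofReal_add, Complex.norm_real, Real.norm_of_nonneg]
    linarith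
  rw [norm_div, h1]
  exact (div_le_self (norm_nonneg _) (by linarith)).trans ht

/-- The mean of `Tr C Q D Q'`. -/
noncomputable def pairMean (A : Family m d) (T : Matrix m m ℂ) (A' : Family n d)
    (T' : Matrix n n ℂ) (C : Matrix n m ℂ) (D : Matrix m n ℂ) : ℂ :=
  gMean fun x => (C * resolv A T x * D * resolv A' T' x).trace

/-- The expression approximating the mean of a diagonal entry of `Y'ᴴ Q' C Q Y` in terms of a
functional `u` approximating `D ↦ 𝔼 Tr C Q D Q'`. -/
noncomputable def formExpr (A : Family m d) (T : Matrix m m ℂ) (A' : Family n d)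
    (T' : Matrix n n ℂ) (δ δ' : J → ℝ) (u : Matrix m n ℂ → ℂ) (P : Family n d) (R : Family m d)
    (i : J) : ℂ :=
  u (R i * (P i)ᴴ) - ((P i)ᴴ * detEquiv A' T' δ' * A' i).trace *
    ((u (R i * (A' i)ᴴ) - u (A i * (A' i)ᴴ) *
      (((A i)ᴴ * detEquiv A T δ * R i).trace / (1 + δ i))) / (1 + δ' i)) -
    u (A i * (P i)ᴴ) * (((A i)ᴴ * detEquiv A T δ * R i).trace / (1 + δ i))

theorem trace_conjTranspose_mul_three (P : Matrix n q ℂ) (R : Matrix m q ℂ) (Q' : Matrix n n ℂ)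
    (C : Matrix n m ℂ) (Q : Matrix m m ℂ) :
    (Pᴴ * (Q' * C * Q) * R).trace = (C * Q * (R * Pᴴ) * Q').trace := by
  rw [Matrix.trace_mul_comm (C * Q * (R * Pᴴ)), trace_conjTranspose_mul_mul, Matrix.trace_mul_comm]
  simp only [Matrix.mul_assoc]

namespace Bounded

variable {B β : ℝ} {A : Family m d} {T : Matrix m m ℂ} (hA : Bounded B β A T)
  {A' : Family n d} {T' : Matrix n n ℂ} (hA' : Bounded B β A' T')

include hA hA' in
theorem norm_pairMean_le {C : Matrix n m ℂ} (hC : ‖C‖ ≤ B) {D : Matrix m n ℂ}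
    (hD : ‖D‖ ≤ β ^ 2) : ‖pairMean A T A' T' C D‖ ≤ B ^ 4 := by
  have hB := hA.B_pos
  refine norm_gMean_le fun x => (norm_trace_mul_le_card _ _).trans ?_
  have h1 : ‖C * resolv A T x * D‖ ≤ B * B * β ^ 2 := by
    refine (Matrix.l2_opNorm_mul _ _).trans ?_
    gcongr
    refine (Matrix.l2_opNorm_mul _ _).trans ?_
    gcongr
    exact hA.norm_resolv_le x
  calc _ ≤ Fintype.card n * ((B * B * β ^ 2) * B) := by
        gcongr
        exact hA'.norm_resolv_le x
    _ = B ^ 3 * (Fintype.card n * β ^ 2) := by ring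
    _ ≤ B ^ 3 * B := by gcongr; exact hA'.card_row
    _ = _ := by ring

include hA hA' in
theorem gVar_traceForm2_le {C : Matrix n m ℂ} (hC : ‖C‖ ≤ B) {D : Matrix m n ℂ}
    (hD : ‖D‖ ≤ β ^ 2) : gVar (fun x => (C * resolv A T x * D * resolv A' T' x).trace) ≤
      (7 * B ^ 4 * β ^ 2) ^ 2 := by
  have hB := hA.B_pos
  refine (hA.gVar_trace_resolv_mul_resolv_le hA' C D).trans ?_
  calc _ ≤ 48 * B ^ 5 * β ^ 2 * ((β ^ 2) ^ 2 * (Fintype.card n * B ^ 2)) := by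
        have h := (frSq_le_card_mul C).trans
          (show _ ≤ Fintype.card n * B ^ 2 by gcongr)
        have h0 := frSq_nonneg C
        gcongr
    _ = 48 * B ^ 7 * β ^ 4 * (Fintype.card n * β ^ 2) := by ring
    _ ≤ 48 * B ^ 7 * β ^ 4 * B := by gcongr; exact hA'.card_row
    _ = 48 * (B ^ 8 * β ^ 4) := by ring
    _ ≤ 49 * (B ^ 8 * β ^ 4) := by gcongr; norm_num
    _ = _ := by ring

include hA hA' in
theorem gVar_form2_single_le {C : Matrix n m ℂ} (hC : ‖C‖ ≤ B) {P : Family n d} {R : Family m d}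
    (hP : ∀ j, ‖P j‖ ≤ β) (hR : ∀ j, ‖R j‖ ≤ β) (i : J) :
    gVar (fun x => ((cols P x)ᴴ * (resolv A' T' x * C * resolv A T x) * cols R x) i i) ≤
      (15 * B ^ 5 * β) ^ 2 := by
  have h := hA.gVar_form2_le hA' hP hR hC {i}
  simp only [Finset.sum_singleton, Finset.card_singleton, Nat.cast_one, mul_one] at h
  refine h.trans ?_
  have hB := hA.B_pos
  have h1 := hA.pow_mul_le (p := 9) (q := 10) (by norm_num) (show (0 : ℝ) ≤ 1 by norm_num)
  calc 216 * B ^ 9 * β ^ 2 = 216 * β ^ 2 * (1 * B ^ 9) := by ring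
    _ ≤ 216 * β ^ 2 * (1 * B ^ 10) := by gcongr
    _ = 216 * (B ^ 10 * β ^ 2) := by ring
    _ ≤ 225 * (B ^ 10 * β ^ 2) := by gcongr; norm_num
    _ = _ := by ring

include hA hA' in
-- Both products in the integration by parts formula pair a trace of standard deviation O(β²) with a
-- form of standard deviation O(β), so decoupling again costs O(β³).
theorem norm_gMean_form2_sub_le {C : Matrix n m ℂ} (hC : ‖C‖ ≤ B) {P : Family n d}
    {R : Family m d} (hP : ∀ j, ‖P j‖ ≤ β) (hR : ∀ j, ‖R j‖ ≤ β) (i : J) :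
    ‖gMean (fun x => ((cols P x)ᴴ * (resolv A' T' x * C * resolv A T x) * cols R x) i i) -
      (pairMean A T A' T' C (R i * (P i)ᴴ) -
        gMean (fun x => ((P i)ᴴ * resolv A' T' x * A' i).trace) *
        gMean (fun x => ((cols A' x)ᴴ * (resolv A' T' x * C * resolv A T x) * cols R x) i i) -
        pairMean A T A' T' C (A i * (P i)ᴴ) *
        gMean (fun x => ((cols A x)ᴴ * resolv A T x * cols R x) i i))‖ ≤
      165 * B ^ 9 * β ^ 3 := by
  have hB := hA.B_pos
  have hβ := hA.pos
  have h1 := norm_gMean_mul_sub_le (hA'.tame_traceForm P A' i) (hA.tame_form2 hA' A' R C i)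
    (a := 4 * B ^ 2 * β ^ 2) (b := 15 * B ^ 5 * β) (by positivity) (by positivity)
    (hA'.gVar_traceForm_le hP hA'.norm_le i) (hA.gVar_form2_single_le hA' hC hA'.norm_le hR i)
  have h2 := norm_gMean_mul_sub_le (hA.tame_trace_resolv_mul_resolv hA' C (A i * (P i)ᴴ))
    (hA.tame_form A R i) (a := 7 * B ^ 4 * β ^ 2) (b := 15 * B ^ 5 * β) (by positivity)
    (by positivity) (hA.gVar_traceForm2_le hA' hC
      (norm_mul_conjTranspose_le (hP i) (hA.norm_le i))) (hA.gVar_form_single_le hA.norm_le hR i)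
  rw [hA.gMean_form2 hA' P R C i]
  simp only [trace_conjTranspose_mul_three]
  unfold pairMean
  generalize gMean (fun x => ((P i)ᴴ * resolv A' T' x * A' i).trace *
    ((cols A' x)ᴴ * (resolv A' T' x * C * resolv A T x) * cols R x) i i) = y₁ at h1 ⊢
  generalize gMean (fun x => (C * resolv A T x * (A i * (P i)ᴴ) * resolv A' T' x).trace *
    ((cols A x)ᴴ * resolv A T x * cols R x) i i) = y₂ at h2 ⊢
  generalize gMean (fun x => ((P i)ᴴ * resolv A' T' x * A' i).trace) *
    gMean (fun x => ((cols A' x)ᴴ * (resolv A' T' x * C * resolv A T x) * cols R x) i i) = z₁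
    at h1 ⊢
  generalize gMean (fun x => (C * resolv A T x * (A i * (P i)ᴴ) * resolv A' T' x).trace) *
    gMean (fun x => ((cols A x)ᴴ * resolv A T x * cols R x) i i) = z₂ at h2 ⊢
  have h3 := hA.pow_mul_le (p := 7) (q := 9) (by norm_num) (show (0 : ℝ) ≤ 60 by norm_num)
  have h4 : ∀ w : ℂ, w - y₁ - y₂ - (w - z₁ - z₂) = -((y₁ - z₁) + (y₂ - z₂)) := fun w => by ring
  rw [h4, norm_neg]
  refine (norm_add_le _ _).trans ((add_le_add h1 h2).trans ?_)
  calc _ = 60 * B ^ 7 * β ^ 3 + 105 * B ^ 9 * β ^ 3 := by ring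
    _ ≤ 60 * B ^ 9 * β ^ 3 + 105 * B ^ 9 * β ^ 3 := by gcongr
    _ = _ := by ring

variable {δ δ' : J → ℝ} (hfix : IsFixedPoint A T δ) (hfix' : IsFixedPoint A' T' δ')

include hA hA' hfix in
theorem norm_formExpr_inner_le {C : Matrix n m ℂ} (hC : ‖C‖ ≤ B)
    {R : Family m d} (hR : ∀ j, ‖R j‖ ≤ β) (i : J) :
    ‖pairMean A T A' T' C (R i * (A' i)ᴴ) - pairMean A T A' T' C (A i * (A' i)ᴴ) *
      (((A i)ᴴ * detEquiv A T δ * R i).trace / (1 + δ i))‖ ≤ 2 * B ^ 6 := by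
  have hB := hA.B_pos
  have hδ := fun j => (hfix j).1
  have u1 := hA.norm_pairMean_le hA' hC (norm_mul_conjTranspose_le (hA'.norm_le i) (hR i))
  have u2 := hA.norm_pairMean_le hA' hC
    (norm_mul_conjTranspose_le (hA'.norm_le i) (hA.norm_le i))
  have hf := norm_div_one_add_le (hδ i) (hA.norm_traceForm_detEquiv_le hδ hA.norm_le hR i)
  have h3 := hA.pow_mul_le (p := 4) (q := 6) (by norm_num) (show (0 : ℝ) ≤ 1 by norm_num)
  refine (norm_sub_le _ _).trans ?_
  rw [norm_mul]
  calc _ ≤ B ^ 4 + B ^ 4 * B ^ 2 := by gcongr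
    _ = 1 * B ^ 4 + B ^ 6 := by ring
    _ ≤ 1 * B ^ 6 + B ^ 6 := by gcongr
    _ = _ := by ring

include hA hA' hfix hfix' in
-- For P = A' the unknown form occurs on both sides, with the nonnegative coefficient 𝔼 Tr A'_iᴴ Q'
-- A'_i, and can be solved for. The means involving one resolvent are then replaced by their
-- equivalents.
theorem norm_gMean_form2_left_sub_le {C : Matrix n m ℂ} (hC : ‖C‖ ≤ B)
    {R : Family m d} (hR : ∀ j, ‖R j‖ ≤ β) (i : J) :
    ‖gMean (fun x => ((cols A' x)ᴴ * (resolv A' T' x * C * resolv A T x) * cols R x) i i) -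
      (pairMean A T A' T' C (R i * (A' i)ᴴ) - pairMean A T A' T' C (A i * (A' i)ᴴ) *
      (((A i)ᴴ * detEquiv A T δ * R i).trace / (1 + δ i))) / (1 + δ' i)‖ ≤
      2205 * B ^ 37 * β ^ 3 := by
  have hB := hA.B_pos
  have hβ := hA.pos
  have h1 := hA.norm_gMean_form2_sub_le hA' hC hA'.norm_le hR i
  have hf := hA.norm_gMean_form_left_sub_det_le hfix hR i
  have u2 := hA.norm_pairMean_le hA' hC
    (norm_mul_conjTranspose_le (hA'.norm_le i) (hA.norm_le i))
  have hK := hA.norm_formExpr_inner_le hA' hfix hC hR i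
  rw [hA'.gMean_traceForm_eq i] at h1
  generalize gMean (fun x => ((cols A' x)ᴴ * (resolv A' T' x * C * resolv A T x) *
    cols R x) i i) = y at h1 ⊢
  generalize pairMean A T A' T' C (R i * (A' i)ᴴ) = v₁ at *
  generalize pairMean A T A' T' C (A i * (A' i)ᴴ) = v₂ at *
  generalize gMean (fun x => ((cols A x)ᴴ * resolv A T x * cols R x) i i) = f at *
  generalize ((A i)ᴴ * detEquiv A T δ * R i).trace / (1 + (δ i : ℂ)) = g at *
  rw [sub_right_comm] at h1
  have h2 := norm_sub_div_one_add_le (hA'.meanForm_nonneg i) h1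
  have h3 : ‖(v₁ - v₂ * f) - (v₁ - v₂ * g)‖ ≤ B ^ 4 * (1080 * B ^ 33 * β ^ 3) := by
    have : (v₁ - v₂ * f) - (v₁ - v₂ * g) = -(v₂ * (f - g)) := by ring
    rw [this, norm_neg, norm_mul]
    gcongr
  have h4 := norm_div_one_add_sub_le (hA'.meanForm_nonneg i) (hfix' i).1 h3
    (hA'.abs_meanForm_sub_le hfix' i) hK
  refine (norm_sub_le_norm_sub_add_norm_sub _ _ _).trans ((add_le_add h2 h4).trans ?_)
  have p1 := hA.pow_mul_le (p := 9) (q := 37) (by norm_num) (show (0 : ℝ) ≤ 165 by norm_num)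
  have p2 := hA.pow_mul_le (p := 35) (q := 37) (by norm_num) (show (0 : ℝ) ≤ 960 by norm_num)
  calc _ = 165 * B ^ 9 * β ^ 3 + 1080 * B ^ 37 * β ^ 3 + 960 * B ^ 35 * β ^ 3 := by ring
    _ ≤ 165 * B ^ 37 * β ^ 3 + 1080 * B ^ 37 * β ^ 3 + 960 * B ^ 37 * β ^ 3 := by gcongr
    _ = _ := by ring

include hA hA' hfix hfix' in
-- For general P the right side contains only the form with A' on the left, which has just been
-- determined. No further equation has to be solved.
theorem norm_gMean_form2_sub_formExpr_le {C : Matrix n m ℂ} (hC : ‖C‖ ≤ B) {P : Family n d}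
    {R : Family m d} (hP : ∀ j, ‖P j‖ ≤ β) (hR : ∀ j, ‖R j‖ ≤ β) (i : J) :
    ‖gMean (fun x => ((cols P x)ᴴ * (resolv A' T' x * C * resolv A T x) * cols R x) i i) -
      formExpr A T A' T' δ δ' (pairMean A T A' T' C) P R i‖ ≤ 4530 * B ^ 39 * β ^ 3 := by
  have hB := hA.B_pos
  have hβ := hA.pos
  have h1 := hA.norm_gMean_form2_sub_le hA' hC hP hR i
  have hf := hA.norm_gMean_form_left_sub_det_le hfix hR i
  have hl := hA.norm_gMean_form2_left_sub_le hA' hfix hfix' hC hR i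
  have hK := norm_div_one_add_le (hfix' i).1 (hA.norm_formExpr_inner_le hA' hfix hC hR i)
  have u2 := hA.norm_pairMean_le hA' hC (norm_mul_conjTranspose_le (hP i) (hA.norm_le i))
  have ht := hA'.norm_gMean_traceForm_le hP hA'.norm_le i
  have ht' := hA'.norm_gMean_traceForm_sub_le hfix' hP hA'.norm_le i
  have h2 := norm_mul_sub_mul_le ht hl ht' hK
  have h3 : ‖pairMean A T A' T' C (A i * (P i)ᴴ) *
      gMean (fun x => ((cols A x)ᴴ * resolv A T x * cols R x) i i) -
      pairMean A T A' T' C (A i * (P i)ᴴ) *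
      (((A i)ᴴ * detEquiv A T δ * R i).trace / (1 + δ i))‖ ≤ B ^ 4 * (1080 * B ^ 33 * β ^ 3) := by
    rw [← mul_sub, norm_mul]
    gcongr
  unfold formExpr
  generalize gMean (fun x => ((cols P x)ᴴ * (resolv A' T' x * C * resolv A T x) *
    cols R x) i i) = y at *
  generalize pairMean A T A' T' C (R i * (P i)ᴴ) = w at *
  generalize pairMean A T A' T' C (A i * (P i)ᴴ) *
      gMean (fun x => ((cols A x)ᴴ * resolv A T x * cols R x) i i) = y₁ at *
  generalize pairMean A T A' T' C (A i * (P i)ᴴ) *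
      (((A i)ᴴ * detEquiv A T δ * R i).trace / (1 + (δ i : ℂ))) = z₁ at *
  generalize gMean (fun x => ((P i)ᴴ * resolv A' T' x * A' i).trace) *
    gMean (fun x => ((cols A' x)ᴴ * (resolv A' T' x * C * resolv A T x) * cols R x) i i) = y₂
    at *
  generalize ((P i)ᴴ * detEquiv A' T' δ' * A' i).trace * ((pairMean A T A' T' C (R i * (A' i)ᴴ) -
    pairMean A T A' T' C (A i * (A' i)ᴴ) *
      (((A i)ᴴ * detEquiv A T δ * R i).trace / (1 + (δ i : ℂ)))) / (1 + (δ' i : ℂ))) = z₂ at *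
  have e : y - (w - z₂ - z₁) = (y - (w - y₂ - y₁)) - ((y₂ - z₂) + (y₁ - z₁)) := by ring
  rw [e]
  refine (norm_sub_le _ _).trans ((add_le_add h1 ((norm_add_le _ _).trans
    (add_le_add h2 h3))).trans ?_)
  have p1 := hA.pow_mul_le (p := 9) (q := 39) (by norm_num) (show (0 : ℝ) ≤ 165 by norm_num)
  have p2 := hA.pow_mul_le (p := 37) (q := 39) (by norm_num) (show (0 : ℝ) ≤ 1080 by norm_num)
  calc _ = 165 * B ^ 9 * β ^ 3 + (2205 * B ^ 39 * β ^ 3 + 1080 * B ^ 39 * β ^ 3 +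
        1080 * B ^ 37 * β ^ 3) := by ring
    _ ≤ 165 * B ^ 39 * β ^ 3 + (2205 * B ^ 39 * β ^ 3 + 1080 * B ^ 39 * β ^ 3 +
        1080 * B ^ 39 * β ^ 3) := by gcongr
    _ = _ := by ring

include hA hA' in
-- Q is expanded around Θ with Θ on its right, so that C Q stays intact and D enters only through
-- the left family Dᴴ Θ A_j.
theorem pairMean_eq {δ : J → ℝ} (hδ : ∀ j, 0 ≤ δ j) (C : Matrix n m ℂ) (D : Matrix m n ℂ) :
    pairMean A T A' T' C D = gMean (fun x => (C * detEquiv A T δ * D * resolv A' T' x).trace) +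
      ∑ j, (pairMean A T A' T' C (A j * (Dᴴ * detEquiv A T δ * A j)ᴴ) / (1 + (δ j : ℂ)) -
        gMean (fun x => ((cols (fun j => Dᴴ * detEquiv A T δ * A j) x)ᴴ *
          (resolv A' T' x * C * resolv A T x) * cols A x) j j)) := by
  have hΘ := detEquiv_conjTranspose (A := A) hA.inv_pos hA.lower hδ
  have h0 : ∀ x, (C * resolv A T x * D * resolv A' T' x).trace =
      (C * detEquiv A T δ * D * resolv A' T' x).trace +
      ∑ j, ((1 + (δ j : ℂ))⁻¹ *
        (C * resolv A T x * (A j * (Dᴴ * detEquiv A T δ * A j)ᴴ) * resolv A' T' x).trace -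
        ((cols (fun j => Dᴴ * detEquiv A T δ * A j) x)ᴴ *
          (resolv A' T' x * C * resolv A T x) * cols A x) j j) := by
    intro x
    rw [← sub_eq_iff_eq_add', ← Matrix.trace_sub, ← Matrix.sub_mul, ← Matrix.sub_mul,
      ← Matrix.mul_sub, hA.resolv_sub_detEquiv hδ x, Matrix.mul_sub (resolv A T x), Matrix.sub_mul,
      Matrix.mul_sub, Matrix.sub_mul, Matrix.sub_mul, Matrix.trace_sub, Finset.sum_sub_distrib]
    congr 1
    · rw [Matrix.mul_sum, Matrix.sum_mul, Matrix.mul_sum, Matrix.sum_mul, Matrix.sum_mul,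
        Matrix.trace_sum]
      refine Finset.sum_congr rfl fun j _ => ?_
      rw [Matrix.mul_smul, Matrix.smul_mul, Matrix.mul_smul, Matrix.smul_mul, Matrix.smul_mul,
        Matrix.trace_smul, smul_eq_mul]
      congr 1
      · push_cast; rfl
      · simp only [Matrix.conjTranspose_mul, Matrix.conjTranspose_conjTranspose, hΘ,
          Matrix.mul_assoc]
    · change _ = Matrix.trace _
      rw [cols_mul_left, trace_conjTranspose_mul_three]
      simp only [Matrix.conjTranspose_mul, Matrix.conjTranspose_conjTranspose, hΘ,
          Matrix.mul_assoc]
  have t0 := hA'.tame_trace_mul_resolv (C * detEquiv A T δ * D)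
  have t1 : ∀ j, Tame fun x => (1 + (δ j : ℂ))⁻¹ *
      (C * resolv A T x * (A j * (Dᴴ * detEquiv A T δ * A j)ᴴ) * resolv A' T' x).trace := fun j =>
    (Tame.const _).mul (hA.tame_trace_resolv_mul_resolv hA' C _)
  have t2 := fun j => hA.tame_form2 hA' (fun j => Dᴴ * detEquiv A T δ * A j) A C j
  conv_lhs => unfold pairMean
  simp only [h0]
  rw [gMean_add t0 (Tame.sum _ fun j _ => (t1 j).sub (t2 j)),
    gMean_sum _ fun j _ => (t1 j).sub (t2 j)]
  congr 1
  refine Finset.sum_congr rfl fun j _ => ?_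
  rw [gMean_sub (t1 j) (t2 j), gMean_const_mul, div_eq_inv_mul]
  rfl

/-- The affine expression `Tr C Θ D Θ' + ∑ j, y_j Tr A_jᴴ Θ D Θ' A'_j`. -/
noncomputable def _root_.pairExpr (A : Family m d) (T : Matrix m m ℂ) (A' : Family n d)
    (T' : Matrix n n ℂ) (δ δ' : J → ℝ) (C : Matrix n m ℂ) (y : J → ℂ) (D : Matrix m n ℂ) : ℂ :=
  (C * detEquiv A T δ * D * detEquiv A' T' δ').trace +
    ∑ j, y j * ((A j)ᴴ * detEquiv A T δ * D * detEquiv A' T' δ' * A' j).trace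

theorem _root_.pairExpr_smul (C : Matrix n m ℂ) (y : J → ℂ) (s : ℂ) (D : Matrix m n ℂ) :
    pairExpr A T A' T' δ δ' C y (s • D) = s * pairExpr A T A' T' δ δ' C y D := by
  unfold pairExpr
  simp only [Matrix.mul_smul, Matrix.smul_mul, Matrix.trace_smul, smul_eq_mul, mul_add,
    Finset.mul_sum]
  congr 1
  exact Finset.sum_congr rfl fun j _ => by ring

theorem _root_.pairMean_smul (C : Matrix n m ℂ) (s : ℂ) (D : Matrix m n ℂ) :
    pairMean A T A' T' C (s • D) = s * pairMean A T A' T' C D := by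
  unfold pairMean
  simp only [Matrix.mul_smul, Matrix.smul_mul, Matrix.trace_smul, smul_eq_mul]
  exact gMean_const_mul _ _

include hA hA' hfix hfix' in
/-- The self-consistent equation for `D ↦ 𝔼 Tr C Q D Q'`. -/
theorem norm_pairMean_sub_pairExpr_self_le {C : Matrix n m ℂ} (hC : ‖C‖ ≤ B) (D : Matrix m n ℂ) :
    ‖pairMean A T A' T' C D - pairExpr A T A' T' δ δ' C
      (fun j => pairMean A T A' T' C (A j * (A' j)ᴴ) / ((1 + δ j) * (1 + δ' j))) D‖ ≤
      5070 * B ^ 121 * β * ‖D‖ := by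
  have hB := hA.B_pos
  have hβ := hA.pos
  have hδ := fun j => (hfix j).1
  have hδ' := fun j => (hfix' j).1
  refine norm_le_mul_of_homogeneous (f := fun D => pairMean A T A' T' C D -
    pairExpr A T A' T' δ δ' C (fun j => pairMean A T A' T' C (A j * (A' j)ᴴ) /
      ((1 + δ j) * (1 + δ' j))) D) (fun s D => ?_) (fun D hD => ?_) D
  · rw [pairMean_smul, pairExpr_smul, mul_sub]
  have hP : ∀ j, ‖Dᴴ * detEquiv A T δ * A j‖ ≤ B * β := fun j =>
    hA.norm_mul_detEquiv_mul_le hδ (by rwa [Matrix.l2_opNorm_conjTranspose]) j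
  have hΘ := detEquiv_conjTranspose (A := A) hA.inv_pos hA.lower hδ
  have h1 := hA'.norm_gMean_trace_mul_resolv_sub_le hfix' (C * detEquiv A T δ * D)
  have h2 := fun j => hA.enlarge.norm_gMean_form2_sub_formExpr_le hA'.enlarge hfix hfix'
    (C := C) (hC.trans (le_self_pow₀ hA.one_le (by norm_num))) hP hA.enlarge.norm_le j
  -- For R = A the fixed-point equation Tr A_jᴴ Θ A_j = δ_j turns both brackets into factors 1 -
  -- δ_j/(1+δ_j) = 1/(1+δ_j). The first term then cancels the matching one in `pairMean_eq`, leaving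
  -- only values of the functional at A_j A'_jᴴ.
  have e : ∀ j, formExpr A T A' T' δ δ' (pairMean A T A' T' C)
      (fun j => Dᴴ * detEquiv A T δ * A j) A j =
      pairMean A T A' T' C (A j * (Dᴴ * detEquiv A T δ * A j)ᴴ) / (1 + (δ j : ℂ)) -
      pairMean A T A' T' C (A j * (A' j)ᴴ) / ((1 + δ j) * (1 + δ' j)) *
        ((A j)ᴴ * detEquiv A T δ * D * detEquiv A' T' δ' * A' j).trace := by
    intro j
    have n1 : ∀ {c : ℝ}, 0 ≤ c → (1 : ℂ) + c ≠ 0 := by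
      intro c hc
      have : (1 : ℝ) + c ≠ 0 := by positivity
      exact_mod_cast this
    have d1 := n1 (hδ j)
    have d2 := n1 (hδ' j)
    have e1 : (Dᴴ * detEquiv A T δ * A j)ᴴ = (A j)ᴴ * detEquiv A T δ * D := by
      simp only [Matrix.conjTranspose_mul, Matrix.conjTranspose_conjTranspose, hΘ,
        Matrix.mul_assoc]
    unfold formExpr
    rw [fixMap_eq hA.inv_pos hA.lower hδ, ← (hfix j).2, e1]
    generalize pairMean A T A' T' C (A j * ((A j)ᴴ * detEquiv A T δ * D)) = a
    generalize pairMean A T A' T' C (A j * (A' j)ᴴ) = b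
    generalize ((A j)ᴴ * detEquiv A T δ * D * detEquiv A' T' δ' * A' j).trace = c
    field_simp
    ring
  have key : pairMean A T A' T' C D - pairExpr A T A' T' δ δ' C
      (fun j => pairMean A T A' T' C (A j * (A' j)ᴴ) / ((1 + δ j) * (1 + δ' j))) D =
      (gMean (fun x => (C * detEquiv A T δ * D * resolv A' T' x).trace) -
        (C * detEquiv A T δ * D * detEquiv A' T' δ').trace) -
      ∑ j, (gMean (fun x => ((cols (fun j => Dᴴ * detEquiv A T δ * A j) x)ᴴ *
          (resolv A' T' x * C * resolv A T x) * cols A x) j j) -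
        formExpr A T A' T' δ δ' (pairMean A T A' T' C)
          (fun j => Dᴴ * detEquiv A T δ * A j) A j) := by
    rw [hA.pairMean_eq hA' hδ C D, pairExpr]
    simp only [e, Finset.sum_sub_distrib]
    ring
  rw [key]
  have hn : ‖C * detEquiv A T δ * D‖ ≤ B * B * 1 := by
    refine (Matrix.l2_opNorm_mul _ _).trans ?_
    gcongr
    refine (Matrix.l2_opNorm_mul _ _).trans ?_
    gcongr
    exact hA.norm_detEquiv_le hδ
  have h3 : (Fintype.card J : ℝ) * (4530 * (B ^ 3) ^ 39 * (B * β) ^ 3) ≤ 4530 * B ^ 121 * β := by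
    have := hA.card_col_mul_le (c := 4530 * B ^ 120) (by positivity)
    calc _ = (Fintype.card J : ℝ) * (4530 * B ^ 120 * β ^ 3) := by ring
      _ ≤ _ := this
      _ = _ := by ring
  have h4 : ‖∑ j, (gMean (fun x => ((cols (fun j => Dᴴ * detEquiv A T δ * A j) x)ᴴ *
          (resolv A' T' x * C * resolv A T x) * cols A x) j j) -
        formExpr A T A' T' δ δ' (pairMean A T A' T' C)
          (fun j => Dᴴ * detEquiv A T δ * A j) A j)‖ ≤ 4530 * B ^ 121 * β := by
    refine (norm_sum_le _ _).trans ((Finset.sum_le_sum fun j _ => h2 j).trans ?_)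
    rw [Finset.sum_const, Finset.card_univ, nsmul_eq_mul]
    exact h3
  have p1 := hA.pow_mul_le (p := 35) (q := 121) (by norm_num) (show (0 : ℝ) ≤ 540 by norm_num)
  refine (norm_sub_le _ _).trans ((add_le_add h1 h4).trans ?_)
  calc _ ≤ 540 * B ^ 33 * β * (B * B * 1) + 4530 * B ^ 121 * β := by gcongr
    _ = 540 * B ^ 35 * β + 4530 * B ^ 121 * β := by ring
    _ ≤ 540 * B ^ 121 * β + 4530 * B ^ 121 * β := by gcongr
    _ = _ := by ring

include hA hA' hfix hfix' in
-- Up to complex conjugation these are the coefficients of the fixed-point difference formula, with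
-- the two resolvents taken from different families. The same row sum estimate applies.
theorem sum_norm_gram_le_contr (i : J) :
    ∑ j, ‖((A j)ᴴ * detEquiv A T δ * (A i * (A' i)ᴴ) * detEquiv A' T' δ' * A' j).trace‖ /
      (weight δ δ' j * weight δ δ' j) * weight δ δ' j ≤ contr (B ^ 2) * weight δ δ' i := by
  have hδ := fun j => (hfix j).1
  have hδ' := fun j => (hfix' j).1
  have h := sum_norm_trace_div_le_contr hA.inv_pos hA.lower hA'.lower hδ hfix'
    (hA'.fixedPoint_le hfix') i (by rw [← (hfix i).2]; linarith)
  refine le_trans (le_of_eq (Finset.sum_congr rfl fun j _ => ?_)) h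
  congr 2
  have e : ((A j)ᴴ * detEquiv A T δ * (A i * (A' i)ᴴ) * detEquiv A' T' δ' * A' j).trace =
      star ((A i)ᴴ * detEquiv A T δ * A j * ((A' j)ᴴ * detEquiv A' T' δ' * A' i)).trace := by
    rw [← Matrix.trace_conjTranspose]
    have h1 : (A j)ᴴ * detEquiv A T δ * (A i * (A' i)ᴴ) * detEquiv A' T' δ' * A' j =
        ((A j)ᴴ * detEquiv A T δ * A i) * ((A' i)ᴴ * detEquiv A' T' δ' * A' j) := by
      simp only [Matrix.mul_assoc]
    rw [h1, Matrix.trace_mul_comm]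
    simp only [Matrix.conjTranspose_mul, Matrix.conjTranspose_conjTranspose,
      detEquiv_conjTranspose hA.inv_pos hA.lower hδ,
      detEquiv_conjTranspose hA'.inv_pos hA'.lower hδ', Matrix.mul_assoc]
  rw [e, norm_star]

include hA hA' in
theorem norm_trace_gram_le {δ δ' : J → ℝ} (hδ : ∀ j, 0 ≤ δ j) (hδ' : ∀ j, 0 ≤ δ' j)
    (D : Matrix m n ℂ) (j : J) :
    ‖((A j)ᴴ * detEquiv A T δ * D * detEquiv A' T' δ' * A' j).trace‖ ≤ B ^ 3 * ‖D‖ := by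
  have hB := hA.B_pos
  have e : (A j)ᴴ * detEquiv A T δ * D * detEquiv A' T' δ' * A' j =
      (A j)ᴴ * (detEquiv A T δ * D * detEquiv A' T' δ') * A' j := by
    simp only [Matrix.mul_assoc]
  rw [e, trace_conjTranspose_mul_mul]
  refine (norm_trace_mul_le_card _ _).trans ?_
  calc _ ≤ Fintype.card n * (β ^ 2 * (B * ‖D‖ * B)) := by
        gcongr
        · exact norm_mul_conjTranspose_le (hA.norm_le j) (hA'.norm_le j)
        · refine (Matrix.l2_opNorm_mul _ _).trans ?_
          gcongr
          · refine (Matrix.l2_opNorm_mul _ _).trans ?_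
            gcongr
            exact hA.norm_detEquiv_le hδ
          · exact hA'.norm_detEquiv_le hδ'
    _ = B ^ 2 * ‖D‖ * (Fintype.card n * β ^ 2) := by ring
    _ ≤ B ^ 2 * ‖D‖ * B := by gcongr; exact hA'.card_row
    _ = _ := by ring

theorem _root_.pairExpr_sub (C : Matrix n m ℂ) (y y' : J → ℂ) (D : Matrix m n ℂ) :
    pairExpr A T A' T' δ δ' C y D - pairExpr A T A' T' δ δ' C y' D =
      ∑ j, (y j - y' j) * ((A j)ᴴ * detEquiv A T δ * D * detEquiv A' T' δ' * A' j).trace := by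
  simp only [pairExpr, add_sub_add_left_eq_sub, ← Finset.sum_sub_distrib, sub_mul]

variable {C : Matrix n m ℂ} (hC : ‖C‖ ≤ B) {y : J → ℂ}
  (hy : ∀ i, y i * ((1 + δ i) * (1 + δ' i)) = pairExpr A T A' T' δ δ' C y (A i * (A' i)ᴴ))

include hA hA' hfix hfix' hC hy in
-- The hypothesis `hy` is the exact form of the closed linear system that the means satisfy
-- approximately when D = A_i A'_iᴴ. The difference obeys the system up to ε, and the weighted
-- contraction bounds it.
theorem norm_pairMean_gram_sub_le (i : J) :
    ‖pairMean A T A' T' C (A i * (A' i)ᴴ) - y i * ((1 + δ i) * (1 + δ' i))‖ ≤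
      40560 * B ^ 125 * β ^ 3 := by
  have hB := hA.B_pos
  have hβ := hA.pos
  have hδ := fun j => (hfix j).1
  have hδ' := fun j => (hfix' j).1
  have hw : ∀ j, (1 + (δ j : ℂ)) * (1 + δ' j) = ((weight δ δ' j * weight δ δ' j : ℝ) : ℂ) := by
    intro j
    rw [weight_sq hδ hδ']
    push_cast
    ring
  have hwpos : ∀ j, 0 < weight δ δ' j * weight δ δ' j := by
    intro j
    have := one_le_weight hδ hδ' j
    positivity
  set ε : ℝ := 5070 * B ^ 121 * β ^ 3 with hε
  have hc := norm_le_of_weighted_contraction (ε := ε)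
    (e := fun i => pairMean A T A' T' C (A i * (A' i)ᴴ) - y i * ((1 + δ i) * (1 + δ' i)))
    (a := fun i j => ‖((A j)ᴴ * detEquiv A T δ * (A i * (A' i)ᴴ) * detEquiv A' T' δ' *
      A' j).trace‖ / (weight δ δ' j * weight δ δ' j))
    (fun i j => div_nonneg (norm_nonneg _) (mul_self_nonneg _)) (one_le_weight hδ hδ')
    (contr_lt_one (sq_nonneg B)) (hA.sum_norm_gram_le_contr hA' hfix hfix') (fun i => ?_) i
  · refine hc.trans ((hA.weight_mul_div_le hδ (hA.fixedPoint_le hfix) (hA'.fixedPoint_le hfix')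
      (by positivity) i).trans (le_of_eq ?_))
    rw [hε]
    ring
  · have h1 := hA.norm_pairMean_sub_pairExpr_self_le hA' hfix hfix' hC (A i * (A' i)ᴴ)
    have h2 := pairExpr_sub (A := A) (T := T) (A' := A') (T' := T') (δ := δ) (δ' := δ') C
      (fun j => pairMean A T A' T' C (A j * (A' j)ᴴ) / ((1 + δ j) * (1 + δ' j))) y
      (A i * (A' i)ᴴ)
    have h3 := norm_sub_le_norm_sub_add_norm_sub (pairMean A T A' T' C (A i * (A' i)ᴴ))
      (pairExpr A T A' T' δ δ' C (fun j => pairMean A T A' T' C (A j * (A' j)ᴴ) /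
        ((1 + δ j) * (1 + δ' j))) (A i * (A' i)ᴴ)) (pairExpr A T A' T' δ δ' C y (A i * (A' i)ᴴ))
    rw [h2] at h3
    rw [hy i, add_comm]
    refine h3.trans (add_le_add (h1.trans ?_) ((norm_sum_le _ _).trans
      (Finset.sum_le_sum fun j _ => ?_)))
    · calc _ ≤ 5070 * B ^ 121 * β * β ^ 2 := by
            gcongr
            exact norm_mul_conjTranspose_le (hA'.norm_le i) (hA.norm_le i)
        _ = _ := by rw [hε]; ring
    · rw [norm_mul, hw j]
      have hne : ((weight δ δ' j * weight δ δ' j : ℝ) : ℂ) ≠ 0 := by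
        exact_mod_cast (hwpos j).ne'
      have e : ∀ v : ℂ, v / ((weight δ δ' j * weight δ δ' j : ℝ) : ℂ) - y j =
          (v - y j * ((weight δ δ' j * weight δ δ' j : ℝ) : ℂ)) /
            ((weight δ δ' j * weight δ δ' j : ℝ) : ℂ) := fun v => by
        rw [sub_div, mul_div_cancel_right₀ _ hne]
      rw [e, norm_div, Complex.norm_real, Real.norm_of_nonneg (hwpos j).le]
      exact le_of_eq (by ring)

include hA hA' hfix hfix' hC hy in
/-- `𝔼 Tr C Q D Q'` is close to its deterministic equivalent. -/
theorem norm_pairMean_sub_pairExpr_le (D : Matrix m n ℂ) :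
    ‖pairMean A T A' T' C D - pairExpr A T A' T' δ δ' C y D‖ ≤ 45630 * B ^ 129 * β * ‖D‖ := by
  have hB := hA.B_pos
  have hβ := hA.pos
  have hδ := fun j => (hfix j).1
  have hδ' := fun j => (hfix' j).1
  have h1 := hA.norm_pairMean_sub_pairExpr_self_le hA' hfix hfix' hC D
  have h2 := pairExpr_sub (A := A) (T := T) (A' := A') (T' := T') (δ := δ) (δ' := δ') C
      (fun j => pairMean A T A' T' C (A j * (A' j)ᴴ) / ((1 + δ j) * (1 + δ' j))) y D
  have h3 := norm_sub_le_norm_sub_add_norm_sub (pairMean A T A' T' C D)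
    (pairExpr A T A' T' δ δ' C (fun j => pairMean A T A' T' C (A j * (A' j)ᴴ) /
      ((1 + δ j) * (1 + δ' j))) D) (pairExpr A T A' T' δ δ' C y D)
  rw [h2] at h3
  have h4 : ‖∑ j, (pairMean A T A' T' C (A j * (A' j)ᴴ) / ((1 + δ j) * (1 + δ' j)) - y j) *
      ((A j)ᴴ * detEquiv A T δ * D * detEquiv A' T' δ' * A' j).trace‖ ≤
      40560 * B ^ 129 * β * ‖D‖ := by
    refine (norm_sum_le _ _).trans ((Finset.sum_le_sum fun j _ => ?_).trans (b := ∑ _j : J,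
      40560 * B ^ 125 * β ^ 3 * (B ^ 3 * ‖D‖)) ?_)
    · rw [norm_mul]
      refine mul_le_mul ?_ (hA.norm_trace_gram_le hA' hδ hδ' D j) (norm_nonneg _) (by positivity)
      have n1 : ∀ {c : ℝ}, 0 ≤ c → (1 : ℂ) + c ≠ 0 := by
        intro c hc
        have : (1 : ℝ) + c ≠ 0 := by positivity
        exact_mod_cast this
      have e : ∀ v : ℂ, v / ((1 + δ j) * (1 + δ' j)) - y j =
          (v - y j * ((1 + δ j) * (1 + δ' j))) / (1 + δ j) / (1 + δ' j) := fun v => by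
        have := n1 (hδ j)
        have := n1 (hδ' j)
        field_simp
      rw [e]
      exact norm_div_one_add_le (hδ' j) (norm_div_one_add_le (hδ j)
        (hA.norm_pairMean_gram_sub_le hA' hfix hfix' hC hy j))
    · rw [Finset.sum_const, Finset.card_univ, nsmul_eq_mul]
      have := hA.card_col_mul_le (c := 40560 * B ^ 128 * ‖D‖) (by positivity)
      calc _ = (Fintype.card J : ℝ) * (40560 * B ^ 128 * ‖D‖ * β ^ 3) := by ring
        _ ≤ _ := this
        _ = _ := by ring
  have p1 := hA.pow_mul_le (p := 121) (q := 129) (by norm_num) (show (0 : ℝ) ≤ 5070 by norm_num)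
  refine h3.trans ((add_le_add h1 h4).trans ?_)
  calc _ ≤ 5070 * B ^ 129 * β * ‖D‖ + 40560 * B ^ 129 * β * ‖D‖ := by gcongr
    _ = _ := by ring

include hA hA' hfix hfix' hC hy in
theorem norm_gMean_form2_sub_det_le {P : Family n d}
    {R : Family m d} (hP : ∀ j, ‖P j‖ ≤ β) (hR : ∀ j, ‖R j‖ ≤ β) (i : J) :
    ‖gMean (fun x => ((cols P x)ᴴ * (resolv A' T' x * C * resolv A T x) * cols R x) i i) -
      formExpr A T A' T' δ δ' (pairExpr A T A' T' δ δ' C y) P R i‖ ≤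
      187050 * B ^ 133 * β ^ 3 := by
  have hB := hA.B_pos
  have hβ := hA.pos
  have hδ := fun j => (hfix j).1
  have hδ' := fun j => (hfix' j).1
  have h1 := hA.norm_gMean_form2_sub_formExpr_le hA' hfix hfix' hC hP hR i
  have hu : ∀ {D}, ‖D‖ ≤ β ^ 2 → ‖pairMean A T A' T' C D - pairExpr A T A' T' δ δ' C y D‖ ≤
      45630 * B ^ 129 * β ^ 3 := by
    intro D hD
    refine (hA.norm_pairMean_sub_pairExpr_le hA' hfix hfix' hC hy D).trans ?_
    calc _ ≤ 45630 * B ^ 129 * β * β ^ 2 := by gcongr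
      _ = _ := by ring
  have u1 := hu (norm_mul_conjTranspose_le (hP i) (hR i))
  have u2 := hu (norm_mul_conjTranspose_le (hA'.norm_le i) (hR i))
  have u3 := hu (norm_mul_conjTranspose_le (hA'.norm_le i) (hA.norm_le i))
  have u4 := hu (norm_mul_conjTranspose_le (hP i) (hA.norm_le i))
  have ht := norm_div_one_add_le (hδ i) (hA.norm_traceForm_detEquiv_le hδ hA.norm_le hR i)
  have ht' := norm_div_one_add_le (hδ' i) (hA'.norm_traceForm_detEquiv_le hδ' hP hA'.norm_le i)
  have h2 : ‖formExpr A T A' T' δ δ' (pairMean A T A' T' C) P R i -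
      formExpr A T A' T' δ δ' (pairExpr A T A' T' δ δ' C y) P R i‖ ≤
      4 * (B ^ 4 * (45630 * B ^ 129 * β ^ 3)) := by
    unfold formExpr
    generalize pairMean A T A' T' C (R i * (P i)ᴴ) = a₁ at *
    generalize pairExpr A T A' T' δ δ' C y (R i * (P i)ᴴ) = b₁ at *
    generalize pairMean A T A' T' C (R i * (A' i)ᴴ) = a₂ at *
    generalize pairExpr A T A' T' δ δ' C y (R i * (A' i)ᴴ) = b₂ at *
    generalize pairMean A T A' T' C (A i * (A' i)ᴴ) = a₃ at *
    generalize pairExpr A T A' T' δ δ' C y (A i * (A' i)ᴴ) = b₃ at *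
    generalize pairMean A T A' T' C (A i * (P i)ᴴ) = a₄ at *
    generalize pairExpr A T A' T' δ δ' C y (A i * (P i)ᴴ) = b₄ at *
    have comm : ∀ w, ((P i)ᴴ * detEquiv A' T' δ' * A' i).trace * (w / (1 + (δ' i : ℂ))) =
        w * (((P i)ᴴ * detEquiv A' T' δ' * A' i).trace / (1 + (δ' i : ℂ))) := fun w => by ring
    simp only [comm]
    generalize ((P i)ᴴ * detEquiv A' T' δ' * A' i).trace / (1 + (δ' i : ℂ)) = t' at *
    generalize ((A i)ᴴ * detEquiv A T δ * R i).trace / (1 + (δ i : ℂ)) = t at *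
    generalize 45630 * B ^ 129 * β ^ 3 = e at *
    have e0 : 0 ≤ e := (norm_nonneg _).trans u1
    have e1 : a₁ - (a₂ - a₃ * t) * t' - a₄ * t - (b₁ - (b₂ - b₃ * t) * t' - b₄ * t) =
        (a₁ - b₁) - (a₂ - b₂) * t' + (a₃ - b₃) * (t * t') - (a₄ - b₄) * t := by ring
    rw [e1]
    have q1 := hA.pow_mul_le (p := 2) (q := 4) (by norm_num) (show (0 : ℝ) ≤ 1 by norm_num)
    have q0 := hA.pow_mul_le (p := 0) (q := 4) (by norm_num) (show (0 : ℝ) ≤ 1 by norm_num)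
    have m2 : ‖(a₂ - b₂) * t'‖ ≤ e * (1 * B ^ 4) := by
      rw [norm_mul]; exact mul_le_mul u2 (ht'.trans (by linarith)) (norm_nonneg _) e0
    have m3 : ‖(a₃ - b₃) * (t * t')‖ ≤ e * (1 * B ^ 4) := by
      rw [norm_mul, norm_mul]
      refine mul_le_mul u3 ?_ (by positivity) e0
      calc _ ≤ B ^ 2 * B ^ 2 := by gcongr
        _ = _ := by ring
    have m4 : ‖(a₄ - b₄) * t‖ ≤ e * (1 * B ^ 4) := by
      rw [norm_mul]; exact mul_le_mul u4 (ht.trans (by linarith)) (norm_nonneg _) e0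
    have m1 : ‖a₁ - b₁‖ ≤ e * (1 * B ^ 4) := by
      rw [pow_zero] at q0
      nlinarith
    refine (norm_sub_le _ _).trans ?_
    have n1 := norm_add_le ((a₁ - b₁) - (a₂ - b₂) * t') ((a₃ - b₃) * (t * t'))
    have n2 := norm_sub_le (a₁ - b₁) ((a₂ - b₂) * t')
    linarith
  have p1 := hA.pow_mul_le (p := 39) (q := 133) (by norm_num) (show (0 : ℝ) ≤ 4530 by norm_num)
  refine (norm_sub_le_norm_sub_add_norm_sub _ _ _).trans ((add_le_add h1 h2).trans ?_)
  calc _ = 4530 * B ^ 39 * β ^ 3 + 182520 * B ^ 133 * β ^ 3 := by ring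
    _ ≤ 4530 * B ^ 133 * β ^ 3 + 182520 * B ^ 133 * β ^ 3 := by gcongr
    _ = _ := by ring

end Bounded

end SecondOrder

/-! ### The clusters of a `Setup` -/

namespace Setup

variable {K N : ℕ} (D : Setup K N) (z : Fin K → ℝ)

/-- The factor `N_k^{-1/2}`. -/
noncomputable def scale (k : Fin K) : ℂ := 1 / ((Real.sqrt (D.n k : ℝ) : ℝ) : ℂ)

/-- The normalised rows `N_k^{-1/2} P_{jk}`. -/
noncomputable def fam (P : D.Corr) (k : Fin K) : Family (Fin (D.n k)) D.d :=
  fun j => D.scale k • D.rows (P j) k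

/-- The matrix `S_k - z_k I`. -/
noncomputable def shift (k : Fin K) : Matrix (Fin (D.n k)) (Fin (D.n k)) ℂ :=
  D.S k - ((z k : ℝ) : ℂ) • 1

theorem star_scale (k : Fin K) : star (D.scale k) = D.scale k := by
  unfold scale
  rw [← Complex.ofReal_one, ← Complex.ofReal_div]
  exact Complex.conj_ofReal _

theorem scale_mul_scale (k l : Fin K) : D.scale k * D.scale l = 1 / D.sqrtNN k l := by
  unfold scale sqrtNN
  rw [Real.sqrt_mul (by positivity)]
  push_cast
  rw [div_mul_div_comm, one_mul]

theorem scale_mul_self (k : Fin K) : D.scale k * D.scale k = 1 / (D.n k : ℂ) := by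
  rw [scale_mul_scale, sqrtNN, Real.sqrt_mul_self (by positivity)]
  push_cast
  rfl

theorem block_Om (j : Fin D.M) (k l : Fin K) :
    D.block (D.Om j) k l = D.rows (D.A j) k * (D.rows (D.A j) l)ᴴ := rfl

theorem fam_mul_conjTranspose (P O : D.Corr) (k l : Fin K) (j : Fin D.M) :
    D.fam P k j * (D.fam O l j)ᴴ =
      (1 / D.sqrtNN k l) • (D.rows (P j) k * (D.rows (O j) l)ᴴ) := by
  unfold fam
  rw [Matrix.conjTranspose_smul, Matrix.smul_mul, Matrix.mul_smul, smul_smul, star_scale,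
    scale_mul_scale]

theorem fam_mul_conjTranspose_self (P O : D.Corr) (k : Fin K) (j : Fin D.M) :
    D.fam P k j * (D.fam O k j)ᴴ =
      (1 / (D.n k : ℂ)) • (D.rows (P j) k * (D.rows (O j) k)ᴴ) := by
  rw [fam_mul_conjTranspose, ← scale_mul_scale, scale_mul_self]

theorem colMat_eq (P : D.Corr) (x : D.Sample) (k : Fin K) :
    D.colMat P x k = cols (D.fam P k) x := by
  ext a j
  simp only [colMat, cols, fam, rows, Matrix.smul_apply, Matrix.submatrix_apply, Matrix.of_apply,
    Matrix.smul_mulVec, Pi.smul_apply, id]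
  rfl

theorem Q_eq (x : D.Sample) (k : Fin K) :
    D.Q z x k = resolv (D.fam D.A k) (D.shift z k) x := by
  rw [Q, X, colMat_eq, add_sub_assoc]
  rfl

theorem ThetaOf_eq (k : Fin K) (δ : Fin D.M → ℝ) :
    D.ThetaOf z k δ = detEquiv (D.fam D.A k) (D.shift z k) δ := by
  unfold ThetaOf detEquiv detInv shift
  congr 1
  rw [add_comm, Finset.smul_sum]
  congr 1
  · refine Finset.sum_congr rfl fun j _ => ?_
    rw [fam_mul_conjTranspose_self, block_Om, smul_comm]
    congr 1
    push_cast
    rw [one_div]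
  · rw [neg_smul, neg_add_eq_sub]

theorem Theta_eq (δ : Fin K → Fin D.M → ℝ) (k : Fin K) :
    D.Theta z δ k = detEquiv (D.fam D.A k) (D.shift z k) (δ k) := D.ThetaOf_eq z k (δ k)

variable {z}

theorem shift_lowerBdd (k : Fin K) : LowerBdd (-z k) (D.shift z k) := by
  unfold LowerBdd shift
  have h := D.S_nonneg k
  convert h using 1
  push_cast
  rw [neg_smul, sub_neg_eq_add, sub_add_cancel]

theorem isSolution_iff (hz : ∀ k, z k < 0) (k : Fin K) (δ : Fin D.M → ℝ) :
    D.IsSolution z k δ ↔ IsFixedPoint (D.fam D.A k) (D.shift z k) δ := by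
  have hz' : 0 < -z k := by linarith [hz k]
  have key : (∀ j, 0 ≤ δ j) → ∀ j, (fixMap (D.fam D.A k) (D.shift z k) δ j : ℂ) =
      1 / (D.n k : ℂ) * (D.block (D.Om j) k k * D.ThetaOf z k δ).trace := by
    intro hδ j
    rw [← fixMap_eq hz' (D.shift_lowerBdd k) hδ j, trace_conjTranspose_mul_mul,
      fam_mul_conjTranspose_self, Matrix.smul_mul, Matrix.trace_smul, smul_eq_mul, ThetaOf_eq,
      block_Om]
  constructor
  · intro h j
    have := key (fun j => (h j).1) j
    rw [← (h j).2] at this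
    exact ⟨(h j).1, by exact_mod_cast this.symm⟩
  · intro h j
    refine ⟨(h j).1, ?_⟩
    rw [← key (fun j => (h j).1) j, ← (h j).2]

theorem existsUnique_isSolution (hz : ∀ k, z k < 0) (k : Fin K) :
    ∃! δ : Fin D.M → ℝ, D.IsSolution z k δ := by
  have hz' : 0 < -z k := by linarith [hz k]
  obtain ⟨δ, hδ⟩ := exists_isFixedPoint hz' (D.fam D.A k) (D.shift_lowerBdd k)
  refine ⟨δ, (D.isSolution_iff hz k δ).2 hδ, fun δ' hδ' => ?_⟩
  exact IsFixedPoint.unique hz' (D.shift_lowerBdd k) ((D.isSolution_iff hz k δ').1 hδ') hδ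

/-- A positive semidefinite matrix of zero trace vanishes, and the diagonal entries of CᴴΘC are the
values of a positive definite form at the columns of C. -/
theorem eq_zero_of_trace_posDef_eq_zero {m q : Type*} [Fintype m] [DecidableEq m] [Fintype q]
    [DecidableEq q] {Θ : Matrix m m ℂ} (hΘ : Θ.PosDef) {C : Matrix m q ℂ}
    (h : (Cᴴ * Θ * C).trace = 0) : C = 0 := by
  have h1 := (hΘ.posSemidef.conjTranspose_mul_mul_same C).trace_eq_zero_iff.1 h
  ext a b
  by_contra hab
  have hne : (fun a => C a b) ≠ 0 := fun h0 => hab (congrFun h0 a)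
  have h2 := hΘ.dotProduct_mulVec_pos hne
  have h3 : (Cᴴ * Θ * C) b b = star (fun a => C a b) ⬝ᵥ (Θ *ᵥ fun a => C a b) := by
    rw [Matrix.mul_assoc]
    simp only [Matrix.mul_apply, dotProduct, Matrix.mulVec, Matrix.conjTranspose_apply,
      Pi.star_apply]
  rw [← h3, h1] at h2
  exact lt_irrefl _ h2

theorem solution_pos (hz : ∀ k, z k < 0) {k : Fin K} {δ : Fin D.M → ℝ}
    (h : D.IsSolution z k δ) {j : Fin D.M} (hj : D.block (D.Om j) k k ≠ 0) : 0 < δ j := by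
  have hz' : 0 < -z k := by linarith [hz k]
  have hf := (D.isSolution_iff hz k δ).1 h
  have hδ := fun j => (hf j).1
  refine lt_of_le_of_ne (hδ j) fun h0 => hj ?_
  have h1 := fixMap_eq (A := D.fam D.A k) hz' (D.shift_lowerBdd k) hδ j
  rw [← (hf j).2, ← h0, Complex.ofReal_zero] at h1
  have h2 := eq_zero_of_trace_posDef_eq_zero
    (detEquiv_posDef (A := D.fam D.A k) hz' (D.shift_lowerBdd k) hδ) h1
  have h3 := D.fam_mul_conjTranspose_self D.A D.A k j
  rw [h2, Matrix.zero_mul, ← block_Om] at h3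
  rcases smul_eq_zero.1 h3.symm with h4 | h4
  -- The normalising factor is zero only for an empty cluster, where there is no index a.
  · ext a
    have h5 : (D.n k : ℂ) = 0 := by simpa using h4
    have h6 : D.n k = 0 := by exact_mod_cast h5
    exact absurd a.2 (by omega)
  · exact h4

/-! ### Deterministic quantities in terms of the normalised families -/

section Det

variable (z) (δ : Fin K → Fin D.M → ℝ) (k l : Fin K)

theorem lamTPO_eq (P O : D.Corr) (a : Matrix (Fin (D.n l)) (Fin (D.n k)) ℂ) (j : Fin D.M) :
    D.lamTPO z δ P O k l a j = (a * detEquiv (D.fam D.A k) (D.shift z k) (δ k) *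
      (D.fam P k j * (D.fam O l j)ᴴ) * detEquiv (D.fam D.A l) (D.shift z l) (δ l)).trace := by
  rw [fam_mul_conjTranspose, Matrix.mul_smul, Matrix.smul_mul, Matrix.trace_smul, smul_eq_mul,
    ← Theta_eq, ← Theta_eq, lamTPO]
  simp only [Matrix.mul_assoc]

theorem lamT_eq (a : Matrix (Fin (D.n l)) (Fin (D.n k)) ℂ) :
    D.lamT z δ k l a = D.lamTPO z δ D.A D.A k l a := by
  funext j
  rw [lamT, lamTPO, block_Om]
  simp only [Matrix.mul_assoc]

theorem lam_eq (b : Matrix (Fin (D.n k)) (Fin (D.n l)) ℂ) (j : Fin D.M) :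
    D.lam z δ k l b j = ((D.fam D.A k j)ᴴ * detEquiv (D.fam D.A k) (D.shift z k) (δ k) * b *
      detEquiv (D.fam D.A l) (D.shift z l) (δ l) * D.fam D.A l j).trace := by
  rw [lam, ← Theta_eq, ← Theta_eq, Matrix.trace_mul_comm _ (D.fam D.A l j), block_Om]
  have : D.sqrtNN k l = D.sqrtNN l k := by rw [sqrtNN, sqrtNN, mul_comm]
  rw [this, ← smul_eq_mul, ← Matrix.trace_smul]
  simp only [← Matrix.mul_assoc]
  rw [fam_mul_conjTranspose]
  simp only [Matrix.smul_mul]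

theorem LamPO_eq (P O : D.Corr) (i j : Fin D.M) :
    D.LamPO z δ P O k l i j = ((D.fam D.A k i)ᴴ * detEquiv (D.fam D.A k) (D.shift z k) (δ k) *
      (D.fam P k j * (D.fam O l j)ᴴ) *
      detEquiv (D.fam D.A l) (D.shift z l) (δ l) * D.fam D.A l i).trace := by
  rw [← lam_eq, fam_mul_conjTranspose, lam, LamPO, Matrix.of_apply, Matrix.mul_smul,
    Matrix.smul_mul, Matrix.trace_smul, smul_eq_mul, ← mul_assoc]
  congr 1
  · rw [← scale_mul_scale, mul_mul_mul_comm, scale_mul_self, scale_mul_self, div_mul_div_comm,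
      one_mul]
  · simp only [Matrix.mul_assoc]

theorem Gam_eq (i j : Fin D.M) : D.Gam z δ k l i j = D.LamPO z δ D.A D.A k l i j := by
  rw [Gam, LamPO, Matrix.of_apply, Matrix.of_apply, block_Om D j]
  simp only [Matrix.mul_assoc]

/-- The diagonal entries of `D_{P,O,k}`. -/
theorem DPO_eq (P O : D.Corr) : D.DPO z δ P O k = Matrix.diagonal fun j =>
    ((D.fam O k j)ᴴ * detEquiv (D.fam D.A k) (D.shift z k) (δ k) * D.fam P k j).trace := by
  unfold DPO
  congr 1
  funext j
  rw [trace_conjTranspose_mul_mul, fam_mul_conjTranspose_self, Matrix.smul_mul, Matrix.trace_smul,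
    smul_eq_mul, Theta_eq]

end Det

variable {δ : Fin K → Fin D.M → ℝ}

theorem F_eq (k : Fin K) : D.F δ k = Matrix.diagonal fun j => 1 / (1 + (δ k j : ℂ)) := by
  unfold F
  simp only [one_div]

theorem Gam_mul_F_mul_F_apply (k l : Fin K) (i j : Fin D.M) :
    (D.Gam z δ k l * D.F δ k * D.F δ l) i j =
      D.Gam z δ k l i j / ((1 + (δ k j : ℂ)) * (1 + (δ l j : ℂ))) := by
  rw [F_eq, F_eq, Matrix.mul_diagonal, Matrix.mul_diagonal]
  rw [mul_one_div, mul_one_div, div_div]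

/-- The entries of Γ F̃ F̃ are the stability coefficients of the pair of clusters. The minimum of
the two gaps serves both, and since no uniformity in N is needed here, ∑ j, δ l j may be taken as
the bound b. -/
theorem isUnit_one_sub (hz : ∀ k, z k < 0) (h : ∀ k, D.IsSolution z k (δ k)) (k l : Fin K) :
    IsUnit (1 - D.Gam z δ k l * D.F δ k * D.F δ l) := by
  have hf := fun k => (D.isSolution_iff hz k _).1 (h k)
  have hδ := fun k j => (hf k j).1
  have ht : 0 < min (-z k) (-z l) := lt_min (by linarith [hz k]) (by linarith [hz l])
  have hb : ∀ j, δ l j ≤ ∑ j, δ l j := fun j =>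
    Finset.single_le_sum (fun k _ => hδ l k) (Finset.mem_univ j)
  have hb0 : 0 ≤ ∑ j, δ l j := Finset.sum_nonneg fun k _ => hδ l k
  refine isUnit_one_sub_of_weighted (one_le_weight (hδ k) (hδ l)) (contr_lt_one hb0) fun i => ?_
  have h1 := sum_norm_trace_div_le_contr ht ((D.shift_lowerBdd k).mono (min_le_left _ _))
    ((D.shift_lowerBdd l).mono (min_le_right _ _)) (hδ k) (hf l) hb i
    (by rw [← (hf k i).2]; linarith)
  refine le_trans (le_of_eq (Finset.sum_congr rfl fun j _ => ?_)) h1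
  congr 1
  rw [Gam_mul_F_mul_F_apply, norm_div, weight_sq (hδ k) (hδ l)]
  congr 1
  · rw [Gam_eq, LamPO_eq]
    simp only [Matrix.mul_assoc]
  · have hn : ∀ k, ‖(1 : ℂ) + (δ k j : ℂ)‖ = 1 + δ k j := by
      intro k
      rw [← Complex.ofReal_one, ← Complex.ofReal_add, Complex.norm_real, Real.norm_of_nonneg]
      linarith [hδ k j]
    rw [norm_mul, hn, hn]

/-- The row vector `λ̃_{kl}(𝒜) F̃_k F̃_l Ξ_{kl}`. -/
noncomputable def solVec (z : Fin K → ℝ) (δ : Fin K → Fin D.M → ℝ) (k l : Fin K)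
    (a : Matrix (Fin (D.n l)) (Fin (D.n k)) ℂ) : Fin D.M → ℂ :=
  D.lamT z δ k l a ᵥ* (D.F δ k * D.F δ l * D.Xi z δ k l)

/-- The deterministic equivalent of `𝓑 ↦ Tr 𝒜 Q_k 𝓑 Q_l`. -/
noncomputable abbrev pairBar (z : Fin K → ℝ) (δ : Fin K → Fin D.M → ℝ) (k l : Fin K)
    (a : Matrix (Fin (D.n l)) (Fin (D.n k)) ℂ) (b : Matrix (Fin (D.n k)) (Fin (D.n l)) ℂ) : ℂ :=
  pairExpr (D.fam D.A k) (D.shift z k) (D.fam D.A l) (D.shift z l) (δ k) (δ l) a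
    (D.solVec z δ k l a) b

theorem UpsilonBar_eq (k l : Fin K) (a : Matrix (Fin (D.n l)) (Fin (D.n k)) ℂ)
    (b : Matrix (Fin (D.n k)) (Fin (D.n l)) ℂ) :
    D.UpsilonBar z δ k l a b = D.pairBar z δ k l a b := by
  unfold UpsilonBar pairBar pairExpr solVec
  rw [Theta_eq, Theta_eq]
  congr 1
  exact Finset.sum_congr rfl fun j _ => by rw [lam_eq]

theorem pairBar_fam (P O : D.Corr) (k l : Fin K) (a : Matrix (Fin (D.n l)) (Fin (D.n k)) ℂ)
    (j : Fin D.M) : D.pairBar z δ k l a (D.fam P k j * (D.fam O l j)ᴴ) =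
      D.lamTPO z δ P O k l a j + (D.solVec z δ k l a ᵥ* D.LamPO z δ P O k l) j := by
  unfold pairBar pairExpr
  rw [← lamTPO_eq]
  congr 1
  exact Finset.sum_congr rfl fun i _ => congrArg _ (D.LamPO_eq z δ k l P O i j).symm

theorem one_add_ne_zero {c : ℝ} (hc : 0 ≤ c) : (1 : ℂ) + c ≠ 0 := by
  have : (1 : ℝ) + c ≠ 0 := by positivity
  exact_mod_cast this

/-- Multiplying λ̃ F̃ F̃ Ξ by I - Γ F̃ F̃ removes Ξ; dividing by the diagonal F̃ F̃ then gives
exactly the closed system for the values at A_i A'_iᴴ. This is the hypothesis `hy` of the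
second-order estimates. -/
theorem solVec_mul (hz : ∀ k, z k < 0) (h : ∀ k, D.IsSolution z k (δ k)) (k l : Fin K)
    (a : Matrix (Fin (D.n l)) (Fin (D.n k)) ℂ) (i : Fin D.M) :
    D.solVec z δ k l a i * ((1 + δ k i) * (1 + δ l i)) =
      D.pairBar z δ k l a (D.fam D.A k i * (D.fam D.A l i)ᴴ) := by
  have hu := (Matrix.isUnit_iff_isUnit_det _).1 (D.isUnit_one_sub hz h k l)
  have h1 : D.solVec z δ k l a ᵥ* (1 - D.Gam z δ k l * D.F δ k * D.F δ l) =
      D.lamT z δ k l a ᵥ* (D.F δ k * D.F δ l) := by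
    rw [solVec, Xi, Matrix.vecMul_vecMul, Matrix.mul_assoc (D.F δ k * D.F δ l),
      Matrix.nonsing_inv_mul _ hu, Matrix.mul_one]
  have d1 := one_add_ne_zero (h k i).1
  have d2 := one_add_ne_zero (h l i).1
  rw [Matrix.vecMul_sub, Matrix.vecMul_one, ← Matrix.vecMul_vecMul, ← Matrix.vecMul_vecMul,
    ← Matrix.vecMul_vecMul, F_eq, F_eq] at h1
  have h2 := congrFun h1 i
  simp only [Pi.sub_apply, Matrix.vecMul_diagonal] at h2
  have hG : D.Gam z δ k l = D.LamPO z δ D.A D.A k l := by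
    ext i j
    exact D.Gam_eq z δ k l i j
  rw [pairBar_fam, ← hG, ← lamT_eq]
  field_simp at h2
  linear_combination h2

/-- The identity holds column by column. The product of the two matrices D comes from the value at
A_j A'_jᴴ in `formExpr`: by `solVec_mul` that value is the solution vector times (1+δ)(1+δ'), which
cancels the denominators. -/
theorem PiBar_eq (hz : ∀ k, z k < 0) (h : ∀ k, D.IsSolution z k (δ k)) (P : D.Corr) (k l : Fin K)
    (a : Matrix (Fin (D.n l)) (Fin (D.n k)) ℂ) :
    D.PiBar z δ P k l a = ∑ j, formExpr (D.fam D.A k) (D.shift z k) (D.fam D.A l) (D.shift z l)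
      (δ k) (δ l) (D.pairBar z δ k l a) (D.fam P l) (D.fam P k) j := by
  have e : ∀ M : Matrix (Fin D.M) (Fin D.M) ℂ,
      D.lamT z δ k l a ᵥ* (D.F δ k * D.F δ l * D.Xi z δ k l * M) =
      D.solVec z δ k l a ᵥ* M := fun M => by rw [solVec, Matrix.vecMul_vecMul]
  unfold PiBar
  rw [e, dotProduct_one, dotProduct_one, ← Finset.sum_add_distrib]
  refine Finset.sum_congr rfl fun j _ => ?_
  have d1 := one_add_ne_zero (h k j).1
  have d2 := one_add_ne_zero (h l j).1
  unfold formExpr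
  rw [← D.solVec_mul hz h]
  simp only [pairBar_fam, F_eq, DPO_eq, Pi.sub_apply, Matrix.vecMul_add, Matrix.vecMul_sub,
    Pi.add_apply, ← Matrix.vecMul_vecMul, Matrix.vecMul_diagonal]
  field_simp
  ring

/-- Both 𝒜 and b are absorbed into the left-hand family conj(b_j) 𝒜ᴴ P_{jl}, so that only a
one-resolvent form in cluster k remains. -/
theorem PhiBar_eq (P : D.Corr) (k l : Fin K) (a : Matrix (Fin (D.n l)) (Fin (D.n k)) ℂ)
    (b : Fin D.M → ℂ) : D.PhiBar z δ P k l a b =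
      ∑ j, ((star (b j) • (aᴴ * D.fam P l j))ᴴ * detEquiv (D.fam D.A k) (D.shift z k) (δ k) *
        D.fam D.A k j).trace / (1 + δ k j) := by
  unfold PhiBar
  rw [Finset.sum_div]
  refine Finset.sum_congr rfl fun j _ => ?_
  have e : ((star (b j) • (aᴴ * D.fam P l j))ᴴ * detEquiv (D.fam D.A k) (D.shift z k) (δ k) *
      D.fam D.A k j).trace = b j * (1 / D.sqrtNN k l * (a * D.Theta z δ k * D.rows (D.A j) k *
        (D.rows (P j) l)ᴴ).trace) := by
    rw [Matrix.conjTranspose_smul, star_star, Matrix.smul_mul, Matrix.smul_mul, Matrix.trace_smul,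
      smul_eq_mul, Matrix.conjTranspose_mul, Matrix.conjTranspose_conjTranspose, ← Theta_eq]
    congr 1
    have e1 : (D.fam P l j)ᴴ * a * D.Theta z δ k * D.fam D.A k j =
        (D.fam P l j)ᴴ * (a * D.Theta z δ k) * D.fam D.A k j := by
      simp only [Matrix.mul_assoc]
    rw [e1, trace_conjTranspose_mul_mul, fam_mul_conjTranspose, Matrix.smul_mul, Matrix.trace_smul,
      smul_eq_mul, Matrix.trace_mul_comm]
    simp only [Matrix.mul_assoc]
  rw [e, F_eq, Matrix.mulVec_diagonal]
  ring

end Setup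

/-! ### Non-asymptotic error bounds -/

/-- `f` has mean close to `fbar` and bounded variance under the law of the Gaussian sample. -/
structure GaussianApprox {J : Type*} [Fintype J] {d : J → ℕ} (c β : ℝ)
    (f : (∀ j, Fin (d j) → ℂ) → ℂ) (fbar : ℂ) : Prop where
  tame : Tame f
  mean : ‖gMean f - fbar‖ ≤ c * β
  var : gVar f ≤ c

/-- The constant in the error bounds. -/
noncomputable def errConst (B : ℝ) : ℝ := 187050 * B ^ 134

theorem mul_pow_le_errConst {B : ℝ} (hB : 1 ≤ B) {c : ℝ} {p : ℕ} (hc : c ≤ 187050)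
    (hp : p ≤ 134) : c * B ^ p ≤ errConst B := by
  have hB0 : 0 ≤ B := by linarith
  exact mul_le_mul hc (pow_le_pow_right₀ hB hp) (by positivity) (by norm_num)

namespace Setup

variable {K N : ℕ} (D : Setup K N) {z : Fin K → ℝ} {δ : Fin K → Fin D.M → ℝ} {B β : ℝ}

theorem idx_injective (k : Fin K) : Function.Injective (D.idx k) := by
  intro i j h
  have h1 := finSigmaFinEquiv.injective (Fin.cast_injective _ h)
  simpa using h1

theorem norm_rows_le {q : Type} [Fintype q] [DecidableEq q] (R : Matrix (Fin N) q ℂ) (k : Fin K) :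
    ‖D.rows R k‖ ≤ ‖R‖ := by
  refine opNorm_le_of_sum_sq (norm_nonneg _) fun v => le_trans ?_ (sum_norm_mulVec_sq_le R v)
  have h1 : ∑ a, ‖(D.rows R k *ᵥ v) a‖ ^ 2 =
      ∑ a ∈ Finset.univ.map ⟨D.idx k, D.idx_injective k⟩, ‖(R *ᵥ v) a‖ ^ 2 := by
    rw [Finset.sum_map]
    rfl
  rw [h1]
  exact Finset.sum_le_univ_sum_of_nonneg fun a => by positivity

/-- Uniform bounds on the data of a setup. -/
structure Bdd (z : Fin K → ℝ) (B β : ℝ) : Prop where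
  bounded : ∀ k, Bounded B β (D.fam D.A k) (D.shift z k)
  norm_le : ∀ k j, ‖D.fam D.B k j‖ ≤ β

variable {D}

theorem digamma_approx (hD : D.Bdd z B β) (hz : ∀ k, z k < 0)
    (h : ∀ k, D.IsSolution z k (δ k)) {k : Fin K}
    {a : Matrix (Fin (D.n k)) (Fin (D.n k)) ℂ} (ha : ‖a‖ ≤ B) :
    GaussianApprox (errConst B) β (D.digamma z k a) (D.digammaBar z δ k a) := by
  have hk := hD.bounded k
  have hB := hk.B_pos
  have hβ := hk.pos
  have e : D.digamma z k a = fun x => (a * resolv (D.fam D.A k) (D.shift z k) x).trace := by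
    funext x
    rw [digamma, Q_eq]
  rw [e, digammaBar, Theta_eq]
  refine ⟨hk.tame_trace_mul_resolv a, ?_, ?_⟩
  · refine (hk.norm_gMean_trace_mul_resolv_sub_le ((D.isSolution_iff hz k _).1 (h k)) a).trans ?_
    calc _ ≤ 540 * B ^ 33 * β * B := by gcongr
      _ = 540 * B ^ 34 * β := by ring
      _ ≤ _ := by
        gcongr
        exact mul_pow_le_errConst hk.one_le (by norm_num) (by norm_num)
  · refine (hk.gVar_trace_mul_resolv_le a).trans ?_
    have h1 : frSq a ≤ (D.n k : ℝ) * B ^ 2 := by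
      refine (frSq_le_card_mul a).trans ?_
      rw [Fintype.card_fin]
      gcongr
    have h2 : (D.n k : ℝ) * β ^ 2 ≤ B := by simpa using hk.card_row
    calc _ ≤ 12 * B ^ 3 * β ^ 2 * ((D.n k : ℝ) * B ^ 2) := by gcongr
      _ = 12 * B ^ 5 * ((D.n k : ℝ) * β ^ 2) := by ring
      _ ≤ 12 * B ^ 5 * B := by gcongr
      _ = 12 * B ^ 6 := by ring
      _ ≤ _ := mul_pow_le_errConst hk.one_le (by norm_num) (by norm_num)

theorem Upsilon_approx (hD : D.Bdd z B β) (hz : ∀ k, z k < 0)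
    (h : ∀ k, D.IsSolution z k (δ k)) {k l : Fin K}
    {a : Matrix (Fin (D.n l)) (Fin (D.n k)) ℂ} (ha : ‖a‖ ≤ B)
    {b : Matrix (Fin (D.n k)) (Fin (D.n l)) ℂ} (hb : ‖b‖ ≤ B) :
    GaussianApprox (errConst B) β (D.Upsilon z k l a b) (D.UpsilonBar z δ k l a b) := by
  have hk := hD.bounded k
  have hl := hD.bounded l
  have hB := hk.B_pos
  have hβ := hk.pos
  have e : D.Upsilon z k l a b = fun x => (a * resolv (D.fam D.A k) (D.shift z k) x * b *
      resolv (D.fam D.A l) (D.shift z l) x).trace := by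
    funext x
    rw [Upsilon, Q_eq, Q_eq]
  rw [e, UpsilonBar_eq]
  refine ⟨hk.tame_trace_resolv_mul_resolv hl a b, ?_, ?_⟩
  · refine (hk.norm_pairMean_sub_pairExpr_le hl ((D.isSolution_iff hz k _).1 (h k))
      ((D.isSolution_iff hz l _).1 (h l)) ha (D.solVec_mul hz h k l a) b).trans ?_
    calc _ ≤ 45630 * B ^ 129 * β * B := by gcongr
      _ = 45630 * B ^ 130 * β := by ring
      _ ≤ _ := by
        gcongr
        exact mul_pow_le_errConst hk.one_le (by norm_num) (by norm_num)
  · refine (hk.gVar_trace_resolv_mul_resolv_le hl a b).trans ?_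
    have h1 : frSq a ≤ (D.n l : ℝ) * B ^ 2 := by
      refine (frSq_le_card_mul a).trans ?_
      rw [Fintype.card_fin]
      gcongr
    have h0 := frSq_nonneg a
    have h2 : (D.n l : ℝ) * β ^ 2 ≤ B := by simpa using hl.card_row
    calc _ ≤ 48 * B ^ 5 * β ^ 2 * (B ^ 2 * ((D.n l : ℝ) * B ^ 2)) := by gcongr
      _ = 48 * B ^ 9 * ((D.n l : ℝ) * β ^ 2) := by ring
      _ ≤ 48 * B ^ 9 * B := by gcongr
      _ = 48 * B ^ 10 := by ring
      _ ≤ _ := mul_pow_le_errConst hk.one_le (by norm_num) (by norm_num)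

/-- There are M columns, each with an error of order β³, and M β² ≤ B. This is the largest of the
mean errors and fixes `errConst`. -/
theorem Pi_approx (hD : D.Bdd z B β) (hz : ∀ k, z k < 0)
    (h : ∀ k, D.IsSolution z k (δ k)) {k l : Fin K}
    {a : Matrix (Fin (D.n l)) (Fin (D.n k)) ℂ} (ha : ‖a‖ ≤ B) {P : D.Corr}
    (hP : ∀ k j, ‖D.fam P k j‖ ≤ β) :
    GaussianApprox (errConst B) β (D.Pi P z k l a) (D.PiBar z δ P k l a) := by
  have hk := hD.bounded k
  have hl := hD.bounded l
  have hB := hk.B_pos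
  have hβ := hk.pos
  have e : D.Pi P z k l a = fun x => ∑ j ∈ Finset.univ, ((cols (D.fam P l) x)ᴴ *
      (resolv (D.fam D.A l) (D.shift z l) x * a * resolv (D.fam D.A k) (D.shift z k) x) *
      cols (D.fam P k) x) j j := by
    funext x
    change _ = Matrix.trace _
    rw [trace_conjTranspose_mul_three, Pi, Q_eq, Q_eq, colMat_eq, colMat_eq]
    simp only [Matrix.mul_assoc]
  have t := fun j => hk.tame_form2 hl (D.fam P l) (D.fam P k) a j
  have hM : (D.M : ℝ) * β ^ 2 ≤ B := by simpa using hk.card_col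
  rw [e, D.PiBar_eq hz h]
  refine ⟨Tame.sum _ fun j _ => t j, ?_, ?_⟩
  · rw [gMean_sum _ fun j _ => t j, ← Finset.sum_sub_distrib]
    refine (norm_sum_le _ _).trans ((Finset.sum_le_sum fun j _ =>
      hk.norm_gMean_form2_sub_det_le hl ((D.isSolution_iff hz k _).1 (h k))
      ((D.isSolution_iff hz l _).1 (h l)) ha (D.solVec_mul hz h k l a) (hP l) (hP k) j).trans ?_)
    rw [Finset.sum_const, Finset.card_univ, nsmul_eq_mul]
    refine (hk.card_col_mul_le (c := 187050 * B ^ 133) (by positivity)).trans (le_of_eq ?_)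
    rw [errConst]
    ring
  · refine (hk.gVar_form2_le hl (hP l) (hP k) ha Finset.univ).trans ?_
    rw [Finset.card_univ, Fintype.card_fin]
    calc _ = 216 * B ^ 9 * (D.M * β ^ 2) := by ring
      _ ≤ 216 * B ^ 9 * B := by gcongr
      _ = 216 * B ^ 10 := by ring
      _ ≤ _ := mul_pow_le_errConst hk.one_le (by norm_num) (by norm_num)

/-- Only the products ‖b_j‖ ‖𝒜‖ matter, since the left-hand family conj(b_j) 𝒜ᴴ P_{jl} then has norm
at most B β. The one-resolvent estimates are used with the enlarged constants. -/
theorem Phi_approx (hD : D.Bdd z B β) (hz : ∀ k, z k < 0)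
    (h : ∀ k, D.IsSolution z k (δ k)) {k l : Fin K}
    {a : Matrix (Fin (D.n l)) (Fin (D.n k)) ℂ} {b : Fin D.M → ℂ} (hab : ∀ j, ‖b j‖ * ‖a‖ ≤ B)
    {P : D.Corr} (hP : ∀ k j, ‖D.fam P k j‖ ≤ β) :
    GaussianApprox (errConst B) β (D.Phi P z k l a b) (D.PhiBar z δ P k l a b) := by
  have hk := hD.bounded k
  have hB := hk.B_pos
  have hβ := hk.pos
  have hP' : ∀ j, ‖star (b j) • (aᴴ * D.fam P l j)‖ ≤ B * β := by
    intro j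
    rw [norm_smul, norm_star]
    calc _ ≤ ‖b j‖ * (‖a‖ * β) := by
          gcongr
          refine (Matrix.l2_opNorm_mul _ _).trans ?_
          rw [Matrix.l2_opNorm_conjTranspose]
          gcongr
          exact hP l j
      _ = (‖b j‖ * ‖a‖) * β := by ring
      _ ≤ _ := by gcongr; exact hab j
  have hcols : ∀ x : D.Sample, cols (fun j => star (b j) • (aᴴ * D.fam P l j)) x =
      aᴴ * cols (D.fam P l) x * Matrix.diagonal (star b) := by
    intro x
    rw [← cols_mul_left]
    ext i j
    rw [Matrix.mul_diagonal]
    simp only [cols, Matrix.of_apply, Matrix.smul_mulVec, Pi.smul_apply, smul_eq_mul,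
      Pi.star_apply]
    ring
  have e : D.Phi P z k l a b = fun x => ∑ j ∈ Finset.univ,
      ((cols (fun j => star (b j) • (aᴴ * D.fam P l j)) x)ᴴ *
      resolv (D.fam D.A k) (D.shift z k) x * cols (D.fam D.A k) x) j j := by
    funext x
    change _ = Matrix.trace _
    rw [hcols, Phi, Q_eq, X, colMat_eq, colMat_eq, Matrix.conjTranspose_mul,
      Matrix.diagonal_conjTranspose, star_star, Matrix.conjTranspose_mul,
      Matrix.conjTranspose_conjTranspose, Matrix.mul_assoc _ (Matrix.diagonal b),
      Matrix.trace_mul_comm]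
    simp only [Matrix.mul_assoc]
  have t := fun j => hk.tame_form (fun j => star (b j) • (aᴴ * D.fam P l j)) (D.fam D.A k) j
  have hM : (D.M : ℝ) * β ^ 2 ≤ B := by simpa using hk.card_col
  rw [e, PhiBar_eq]
  refine ⟨Tame.sum _ fun j _ => t j, ?_, ?_⟩
  · rw [gMean_sum _ fun j _ => t j, ← Finset.sum_sub_distrib]
    refine (norm_sum_le _ _).trans ((Finset.sum_le_sum fun j _ =>
      hk.enlarge.norm_gMean_form_right_sub_det_le ((D.isSolution_iff hz k _).1 (h k))
        hP' j).trans ?_)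
    rw [Finset.sum_const, Finset.card_univ, nsmul_eq_mul]
    have h1 := hk.card_col_mul_le (c := 1080 * B ^ 102) (by positivity)
    calc _ = (Fintype.card (Fin D.M) : ℝ) * (1080 * B ^ 102 * β ^ 3) := by ring
      _ ≤ _ := h1
      _ = 1080 * B ^ 103 * β := by ring
      _ ≤ _ := by
        gcongr
        exact mul_pow_le_errConst hk.one_le (by norm_num) (by norm_num)
  · refine (hk.enlarge.gVar_form_le hP' hk.enlarge.norm_le Finset.univ).trans ?_
    rw [Finset.card_univ, Fintype.card_fin]
    calc _ = 216 * B ^ 29 * (D.M * β ^ 2) := by ring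
      _ ≤ 216 * B ^ 29 * B := by gcongr
      _ = 216 * B ^ 30 := by ring
      _ ≤ _ := mul_pow_le_errConst hk.one_le (by norm_num) (by norm_num)

end Setup

/-! ### Asymptotics -/

section Asymptotics

variable {Ω : Type*} [MeasurableSpace Ω] {P : Measure Ω}

/-- A sequence whose second moments are bounded is almost surely `o(N)`. -/
theorem ae_tendsto_norm_div_of_second_moment {Z : ℕ → Ω → ℂ} {V : ℝ}
    (hZ : ∀ N, AEMeasurable (Z N) P)
    (hV : ∀ᶠ N in atTop, Integrable (fun ω => ‖Z N ω‖ ^ 2) P ∧ ∫ ω, ‖Z N ω‖ ^ 2 ∂P ≤ V) :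
    ∀ᵐ ω ∂P, Tendsto (fun N : ℕ => ‖Z N ω‖ / (N : ℝ)) atTop (𝓝 0) := by
  obtain ⟨N₀, hN₀⟩ := eventually_atTop.1 hV
  have hV0 : 0 ≤ V := (integral_nonneg fun ω => by positivity).trans (hN₀ N₀ le_rfl).2
  -- The expectation of ∑ ‖Z_N‖²/N² is finite, so almost surely the series converges and its terms
  -- tend to zero. No joint law of the Z_N is involved. The shift by N₀ skips the terms without a
  -- moment bound.
  set g : ℕ → Ω → ℝ≥0∞ := fun N ω =>
    ENNReal.ofReal (((N + N₀ : ℕ) : ℝ) ^ 2)⁻¹ * ENNReal.ofReal (‖Z (N + N₀) ω‖ ^ 2) with hg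
  have hgm : ∀ N, AEMeasurable (g N) P := fun N =>
    ((hZ (N + N₀)).norm.pow_const 2).ennreal_ofReal.const_mul _
  have hgi : ∀ N, ∫⁻ ω, g N ω ∂P ≤ ENNReal.ofReal ((((N + N₀ : ℕ) : ℝ) ^ 2)⁻¹ * V) := by
    intro N
    obtain ⟨h1, h2⟩ := hN₀ (N + N₀) (by omega)
    rw [lintegral_const_mul'' _ ((hZ (N + N₀)).norm.pow_const 2).ennreal_ofReal,
      ← ofReal_integral_eq_lintegral_ofReal h1 (Eventually.of_forall fun ω => by positivity),
      ENNReal.ofReal_mul (by positivity)]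
    gcongr
  have hsum : Summable fun N : ℕ => (((N + N₀ : ℕ) : ℝ) ^ 2)⁻¹ * V :=
    ((summable_nat_add_iff N₀).2 (Real.summable_nat_pow_inv.2 (by norm_num : 1 < 2))).mul_right V
  have hfin : ∫⁻ ω, ∑' N, g N ω ∂P ≠ ∞ := by
    rw [lintegral_tsum hgm]
    refine ne_top_of_le_ne_top ?_ (ENNReal.tsum_le_tsum hgi)
    rw [← ENNReal.ofReal_tsum_of_nonneg (fun N => by positivity) hsum]
    exact ENNReal.ofReal_ne_top
  filter_upwards [ae_lt_top' (AEMeasurable.tsum hgm) hfin] with ω hω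
  have h1 := ENNReal.tendsto_atTop_zero_of_tsum_ne_top hω.ne
  have h2 := (ENNReal.tendsto_toReal ENNReal.zero_ne_top).comp h1
  have h3 : Tendsto (fun N : ℕ => (‖Z (N + N₀) ω‖ / ((N + N₀ : ℕ) : ℝ)) ^ 2) atTop (𝓝 0) := by
    refine h2.congr fun N => ?_
    simp only [Function.comp, hg]
    rw [ENNReal.toReal_mul, ENNReal.toReal_ofReal (by positivity),
      ENNReal.toReal_ofReal (by positivity), div_pow, div_eq_inv_mul]
  have h4 : Tendsto (fun N : ℕ => ‖Z (N + N₀) ω‖ / ((N + N₀ : ℕ) : ℝ)) atTop (𝓝 0) := by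
    have := h3.sqrt
    rw [Real.sqrt_zero] at this
    exact this.congr fun N => Real.sqrt_sq (by positivity)
  exact (tendsto_add_atTop_iff_nat N₀).1 h4

theorem integral_norm_sub_sq_le_gVar {J : Type*} [Fintype J] {d : J → ℕ}
    {f : (∀ j, Fin (d j) → ℂ) → ℂ} (hf : Tame f) (c : ℂ) :
    ∫ x, ‖f x - c‖ ^ 2 ∂(gaussianSample d) ≤ 2 * gVar f + 2 * ‖gMean f - c‖ ^ 2 := by
  have i1 := ((hf.sub (Tame.const c)).norm_sq).integrable (gaussianSample d)
  have i2 := ((hf.sub (Tame.const (gMean f))).norm_sq).integrable (gaussianSample d)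
  calc _ ≤ ∫ x, (2 * ‖f x - gMean f‖ ^ 2 + 2 * ‖gMean f - c‖ ^ 2) ∂(gaussianSample d) := by
        refine integral_mono i1 ((i2.const_mul 2).add (integrable_const _)) fun x => ?_
        have h := norm_add_sq_le_two (f x - gMean f) (gMean f - c)
        rwa [sub_add_sub_cancel] at h
    _ = _ := by
        rw [integral_add (i2.const_mul 2) (integrable_const _), integral_const_mul, integral_const,
          probReal_univ, one_smul]
        rfl

variable {K : ℕ} {D : ∀ N, Setup K N} [IsProbabilityMeasure P]
  {x : ∀ N, ∀ j : Fin (D N).M, Ω → Fin ((D N).d j) → ℂ}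

theorem IsGaussianSample.map_eq (hx : IsGaussianSample D P x) (N : ℕ) :
    P.map (fun ω j => x N j ω) = gaussianSample (D N).d := by
  obtain ⟨h1, h2⟩ := hx N
  rw [(iIndepFun_iff_map_fun_eq_pi_map fun j => (h1 j).aemeasurable).1 h2]
  simp only [(h1 _).map_eq]
  rfl

theorem IsGaussianSample.aemeasurable (hx : IsGaussianSample D P x) (N : ℕ) :
    AEMeasurable (fun ω j => x N j ω) P :=
  aemeasurable_pi_lambda _ fun j => ((hx N).1 j).aemeasurable

theorem IsGaussianSample.integral_comp {F : Type*} [NormedAddCommGroup F] [NormedSpace ℝ F]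
    (hx : IsGaussianSample D P x) (N : ℕ)
    {f : (D N).Sample → F} (hf : Continuous f) [SecondCountableTopology F] :
    ∫ ω, f (fun j => x N j ω) ∂P = ∫ y, f y ∂(gaussianSample (D N).d) := by
  rw [← hx.map_eq N, integral_map (hx.aemeasurable N)]
  borelize F
  exact hf.measurable.aestronglyMeasurable

theorem IsGaussianSample.integrable_comp {F : Type*} [NormedAddCommGroup F] [NormedSpace ℝ F]
    [SecondCountableTopology F] (hx : IsGaussianSample D P x) (N : ℕ)
    {f : (D N).Sample → F} (hf : Tame f) : Integrable (fun ω => f (fun j => x N j ω)) P := by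
  have h := hf.integrable (gaussianSample (D N).d)
  rw [← hx.map_eq N] at h
  exact h.comp_aemeasurable (hx.aemeasurable N)

/-- Tameness at every N provides integrability; the quantitative bounds are needed only for large N.
The second moment about the equivalent is bounded by twice the variance plus twice the squared bias.
-/
theorem IsGaussianSample.stochEquiv (hx : IsGaussianSample D P x)
    {f : ∀ N, (D N).Sample → ℂ} {fbar : ℕ → ℂ} (hf : ∀ N, Tame (f N)) {c C : ℝ}
    (happ : ∀ᶠ N : ℕ in atTop, ∃ β, β ≤ C / √N ∧ GaussianApprox c β (f N) (fbar N)) :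
    StochEquiv P (1 / 2) (fun N ω => f N (fun j => x N j ω)) fbar := by
  have hc : ∀ {N β}, GaussianApprox c β (f N) (fbar N) → 0 ≤ c := fun h =>
    (integral_nonneg fun x => by positivity).trans h.var
  have hmean : ∀ N, ∫ ω, f N (fun j => x N j ω) ∂P = gMean (f N) := fun N =>
    hx.integral_comp N (hf N).1
  have hbd : ∀ᶠ N : ℕ in atTop, ‖gMean (f N) - fbar N‖ ≤ c * C * ‖(N : ℝ) ^ (-(1 / 2) : ℝ)‖ := by
    filter_upwards [happ] with N ⟨β, hβ, h⟩
    have e : ‖(N : ℝ) ^ (-(1 / 2) : ℝ)‖ = 1 / √N := by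
      rw [Real.norm_of_nonneg (by positivity), Real.rpow_neg (by positivity),
        ← Real.sqrt_eq_rpow, one_div]
    rw [e]
    calc _ ≤ c * β := h.mean
      _ ≤ c * (C / √N) := mul_le_mul_of_nonneg_left hβ (hc h)
      _ = _ := by ring
  refine ⟨fun N => hx.integrable_comp N (hf N), ?_, ?_⟩
  · refine IsBigO.of_bound (c * C) ?_
    simp only [hmean, norm_norm]
    exact hbd
  · refine ae_tendsto_norm_div_of_second_moment (V := 2 * c + 2 * (c * C) ^ 2)
      (fun N => ((hf N).1.measurable.comp_aemeasurable (hx.aemeasurable N)).sub_const _) ?_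
    filter_upwards [happ, hbd, eventually_ge_atTop 1] with N ⟨β, hβ, h⟩ hN hN1
    have ht := ((hf N).sub (Tame.const (fbar N))).norm_sq
    refine ⟨hx.integrable_comp N ht, ?_⟩
    rw [hx.integral_comp N ht.1]
    refine (integral_norm_sub_sq_le_gVar (hf N) (fbar N)).trans ?_
    have h1 : ‖(N : ℝ) ^ (-(1 / 2) : ℝ)‖ ≤ 1 := by
      rw [Real.norm_of_nonneg (by positivity)]
      exact Real.rpow_le_one_of_one_le_of_nonpos (by exact_mod_cast hN1) (by norm_num)
    have h0 : 0 ≤ ‖(N : ℝ) ^ (-(1 / 2) : ℝ)‖ := norm_nonneg _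
    have h2 : ‖gMean (f N) - fbar N‖ ^ 2 ≤ (c * C) ^ 2 := by
      calc _ ≤ (c * C * ‖(N : ℝ) ^ (-(1 / 2) : ℝ)‖) ^ 2 := by gcongr
        _ = (c * C) ^ 2 * ‖(N : ℝ) ^ (-(1 / 2) : ℝ)‖ ^ 2 := by ring
        _ ≤ (c * C) ^ 2 * 1 := by
            gcongr
            exact pow_le_one₀ h0 h1
        _ = _ := mul_one _
    linarith [h.var]

theorem ProportionalGrowth.exists_le (h : ProportionalGrowth D) (k : Fin K) :
    ∃ κ : ℝ, ∀ᶠ N in atTop, ((D N).n k : ℝ) ≤ κ * (D N).M ∧ ((D N).M : ℝ) ≤ κ * (D N).n k := by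
  obtain ⟨h1, h2⟩ := h k
  obtain ⟨c, hc0, hc⟩ := exists_between h1
  obtain ⟨C, hC0, hC⟩ := exists_between h2
  have hct : c ≠ ∞ := (lt_top_of_lt hc).ne
  refine ⟨max C.toReal c.toReal⁻¹, ?_⟩
  filter_upwards [eventually_lt_of_lt_liminf hc, eventually_lt_of_limsup_lt hC0] with N hN1 hN2
  -- In ℝ≥0∞ one has 0/0 = 0, excluded by the lower bound, and n/0 = ⊤ for n ≠ 0, excluded by the
  -- upper one. Hence M > 0 for these N.
  have hM : (D N).M ≠ 0 := by
    intro h0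
    rw [h0] at hN1 hN2
    rcases eq_or_ne ((D N).n k) 0 with hn | hn
    · rw [hn] at hN1
      simp at hN1
    · rw [Nat.cast_zero, ENNReal.div_zero (by exact_mod_cast hn)] at hN2
      exact not_top_lt hN2
  have hM' : (((D N).M : ℕ) : ℝ≥0∞) ≠ 0 := by exact_mod_cast hM
  have hMt : (((D N).M : ℕ) : ℝ≥0∞) ≠ ∞ := ENNReal.natCast_ne_top _
  have e1 : c.toReal * (D N).M ≤ (D N).n k := by
    have := (ENNReal.le_div_iff_mul_le (Or.inl hM') (Or.inl hMt)).1 hN1.le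
    have := ENNReal.toReal_mono (ENNReal.natCast_ne_top _) this
    simpa [ENNReal.toReal_mul] using this
  have e2 : ((D N).n k : ℝ) ≤ C.toReal * (D N).M := by
    have := (ENNReal.div_le_iff_le_mul (Or.inl hM') (Or.inl hMt)).1 hN2.le
    have := ENNReal.toReal_mono (ENNReal.mul_ne_top hC.ne hMt) this
    simpa [ENNReal.toReal_mul] using this
  have hcp : 0 < c.toReal := ENNReal.toReal_pos hc0.ne' hct
  constructor
  · exact e2.trans (by gcongr; exact le_max_left _ _)
  · calc ((D N).M : ℝ) ≤ c.toReal⁻¹ * (D N).n k := by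
          rw [← div_eq_inv_mul, le_div_iff₀ hcp]; linarith
      _ ≤ _ := by gcongr; exact le_max_right _ _

/-- N is the sum of K cluster sizes, each at most a multiple of M, and M is at most a multiple of
any one of them. -/
theorem ProportionalGrowth.exists_uniform (h : ProportionalGrowth D) :
    ∃ κ : ℝ, 1 ≤ κ ∧ ∀ᶠ N : ℕ in atTop, ∀ k,
      (N : ℝ) ≤ κ * (D N).n k ∧ ((D N).M : ℝ) ≤ κ * (D N).n k := by
  choose κ hκ using h.exists_le
  set κ₀ : ℝ := 1 + ∑ k, |κ k| with hκ₀
  have hle : ∀ k, κ k ≤ κ₀ := fun k => by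
    have := Finset.single_le_sum (f := fun k => |κ k|) (fun k _ => abs_nonneg _)
      (Finset.mem_univ k)
    linarith [le_abs_self (κ k)]
  have h1 : 1 ≤ κ₀ := by
    have : 0 ≤ ∑ k, |κ k| := Finset.sum_nonneg fun k _ => abs_nonneg _
    linarith
  refine ⟨K * κ₀ ^ 2 + κ₀, by nlinarith [sq_nonneg κ₀, (Nat.cast_nonneg K : (0 : ℝ) ≤ K)], ?_⟩
  filter_upwards [eventually_all.2 hκ] with N hN k
  have hM : ((D N).M : ℝ) ≤ κ₀ * (D N).n k :=
    (hN k).2.trans (by gcongr; exact hle k)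
  have hn0 : (0 : ℝ) ≤ (D N).n k := by positivity
  constructor
  · have hs : (N : ℝ) = ∑ l, ((D N).n l : ℝ) := by
      rw [← Nat.cast_sum, (D N).sum_n]
    have h2 : (N : ℝ) ≤ K * (κ₀ * (κ₀ * (D N).n k)) := by
      rw [hs]
      refine (Finset.sum_le_sum fun l _ => (hN l).1.trans
        (show _ ≤ κ₀ * (κ₀ * (D N).n k) from ?_)).trans ?_
      · calc _ ≤ κ₀ * ((D N).M : ℝ) := by gcongr; exact hle l
          _ ≤ _ := by gcongr
      · simp
    nlinarith [mul_nonneg (zero_le_one.trans h1) hn0]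
  · nlinarith [mul_nonneg (mul_nonneg (Nat.cast_nonneg K : (0 : ℝ) ≤ K) (sq_nonneg κ₀)) hn0]

end Asymptotics

/-! ### Bounds on the normalised data of a setup -/

namespace Setup

variable {K N : ℕ} (D : Setup K N) {z : Fin K → ℝ}

theorem shift_lowerBdd_inv (hz : ∀ k, z k < 0) {B : ℝ} (hB : ∑ k, (-z k)⁻¹ ≤ B) (k : Fin K) :
    LowerBdd B⁻¹ (D.shift z k) := by
  have hp : ∀ k, 0 < (-z k)⁻¹ := fun k => inv_pos.2 (by linarith [hz k])
  have h1 : (-z k)⁻¹ ≤ B :=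
    (Finset.single_le_sum (f := fun k => (-z k)⁻¹) (fun k _ => (hp k).le)
      (Finset.mem_univ k)).trans hB
  refine (D.shift_lowerBdd k).mono ?_
  rw [← inv_inv (-z k)]
  exact inv_anti₀ (hp k) h1

/-- Any single setup admits some constants, with no uniformity in N. This serves to obtain tameness,
hence integrability, also at the small N about which the asymptotic hypotheses say nothing. -/
theorem exists_bdd (hz : ∀ k, z k < 0) (R : ℝ) : ∃ B β, R ≤ B ∧ D.Bdd z B β := by
  have hp : 0 ≤ ∑ k, (-z k)⁻¹ := Finset.sum_nonneg fun k _ => inv_nonneg.2 (by linarith [hz k])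
  set s : ℝ := ∑ k, ∑ j, (‖D.fam D.A k j‖ + ‖D.fam D.B k j‖) with hs
  have hs1 : ∀ k j, ‖D.fam D.A k j‖ + ‖D.fam D.B k j‖ ≤ s := by
    intro k j
    refine le_trans ?_ (Finset.single_le_sum (f := fun k => ∑ j, (‖D.fam D.A k j‖ +
      ‖D.fam D.B k j‖)) (fun k _ => by positivity) (Finset.mem_univ k))
    exact Finset.single_le_sum (f := fun j => ‖D.fam D.A k j‖ + ‖D.fam D.B k j‖)
      (fun j _ => by positivity) (Finset.mem_univ j)
  have hs0 : 0 ≤ s := by positivity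
  have hn : ∀ k, (D.n k : ℝ) ≤ N := fun k => by
    have : D.n k ≤ ∑ k, D.n k := Finset.single_le_sum (fun _ _ => Nat.zero_le _)
      (Finset.mem_univ k)
    rw [D.sum_n] at this
    exact_mod_cast this
  have hN : 0 ≤ (N : ℝ) * (1 + s) ^ 2 := by positivity
  have hM : 0 ≤ (D.M : ℝ) * (1 + s) ^ 2 := by positivity
  refine ⟨1 + |R| + ∑ k, (-z k)⁻¹ + N * (1 + s) ^ 2 + D.M * (1 + s) ^ 2, 1 + s, ?_, fun k => ?_,
    fun k j => ?_⟩
  · linarith [le_abs_self R]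
  · refine ⟨by linarith [abs_nonneg R], by linarith,
      D.shift_lowerBdd_inv hz (by linarith [abs_nonneg R]) k, fun j => ?_, ?_, ?_⟩
    · linarith [hs1 k j, norm_nonneg (D.fam D.B k j)]
    · rw [Fintype.card_fin]
      have := mul_le_mul_of_nonneg_right (hn k) (sq_nonneg (1 + s))
      linarith [abs_nonneg R]
    · rw [Fintype.card_fin]
      linarith [abs_nonneg R]
  · linarith [hs1 k j, norm_nonneg (D.fam D.A k j)]

theorem norm_fam_le {P : D.Corr} {C κ : ℝ} (hC : 0 ≤ C) (hP : ∀ j, ‖P j‖ ≤ C)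
    (hN : 1 ≤ N) (k : Fin K) (hk : (N : ℝ) ≤ κ * D.n k) (j : Fin D.M) :
    ‖D.fam P k j‖ ≤ C * √κ / √N := by
  have hN' : (1 : ℝ) ≤ N := by exact_mod_cast hN
  have hn : (0 : ℝ) < D.n k := by
    rcases (Nat.cast_nonneg (D.n k) : (0 : ℝ) ≤ D.n k).lt_or_eq with h | h
    · exact h
    · rw [← h, mul_zero] at hk
      linarith
  have hκ : 0 ≤ κ := by
    by_contra hneg
    push Not at hneg
    nlinarith
  have h1 : √N ≤ √κ * √(D.n k) := by
    rw [← Real.sqrt_mul hκ]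
    exact Real.sqrt_le_sqrt hk
  have hsN : 0 < √(N : ℝ) := Real.sqrt_pos.2 (by linarith)
  have hsn : 0 < √(D.n k : ℝ) := Real.sqrt_pos.2 hn
  unfold fam scale
  rw [norm_smul, norm_div, norm_one, Complex.norm_real, Real.norm_of_nonneg hsn.le]
  calc _ ≤ 1 / √(D.n k : ℝ) * C := by
        gcongr
        exact (D.norm_rows_le _ k).trans (hP j)
    _ ≤ √κ / √N * C := by
        refine mul_le_mul_of_nonneg_right ?_ hC
        rw [div_le_div_iff₀ hsn hsN]
        linarith
    _ = _ := by ring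

end Setup

/-- Here β = C√κ/√N, and B collects 1, the prescribed R, the inverse gaps, and C²κ², which dominates
both N_k β² ≤ C²κ and M β² ≤ C²κ². The parameter R lets B also dominate the norms of the test
matrices. -/
theorem eventually_bdd {K : ℕ} {D : ∀ N, Setup K N} (hA1 : ProportionalGrowth D)
    (hAB : BoundedCorrelation D) {z : Fin K → ℝ} (hz : ∀ k, z k < 0) (R : ℝ) :
    ∃ B C : ℝ, R ≤ B ∧ ∀ᶠ N : ℕ in atTop, ∃ β, β ≤ C / √N ∧ (D N).Bdd z B β := by
  obtain ⟨κ, hκ, hg⟩ := hA1.exists_uniform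
  obtain ⟨C₀, hC₀⟩ := hAB
  have hp : 0 ≤ ∑ k, (-z k)⁻¹ := Finset.sum_nonneg fun k _ => inv_nonneg.2 (by linarith [hz k])
  set C : ℝ := 1 + |C₀| with hC
  have hC1 : 1 ≤ C := by linarith [abs_nonneg C₀]
  have hC0 : C₀ ≤ C := by linarith [le_abs_self C₀]
  have hq : 0 ≤ C ^ 2 * κ ^ 2 := by positivity
  refine ⟨1 + |R| + ∑ k, (-z k)⁻¹ + C ^ 2 * κ ^ 2, C * √κ, by linarith [le_abs_self R], ?_⟩
  filter_upwards [hg, hC₀, eventually_ge_atTop 1] with N hN hCN hN1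
  have hN' : (1 : ℝ) ≤ N := by exact_mod_cast hN1
  have hsN : 0 < √(N : ℝ) := Real.sqrt_pos.2 (by linarith)
  have hsq : (C * √κ / √N) ^ 2 = C ^ 2 * κ / N := by
    rw [div_pow, mul_pow, Real.sq_sqrt (by linarith), Real.sq_sqrt (by linarith)]
  refine ⟨C * √κ / √N, le_rfl, fun k => ⟨by linarith [abs_nonneg R], ?_,
    (D N).shift_lowerBdd_inv hz (by linarith [abs_nonneg R]) k,
    (D N).norm_fam_le (by linarith) (fun j => (hCN j).1.trans hC0) hN1 k (hN k).1, ?_, ?_⟩,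
    fun k => (D N).norm_fam_le (by linarith) (fun j => (hCN j).2.trans hC0) hN1 k (hN k).1⟩
  · have : 0 < √κ := Real.sqrt_pos.2 (by linarith)
    positivity
  all_goals
    have hn : ((D N).n k : ℝ) ≤ N := by
      have : (D N).n k ≤ ∑ k, (D N).n k := Finset.single_le_sum (fun _ _ => Nat.zero_le _)
        (Finset.mem_univ k)
      rw [(D N).sum_n] at this
      exact_mod_cast this
    rw [Fintype.card_fin, hsq]
  · have h1 : ((D N).n k : ℝ) * (C ^ 2 * κ / N) ≤ N * (C ^ 2 * κ / N) := by gcongr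
    have h2 : (N : ℝ) * (C ^ 2 * κ / N) = C ^ 2 * κ := by field_simp
    have h3 : C ^ 2 * κ ≤ C ^ 2 * κ ^ 2 := by gcongr; nlinarith
    linarith [abs_nonneg R]
  · have h1 : ((D N).M : ℝ) * (C ^ 2 * κ / N) ≤ (κ * N) * (C ^ 2 * κ / N) := by
      gcongr
      exact (hN k).2.trans (by gcongr)
    have h2 : (κ * (N : ℝ)) * (C ^ 2 * κ / N) = C ^ 2 * κ ^ 2 := by field_simp
    linarith [abs_nonneg R]

/-- Non-asymptotic bounds under `Setup.Bdd` give the equivalence `≍_{1/2}`. -/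
theorem stochEquiv_of_bdd {K : ℕ} {D : ∀ N, Setup K N}
    {Ω : Type*} [MeasurableSpace Ω] {P : Measure Ω} [IsProbabilityMeasure P]
    {x : ∀ N, ∀ j : Fin (D N).M, Ω → Fin ((D N).d j) → ℂ} (hx : IsGaussianSample D P x)
    (hA1 : ProportionalGrowth D) (hAB : BoundedCorrelation D)
    {z : Fin K → ℝ} (hz : ∀ k, z k < 0) {f : ∀ N, (D N).Sample → ℂ} {fbar : ℕ → ℂ} (R : ℝ)
    (h : ∀ N B β, R ≤ B → (D N).Bdd z B β → GaussianApprox (errConst B) β (f N) (fbar N)) :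
    StochEquiv P (1 / 2) (fun N ω => f N (fun j => x N j ω)) fbar := by
  obtain ⟨B, C, hRB, hev⟩ := eventually_bdd hA1 hAB hz R
  refine hx.stochEquiv (c := errConst B) (C := C) (fun N => ?_) ?_
  · obtain ⟨B, β, hB, hb⟩ := (D N).exists_bdd hz R
    exact (h N B β hB hb).tame
  · filter_upwards [hev] with N ⟨β, hβ, hb⟩
    exact ⟨β, hβ, h N B β hRB hb⟩

theorem mainTheorem2 {K : ℕ} (D : ∀ N, Setup K N)
    {Ω : Type*} [MeasurableSpace Ω] (P : Measure Ω) [IsProbabilityMeasure P]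
    (x : ∀ N, ∀ j : Fin (D N).M, Ω → Fin ((D N).d j) → ℂ) (hx : IsGaussianSample D P x)
    (hA1 : ProportionalGrowth D) (hAB : BoundedCorrelation D)
    (z : Fin K → ℝ) (hz : ∀ k, z k < 0) :
    (∀ N k, ∃! δ : Fin (D N).M → ℝ, (D N).IsSolution z k δ) ∧
    ∀ δ : ∀ N, Fin K → Fin (D N).M → ℝ, (∀ N k, (D N).IsSolution z k (δ N k)) →
      (∀ N k j, (D N).block ((D N).Om j) k k ≠ 0 → 0 < δ N k j) ∧
      (∀ N k l, IsUnit (1 - (D N).Gam z (δ N) k l * (D N).F (δ N) k * (D N).F (δ N) l)) ∧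
      (∀ k, ∀ a : ∀ N, Matrix (Fin ((D N).n k)) (Fin ((D N).n k)) ℂ,
        (∃ C : ℝ, ∀ N, ‖a N‖ ≤ C) →
        StochEquiv P (1 / 2) (fun N ω => (D N).digamma z k (a N) (fun j => x N j ω))
          (fun N => (D N).digammaBar z (δ N) k (a N))) ∧
      (∀ k l, ∀ a : ∀ N, Matrix (Fin ((D N).n l)) (Fin ((D N).n k)) ℂ,
        (∃ C : ℝ, ∀ N, ‖a N‖ ≤ C) →
        (∀ b : ∀ N, Fin (D N).M → ℂ, (∃ C : ℝ, ∀ N, ‖Matrix.diagonal (b N)‖ ≤ C) →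
          StochEquiv P (1 / 2)
              (fun N ω => (D N).Phi (D N).B z k l (a N) (b N) (fun j => x N j ω))
              (fun N => (D N).PhiBar z (δ N) (D N).B k l (a N) (b N)) ∧
          StochEquiv P (1 / 2)
              (fun N ω => (D N).Phi (D N).A z k l (a N) (b N) (fun j => x N j ω))
              (fun N => (D N).PhiBar z (δ N) (D N).A k l (a N) (b N))) ∧
        (∀ b : ∀ N, Matrix (Fin ((D N).n k)) (Fin ((D N).n l)) ℂ, (∃ C : ℝ, ∀ N, ‖b N‖ ≤ C) →
          StochEquiv P (1 / 2)
            (fun N ω => (D N).Upsilon z k l (a N) (b N) (fun j => x N j ω))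
            (fun N => (D N).UpsilonBar z (δ N) k l (a N) (b N))) ∧
        StochEquiv P (1 / 2)
          (fun N ω => (D N).Pi (D N).B z k l (a N) (fun j => x N j ω))
          (fun N => (D N).PiBar z (δ N) (D N).B k l (a N)) ∧
        StochEquiv P (1 / 2)
          (fun N ω => (D N).Pi (D N).A z k l (a N) (fun j => x N j ω))
          (fun N => (D N).PiBar z (δ N) (D N).A k l (a N))) := by
  refine ⟨fun N k => (D N).existsUnique_isSolution hz k, fun δ hδ =>
    ⟨fun N k j hj => (D N).solution_pos hz (hδ N k) hj,
      fun N k l => (D N).isUnit_one_sub hz (hδ N) k l, ?_, ?_⟩⟩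
  · rintro k a ⟨C, hC⟩
    exact stochEquiv_of_bdd hx hA1 hAB hz C fun N B β hB hb =>
      Setup.digamma_approx hb hz (hδ N) ((hC N).trans hB)
  · rintro k l a ⟨C, hC⟩
    refine ⟨?_, ?_, ?_, ?_⟩
    · rintro b ⟨C', hC'⟩
      -- The spectral norm of diag(b) dominates each entry of b.
      have hab : ∀ N B, C' * C ≤ B → ∀ j, ‖b N j‖ * ‖a N‖ ≤ B := fun N B hB j => by
        have h1 : ‖b N j‖ ≤ C' := by
          have := norm_entry_le (Matrix.diagonal (b N)) j j
          rw [Matrix.diagonal_apply_eq] at this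
          exact this.trans (hC' N)
        exact (mul_le_mul h1 (hC N) (norm_nonneg _) ((norm_nonneg _).trans h1)).trans hB
      exact ⟨stochEquiv_of_bdd hx hA1 hAB hz (C' * C) fun N B β hB hb =>
          Setup.Phi_approx hb hz (hδ N) (hab N B hB) hb.norm_le,
        stochEquiv_of_bdd hx hA1 hAB hz (C' * C) fun N B β hB hb =>
          Setup.Phi_approx hb hz (hδ N) (hab N B hB) fun k => (hb.bounded k).norm_le⟩
    · rintro b ⟨C', hC'⟩
      exact stochEquiv_of_bdd hx hA1 hAB hz (max C C') fun N B β hB hb =>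
        Setup.Upsilon_approx hb hz (hδ N) ((hC N).trans ((le_max_left _ _).trans hB))
          ((hC' N).trans ((le_max_right _ _).trans hB))
    · exact stochEquiv_of_bdd hx hA1 hAB hz C fun N B β hB hb =>
        Setup.Pi_approx hb hz (hδ N) ((hC N).trans hB) hb.norm_le
    · exact stochEquiv_of_bdd hx hA1 hAB hz C fun N B β hB hb =>
        Setup.Pi_approx hb hz (hδ N) ((hC N).trans hB) fun k => (hb.bounded k).norm_le
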